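/- Let $\mathcal F$ be the set of finite subgroups of the circle group $\mathbb T$. Let $\mathcal E_a$ be the rational differential graded ring with many objects (category enriched over rational chain complexes) with one object for each $H\in\mathcal F$ and one object $\mathbb T$, such that, for $H\ne K$ in $\mathcal F$: - $\mathcal E_a(H,H)$ has basis $\mathrm{id}_H$ (degree $0$) and $m_1^H$ (degree $1$); $\mathcal E_a(H,K)=0$; $\mathcal E_a(H,\mathbb T)$ has basis $f_0^H$ (degree $0$); $\mathcal E_a(\mathbb T,H)$ has basis $g_n^H$, $n\ge 1$ (degree $n$); $\mathcal E_a(\mathbb T,\mathbb T)$ has basis $\mathrm{id}_{\mathbb T}$ (degree $0$) and $i_{2n+1}^H$ for $H\in\mathcal F$, $n\ge 0$ (degree $2n+1$); - $d(g_{2n+1}^H)=g_{2n}^H$ for $n\ge 1$, and all other basis elements are cycles; - the nonzero products of basis elements, apart from those with identities, are $g_1^Hf_0^H=m_1^H$, $f_0^Hg_{2n+1}^H=i_{2n+1}^H$ and $m_1^Hg_{2n+1}^H=g_1^Hi_{2n+1}^H=g_{2n+2}^H$ for $n\ge 0$. Let $\mathrm{Ho}(\mathcal Mod\text{-}\mathcal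 E_a)$ be the localization of the category of right differential graded $\mathcal E_a$-modules at the quasi-isomorphisms, with suspension $(\Sigma M)_n=M_{n-1}$, $d_{\Sigma M}=-d_M$, and with the triangles isomorphic to some $M\xrightarrow{f}N\to C_f\to\Sigma M$, where $C_f=\Sigma M\oplus N$ has $d(x,y)=(-dx,\,dy+f(x))$, the map $N\to C_f$ is the inclusion and the map $C_f\to\Sigma M$ is the projection. Let $F_G=\mathcal E_a(-,G)$. A cycle $z\in\mathcal E_a(G,G')_p$ gives, by left multiplication, a map $[z]\colon\Sigma^pF_G\to F_{G'}$ in $\mathrm{Ho}(\mathcal Mod\text{-}\mathcal E_a)$. For composable maps $A_m\xrightarrow{f_m}\cdots\xrightarrow{f_1}A_0$ in this category, an object $X$ is in $\{f_1,\dots,f_m\}$ if there are a sequence $0\cong F_0X\to F_1X\to\cdots\to F_{m+1}X=X$ and triangles $F_kX\to F_{k+1}X\xrightarrow{\pi_{k+1}}\Sigma^kA_k\xrightarrow{\delta_k}\Sigma F_kX$ for $0\le k\le m$ with $\Sigma\pi_k\circ\delta_k=\Sigma^kf_k$ for $1\le k\le m$; put $\sigma'_X\colon A_0\cong F_1X\to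 X$ and $\sigma_X=\pi_{m+1}\colon X\to\Sigma^mA_m$. The Toda bracket $\langle f,f_1,\dots,f_m,h\rangle_T$ of $Z\xrightarrow{h}A_m\to\cdots\to A_0\xrightarrow{f}Y$ is the set of all composites $\alpha\beta\colon\Sigma^mZ\to Y$ with $X\in\{f_1,\dots,f_m\}$, $\beta\colon\Sigma^mZ\to X$, $\alpha\colon X\to Y$, $\sigma_X\beta=\Sigma^mh$ and $\alpha\sigma'_X=f$. The Massey product $\langle\gamma_1,\dots,\gamma_N\rangle$ of $\gamma_i\in H_{p_i}\mathcal E_a(G_i,G_{i-1})$ is the set of classes of the cycles $\sum_{r=1}^{N-1}\epsilon(a_{1,r})a_{r+1,N}$, where $\epsilon(a)=(-1)^{\deg a+1}a$ and where $a_{i,j}\in\mathcal E_a(G_j,G_{i-1})_{p_i+\dots+p_j+j-i}$, for $1\le i\le j\le N$ and $(i,j)\neq(1,N)$, are such that $a_{i,i}$ is a cycle in $\gamma_i$ and $d(a_{i,j})=\sum_{r=i}^{j-1}\epsilon(a_{i,r})a_{r+1,j}$. **Proposition.** For all $H\in\mathcal F$ and $n\ge 0$, in $\mathrm{Ho}(\mathcal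 Mod\text{-}\mathcal E_a)$, $$\langle[f_0^H],[m_1^H],\Sigma[m_1^H],\dots,\Sigma^{n-1}[m_1^H],\Sigma^n[g_1^H]\rangle_T=\{[f_0^Hg_{2n+1}^H]\}=\{[i_{2n+1}^H]\}$$ as sets of maps $\Sigma^n\Sigma^{n+1}F_{\mathbb T}=\Sigma^{2n+1}F_{\mathbb T}\to F_{\mathbb T}$. These brackets agree up to sign with the Massey products in $H_*\mathcal E_a$: $$\langle[f_0^H],\underbrace{[m_1^H],\dots,[m_1^H]}_{n},[g_1^H]\rangle=\{-[i_{2n+1}^H]\},$$ so that the bracket consists of the maps $[z]$ for the cycles $z$ such that $-[z]$ is in the Massey product. (For $n=0$ both are two-fold, with no $m_1^H$.) -/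

import Mathlib

open CategoryTheory CategoryTheory.Pretriangulated CategoryTheory.Limits

noncomputable section

namespace DG

/-! ### Rational chain complexes -/

/-- An (unbounded) rational chain complex: a rational vector space with an internal `ℤ`-grading
and a differential of degree `-1`. -/
structure Cx where
  V : Type
  [grp : AddCommGroup V]
  [mod : Module ℚ V]
  gr : ℤ → Submodule ℚ V
  internal : DirectSum.IsInternal gr
  d : V →ₗ[ℚ] V
  d_mem : ∀ {n : ℤ} {x : V}, x ∈ gr n → d x ∈ gr (n - 1)
  d_d : ∀ x : V, d (d x) = 0

attribute [instance] Cx.grp Cx.mod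

namespace Cx

/-- Chain maps (of degree `0`). -/
@[ext]
structure Hom (C D : Cx) where
  lin : C.V →ₗ[ℚ] D.V
  map_gr : ∀ {n : ℤ} {x : C.V}, x ∈ C.gr n → lin x ∈ D.gr n
  map_d : ∀ x : C.V, lin (C.d x) = D.d (lin x)

variable (C D : Cx)

/-- The cycles of degree `n`. -/
def cycles (n : ℤ) : Submodule ℚ C.V := C.gr n ⊓ LinearMap.ker C.d

/-- The boundaries of degree `n`. -/
def boundaries (n : ℤ) : Submodule ℚ C.V := (C.gr (n + 1)).map C.d

/-- The homology in degree `n`. -/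
abbrev H (n : ℤ) : Type := C.cycles n ⧸ (C.boundaries n).submoduleOf (C.cycles n)

/-- The homology class of a cycle. -/
def cls {C : Cx} {n : ℤ} (z : C.cycles n) : C.H n := Submodule.Quotient.mk z

variable {C D}

/-- The map induced on cycles by a chain map. -/
def Hom.mapCycles (f : Hom C D) (n : ℤ) : C.cycles n →ₗ[ℚ] D.cycles n :=
  f.lin.restrict (fun x hx => ⟨f.map_gr hx.1, by
    have h := f.map_d x
    rw [LinearMap.mem_ker.1 hx.2, map_zero] at h
    exact h.symm⟩)

/-- The map induced on homology by a chain map. -/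
def Hom.mapH (f : Hom C D) (n : ℤ) : C.H n →ₗ[ℚ] D.H n :=
  Submodule.mapQ _ _ (f.mapCycles n) (by
    rintro ⟨x, hx⟩ ⟨y, hy, hyx⟩
    exact ⟨f.lin y, f.map_gr hy, by
      rw [← f.map_d, hyx]; rfl⟩)

/-- A chain map is a quasi-isomorphism if it induces isomorphisms in homology. -/
def Hom.IsQuasiIso (f : Hom C D) : Prop := ∀ n : ℤ, Function.Bijective (f.mapH n)

lemma cls_eq_zero_iff {n : ℤ} (z : C.cycles n) :
    cls z = 0 ↔ ∃ y ∈ C.gr (n + 1), C.d y = z := by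
  unfold cls
  rw [Submodule.Quotient.mk_eq_zero]
  exact Iff.rfl

lemma Hom.isQuasiIso_iff (f : Hom C D) : f.IsQuasiIso ↔ ∀ n : ℤ,
    (∀ x ∈ C.gr n, C.d x = 0 → (∃ y ∈ D.gr (n + 1), D.d y = f.lin x) →
      ∃ w ∈ C.gr (n + 1), C.d w = x) ∧
    (∀ y ∈ D.gr n, D.d y = 0 → ∃ x ∈ C.gr n, C.d x = 0 ∧
      ∃ w ∈ D.gr (n + 1), D.d w = f.lin x - y) := by
  refine forall_congr' fun n => and_congr ?_ ?_
  · rw [injective_iff_map_eq_zero]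
    constructor
    · rintro h x hx hdx hy
      exact (cls_eq_zero_iff (⟨x, hx, hdx⟩ : C.cycles n)).1
        (h (cls ⟨x, hx, hdx⟩) ((cls_eq_zero_iff (f.mapCycles n ⟨x, hx, hdx⟩)).2 hy))
    · rintro h a ha
      obtain ⟨⟨x, hx, hdx⟩, rfl⟩ := Submodule.Quotient.mk_surjective _ a
      exact (cls_eq_zero_iff (⟨x, hx, hdx⟩ : C.cycles n)).2
        (h x hx hdx ((cls_eq_zero_iff (f.mapCycles n ⟨x, hx, hdx⟩)).1 ha))
  · constructor
    · rintro h y hy hdy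
      obtain ⟨a, ha⟩ := h (cls ⟨y, hy, hdy⟩)
      obtain ⟨⟨x, hx, hdx⟩, rfl⟩ := Submodule.Quotient.mk_surjective _ a
      refine ⟨x, hx, hdx, ?_⟩
      have h2 : cls (f.mapCycles n ⟨x, hx, hdx⟩ - ⟨y, hy, hdy⟩) = 0 :=
        (sub_eq_zero.2 ha : _)
      exact (cls_eq_zero_iff _).1 h2
    · rintro h b
      obtain ⟨⟨y, hy, hdy⟩, rfl⟩ := Submodule.Quotient.mk_surjective _ b
      obtain ⟨x, hx, hdx, hw⟩ := h y hy hdy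
      refine ⟨cls ⟨x, hx, hdx⟩, ?_⟩
      have h2 : cls (f.mapCycles n ⟨x, hx, hdx⟩ - ⟨y, hy, hdy⟩) = 0 :=
        (cls_eq_zero_iff _).2 hw
      exact sub_eq_zero.1 h2

lemma Hom.map_units_d (f : Hom C D) (u : ℤˣ) (x : C.V) :
    f.lin (u • C.d x) = u • D.d (f.lin x) := by
  rw [Units.smul_def, Units.smul_def, map_zsmul, f.map_d]

lemma internal_shift (C : Cx) (k : ℤ) : DirectSum.IsInternal (fun n => C.gr (n - k)) := by
  have h := (DirectSum.isInternal_submodule_iff_iSupIndep_and_iSup_eq_top _).1 C.internal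
  refine (DirectSum.isInternal_submodule_iff_iSupIndep_and_iSup_eq_top _).2
    ⟨h.1.comp (f := fun n : ℤ => n - k) (sub_left_injective), ?_⟩
  rw [← h.2]
  exact (Equiv.subRight k).iSup_comp (g := C.gr)

lemma internal_prod (C D : Cx) (k : ℤ) :
    DirectSum.IsInternal (fun n => (C.gr (n - k)).prod (D.gr n)) := by
  have h := (DirectSum.isInternal_submodule_iff_iSupIndep_and_iSup_eq_top _).1 (C.internal_shift k)
  have h' := (DirectSum.isInternal_submodule_iff_iSupIndep_and_iSup_eq_top _).1 D.internal
  refine (DirectSum.isInternal_submodule_iff_iSupIndep_and_iSup_eq_top _).2 ⟨?_, ?_⟩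
  · intro i
    rw [Submodule.disjoint_def]
    rintro ⟨x, y⟩ ⟨hx, hy⟩ h2
    have h3 : (⨆ (j) (_ : j ≠ i), (C.gr (j - k)).prod (D.gr j)) ≤
        (⨆ (j) (_ : j ≠ i), C.gr (j - k)).prod (⨆ (j) (_ : j ≠ i), D.gr j) :=
      iSup₂_le fun j hj => Submodule.prod_mono
        (le_iSup₂_of_le (f := fun j (_ : j ≠ i) => C.gr (j - k)) j hj le_rfl)
        (le_iSup₂_of_le (f := fun j (_ : j ≠ i) => D.gr j) j hj le_rfl)
    have h4 := h3 h2
    exact Prod.ext (Submodule.disjoint_def.1 (h.1 i) x hx h4.1)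
      (Submodule.disjoint_def.1 (h'.1 i) y hy h4.2)
  · rw [eq_top_iff]
    have h1 : (⨆ n, C.gr (n - k)) ≤
        (⨆ n, (C.gr (n - k)).prod (D.gr n)).comap (LinearMap.inl ℚ C.V D.V) :=
      iSup_le fun n x hx => le_iSup (fun n => (C.gr (n - k)).prod (D.gr n)) n
        ⟨hx, zero_mem _⟩
    have h2 : (⨆ n, D.gr n) ≤
        (⨆ n, (C.gr (n - k)).prod (D.gr n)).comap (LinearMap.inr ℚ C.V D.V) :=
      iSup_le fun n x hx => le_iSup (fun n => (C.gr (n - k)).prod (D.gr n)) n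
        ⟨zero_mem _, hx⟩
    rintro ⟨x, y⟩ -
    have hx : x ∈ ⨆ n, C.gr (n - k) := by rw [h.2]; trivial
    have hy : y ∈ ⨆ n, D.gr n := by rw [h'.2]; trivial
    have h3 := add_mem (Submodule.mem_comap.1 (h1 hx)) (Submodule.mem_comap.1 (@h2 y hy))
    simpa only [LinearMap.inl_apply, LinearMap.inr_apply, Prod.mk_add_mk, add_zero, zero_add]
      using h3

/-- The `k`-fold suspension: `(Σ^k C)_n = C_{n-k}` with differential `(-1)^k d`. -/
def shift (C : Cx) (k : ℤ) : Cx where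
  V := C.V
  gr n := C.gr (n - k)
  internal := C.internal_shift k
  d := k.negOnePow • C.d
  d_mem {n x} hx := by
    have h := C.d_mem hx
    rw [show n - k - 1 = n - 1 - k by ring] at h
    rw [LinearMap.smul_apply, Units.smul_def]
    exact zsmul_mem h _
  d_d x := by
    change k.negOnePow • C.d (k.negOnePow • C.d x) = 0
    rw [Units.smul_def, Units.smul_def, map_zsmul, C.d_d, smul_zero, smul_zero]

/-- The cone of `f : C ⟶ D`: it is `ΣC ⊕ D` with differential `(x, y) ↦ (-dx, dy + f x)`. -/
def cone (f : Hom C D) : Cx where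
  V := C.V × D.V
  gr n := (C.gr (n - 1)).prod (D.gr n)
  internal := internal_prod C D 1
  d := (-(C.d ∘ₗ LinearMap.fst ℚ C.V D.V)).prod
    (D.d ∘ₗ LinearMap.snd ℚ C.V D.V + f.lin ∘ₗ LinearMap.fst ℚ C.V D.V)
  d_mem {n x} hx := ⟨neg_mem (C.d_mem hx.1), add_mem (D.d_mem hx.2) (f.map_gr hx.1)⟩
  d_d x := by
    simp [C.d_d, D.d_d, f.map_d]

end Cx

/-! ### Rational differential graded rings with many objects and their modules -/

/-- A rational differential graded ring with set of objects `ι`, that is, a category enriched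
over rational chain complexes. `Hom a b` is the complex of morphisms from `a` to `b`
and `comp x y` is the composite `x ∘ y`, also written `x y`. -/
structure DGRing (ι : Type) where
  Hom : ι → ι → Cx
  comp : ∀ {a b c : ι}, (Hom b c).V →ₗ[ℚ] (Hom a b).V →ₗ[ℚ] (Hom a c).V
  one : ∀ a : ι, (Hom a a).V
  comp_mem : ∀ {a b c : ι} {m n : ℤ} {x : (Hom b c).V} {y : (Hom a b).V},
    x ∈ (Hom b c).gr m → y ∈ (Hom a b).gr n → comp x y ∈ (Hom a c).gr (m + n)
  one_mem : ∀ a : ι, one a ∈ (Hom a a).gr 0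
  assoc : ∀ {a b c e : ι} (x : (Hom c e).V) (y : (Hom b c).V) (z : (Hom a b).V),
    comp (comp x y) z = comp x (comp y z)
  one_comp : ∀ {a b : ι} (x : (Hom a b).V), comp (one b) x = x
  comp_one : ∀ {a b : ι} (x : (Hom a b).V), comp x (one a) = x
  leibniz : ∀ {a b c : ι} {m : ℤ} {x : (Hom b c).V} (y : (Hom a b).V), x ∈ (Hom b c).gr m →
    (Hom a c).d (comp x y) = comp ((Hom b c).d x) y + m.negOnePow • comp x ((Hom a b).d y)

variable {ι : Type}

/-- A right differential graded module over `R`. -/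
structure DGMod (R : DGRing ι) where
  obj : ι → Cx
  act : ∀ {a b : ι}, (obj b).V →ₗ[ℚ] (R.Hom a b).V →ₗ[ℚ] (obj a).V
  act_mem : ∀ {a b : ι} {m n : ℤ} {x : (obj b).V} {r : (R.Hom a b).V},
    x ∈ (obj b).gr m → r ∈ (R.Hom a b).gr n → act x r ∈ (obj a).gr (m + n)
  act_one : ∀ {a : ι} (x : (obj a).V), act x (R.one a) = x
  act_comp : ∀ {a b c : ι} (x : (obj c).V) (r : (R.Hom b c).V) (s : (R.Hom a b).V),
    act x (R.comp r s) = act (act x r) s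
  leibniz : ∀ {a b : ι} {m : ℤ} {x : (obj b).V} (r : (R.Hom a b).V), x ∈ (obj b).gr m →
    (obj a).d (act x r) = act ((obj b).d x) r + m.negOnePow • act x ((R.Hom a b).d r)

namespace DGMod

variable {R : DGRing ι}

/-- Morphisms of right differential graded modules. -/
@[ext]
structure Hom (M N : DGMod R) where
  app : ∀ a : ι, Cx.Hom (M.obj a) (N.obj a)
  map_act : ∀ {a b : ι} (x : (M.obj b).V) (r : (R.Hom a b).V),
    (app a).lin (M.act x r) = N.act ((app b).lin x) r

/-- The category `Mod-R` of right differential graded `R`-modules. -/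
instance : Category (DGMod R) where
  Hom := Hom
  id M :=
    { app := fun a => ⟨LinearMap.id, fun h => h, fun _ => rfl⟩
      map_act := fun _ _ => rfl }
  comp f g :=
    { app := fun a => ⟨(g.app a).lin ∘ₗ (f.app a).lin,
        fun h => (g.app a).map_gr ((f.app a).map_gr h), fun x => by
          simp [(f.app a).map_d, (g.app a).map_d]⟩
      map_act := fun x r => by simp [f.map_act, g.map_act] }

@[ext]
lemma hom_ext {M N : DGMod R} {f g : M ⟶ N}
    (h : ∀ a x, (f.app a).lin x = (g.app a).lin x) : f = g :=
  Hom.ext (funext fun a => Cx.Hom.ext (LinearMap.ext (h a)))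

@[simp]
lemma id_apply (M : DGMod R) (a : ι) (x : (M.obj a).V) :
    (Hom.app (𝟙 M) a).lin x = x := rfl

@[simp]
lemma comp_apply {M N P : DGMod R} (f : M ⟶ N) (g : N ⟶ P) (a : ι) (x : (M.obj a).V) :
    (Hom.app (f ≫ g) a).lin x = (g.app a).lin ((f.app a).lin x) := rfl

/-- The `k`-fold suspension of a right module; the action is unchanged. -/
def susp (M : DGMod R) (k : ℤ) : DGMod R where
  obj a := (M.obj a).shift k
  act := M.act
  act_mem {a b m n x r} hx hr := by
    have h := M.act_mem hx hr
    rw [show m - k + n = m + n - k by ring] at h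
    exact h
  act_one := M.act_one
  act_comp := M.act_comp
  leibniz {a b m x} r hx := by
    have h := M.leibniz r hx
    change k.negOnePow • (M.obj a).d (M.act x r) =
      M.act (k.negOnePow • (M.obj b).d x) r + m.negOnePow • M.act x ((R.Hom a b).d r)
    rw [h, smul_add, smul_smul, ← Int.negOnePow_add, show k + (m - k) = m by ring]
    simp only [Units.smul_def, map_zsmul, LinearMap.smul_apply]

/-- The suspension functors on `Mod-R`. -/
def suspFunctor (R : DGRing ι) (k : ℤ) : DGMod R ⥤ DGMod R where
  obj M := M.susp k
  map f :=
    { app := fun a => ⟨(f.app a).lin, fun h => (f.app a).map_gr h,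
        (f.app a).map_units_d k.negOnePow⟩
      map_act := fun x r => f.map_act x r }

lemma eqToHom_susp_apply (M : DGMod R) {k l : ℤ} (h : k = l) (e : M.susp k = M.susp l) (a : ι)
    (x : (M.obj a).V) : (Hom.app (eqToHom e) a).lin x = x := by
  subst h
  rfl

lemma susp_zero_gr (M : DGMod R) (a : ι) (n : ℤ) :
    ((M.susp 0).obj a).gr n = (M.obj a).gr n :=
  congrArg (M.obj a).gr (sub_zero n)

lemma susp_zero_d (M : DGMod R) (a : ι) (x : (M.obj a).V) :
    ((M.susp 0).obj a).d x = (M.obj a).d x := by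
  change (0 : ℤ).negOnePow • (M.obj a).d x = (M.obj a).d x
  rw [Int.negOnePow_zero, one_smul]

lemma susp_add_gr (M : DGMod R) (k l : ℤ) (a : ι) (n : ℤ) :
    ((M.susp (k + l)).obj a).gr n = (((M.susp k).susp l).obj a).gr n :=
  congrArg (M.obj a).gr (by ring)

lemma susp_add_d (M : DGMod R) (k l : ℤ) (a : ι) (x : (M.obj a).V) :
    ((M.susp (k + l)).obj a).d x = (((M.susp k).susp l).obj a).d x := by
  change (k + l).negOnePow • (M.obj a).d x = l.negOnePow • k.negOnePow • (M.obj a).d x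
  rw [smul_smul, ← Int.negOnePow_add, add_comm]

/-- The isomorphism `Σ^0 M ≅ M` given by the identity on the underlying vector spaces. -/
def suspZero (M : DGMod R) : M.susp 0 ≅ M where
  hom :=
    { app := fun a => ⟨LinearMap.id, fun {n _} h => M.susp_zero_gr a n ▸ h, M.susp_zero_d a⟩
      map_act := fun _ _ => rfl }
  inv :=
    { app := fun a => ⟨LinearMap.id, fun {n x} h => (M.susp_zero_gr a n).symm ▸ h,
        fun x => (M.susp_zero_d a x).symm⟩
      map_act := fun _ _ => rfl }

/-- The isomorphism `Σ^{k+l} M ≅ Σ^l Σ^k M` given by the identity on the underlying vector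
spaces. -/
def suspAdd (M : DGMod R) (k l : ℤ) : M.susp (k + l) ≅ (M.susp k).susp l where
  hom :=
    { app := fun a => ⟨LinearMap.id, fun {n _} h => M.susp_add_gr k l a n ▸ h, M.susp_add_d k l a⟩
      map_act := fun _ _ => rfl }
  inv :=
    { app := fun a => ⟨LinearMap.id, fun {n x} h => (M.susp_add_gr k l a n).symm ▸ h,
        fun x => (M.susp_add_d k l a x).symm⟩
      map_act := fun _ _ => rfl }

/-- The shift on `Mod-R`: `M⟦k⟧` is the suspension `Σ^k M`. All structure isomorphisms are the
identity on underlying vector spaces. -/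
instance : HasShift (DGMod R) ℤ := hasShiftMk _ _
  { F := suspFunctor R
    zero := NatIso.ofComponents suspZero (fun _ => rfl)
    add := fun k l => NatIso.ofComponents (fun M => suspAdd M k l) (fun _ => rfl)
    assoc_hom_app := fun m₁ m₂ m₃ M => by
      ext a x
      exact (eqToHom_susp_apply M (add_assoc m₁ m₂ m₃) _ a x).symm
    zero_add_hom_app := fun n M => by
      ext a x
      exact (eqToHom_susp_apply M (zero_add n) _ a x).symm
    add_zero_hom_app := fun n M => by
      ext a x
      exact (eqToHom_susp_apply M (add_zero n) _ a x).symm }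

/-- The quasi-isomorphisms of right modules: the weak equivalences of `Mod-R`. -/
def quasiIso (R : DGRing ι) : MorphismProperty (DGMod R) :=
  fun _ _ f => ∀ a : ι, (f.app a).IsQuasiIso

instance (R : DGRing ι) : (quasiIso R).IsCompatibleWithShift ℤ where
  condition k := by
    ext M N f
    refine forall_congr' fun a => ?_
    rw [Cx.Hom.isQuasiIso_iff, Cx.Hom.isQuasiIso_iff]
    refine Iff.trans (forall_congr' fun n => ?_) (Equiv.subRight k).forall_congr_right
    change ((∀ x ∈ (M.obj a).gr (n - k), k.negOnePow • (M.obj a).d x = 0 →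
        (∃ y ∈ (N.obj a).gr (n + 1 - k), k.negOnePow • (N.obj a).d y = (f.app a).lin x) →
        ∃ w ∈ (M.obj a).gr (n + 1 - k), k.negOnePow • (M.obj a).d w = x) ∧
      (∀ y ∈ (N.obj a).gr (n - k), k.negOnePow • (N.obj a).d y = 0 →
        ∃ x ∈ (M.obj a).gr (n - k), k.negOnePow • (M.obj a).d x = 0 ∧
        ∃ w ∈ (N.obj a).gr (n + 1 - k), k.negOnePow • (N.obj a).d w = (f.app a).lin x - y)) ↔ _
    rw [show n + 1 - k = n - k + 1 by ring]
    simp only [Equiv.subRight_apply]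
    rcases Int.even_or_odd k with hk | hk
    · rw [Int.negOnePow_even k hk]
      simp only [one_smul]
    · rw [Int.negOnePow_odd k hk]
      have key : ∀ (C : Cx) (m : ℤ) (x : C.V), (∃ w ∈ C.gr m, (-1 : ℤˣ) • C.d w = x) ↔
          ∃ w ∈ C.gr m, C.d w = x := fun C m x =>
        ⟨fun ⟨w, hw, h⟩ => ⟨-w, neg_mem hw, by simpa [Units.smul_def] using h⟩,
          fun ⟨w, hw, h⟩ => ⟨-w, neg_mem hw, by simpa [Units.smul_def] using h⟩⟩
      simp only [key]
      simp only [Units.smul_def, Units.val_neg, Units.val_one, neg_smul, one_smul, neg_eq_zero]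

/-- The componentwise action of `R` on `M ⊕ N`. -/
def prodAct (M N : DGMod R) (a b : ι) : ((M.obj b).V × (N.obj b).V) →ₗ[ℚ] (R.Hom a b).V →ₗ[ℚ]
    ((M.obj a).V × (N.obj a).V) :=
  LinearMap.mk₂ ℚ (fun x r => (M.act x.1 r, N.act x.2 r))
    (by simp) (by simp) (by simp) (by simp)

/-- The cone of a morphism of right modules. -/
def cone {M N : DGMod R} (f : M ⟶ N) : DGMod R where
  obj a := Cx.cone (f.app a)
  act {a b} := prodAct M N a b
  act_mem {a b m n x r} hx hr := by
    have h := M.act_mem hx.1 hr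
    rw [show m - 1 + n = m + n - 1 by ring] at h
    exact ⟨h, N.act_mem hx.2 hr⟩
  act_one x := Prod.ext (M.act_one _) (N.act_one _)
  act_comp x r s := Prod.ext (M.act_comp _ r s) (N.act_comp _ r s)
  leibniz {a b m x} r hx := by
    have h := M.leibniz r hx.1
    have h' := N.leibniz r hx.2
    refine Prod.ext ?_ ?_
    · change -(M.obj a).d (M.act x.1 r) =
        M.act (-(M.obj b).d x.1) r + m.negOnePow • M.act x.1 ((R.Hom a b).d r)
      rw [h, Int.negOnePow_sub, Int.negOnePow_one, mul_neg, mul_one, Units.neg_smul, map_neg,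
        LinearMap.neg_apply]
      abel
    · change (N.obj a).d (N.act x.2 r) + (f.app a).lin (M.act x.1 r) =
        N.act ((N.obj b).d x.2 + (f.app b).lin x.1) r + m.negOnePow • N.act x.2 ((R.Hom a b).d r)
      rw [h', f.map_act, map_add, LinearMap.add_apply]
      abel

/-- The triangle `M ⟶ N ⟶ cone f ⟶ ΣM` of `f`, given by `f`, `y ↦ (0, y)` and `(x, y) ↦ x`. -/
def coneTriangle {M N : DGMod R} (f : M ⟶ N) : Triangle (DGMod R) :=
  Triangle.mk f
    (Z := cone f)
    { app := fun a => ⟨LinearMap.inr ℚ (M.obj a).V (N.obj a).V, fun h => ⟨zero_mem _, h⟩,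
        fun x => by
          change ((0 : (M.obj a).V), (N.obj a).d x) =
            (-(M.obj a).d 0, (N.obj a).d x + (f.app a).lin 0)
          simp⟩
      map_act := fun {a b} x r => by
        change ((0 : (M.obj a).V), N.act x r) = (M.act 0 r, N.act x r)
        simp }
    { app := fun a => ⟨LinearMap.fst ℚ (M.obj a).V (N.obj a).V, fun h => h.1, fun x => by
        change -(M.obj a).d x.1 = (1 : ℤ).negOnePow • (M.obj a).d x.1
        rw [Int.negOnePow_one, Units.neg_smul, one_smul]⟩
      map_act := fun x r => rfl }

/-- The free right module `F_G = R(-, G)`. -/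
def free (R : DGRing ι) (G : ι) : DGMod R where
  obj a := R.Hom a G
  act := R.comp
  act_mem := R.comp_mem
  act_one := R.comp_one
  act_comp x r s := (R.assoc x r s).symm
  leibniz r hx := R.leibniz r hx

/-- The morphism `Σ^p F_G ⟶ F_G'` given by left multiplication by a cycle in `R(G, G')_p`. -/
def leftMul {G G' : ι} {p : ℤ} (z : (R.Hom G G').cycles p) :
    (free R G)⟦p⟧ ⟶ free R G' where
  app a :=
    { lin := R.comp z.1
      map_gr := fun {n x} hx => by
        have h := R.comp_mem z.2.1 hx
        rw [show p + (n - p) = n by ring] at h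
        exact h
      map_d := fun (x : (R.Hom a G).V) => by
        have h := R.leibniz x z.2.1
        rw [LinearMap.mem_ker.1 z.2.2, map_zero, LinearMap.zero_apply, zero_add] at h
        change R.comp z.1 (p.negOnePow • (R.Hom a G).d x) = (R.Hom a G').d (R.comp z.1 x)
        rw [h, Units.smul_def, Units.smul_def, map_zsmul] }
  map_act x r := (R.assoc z.1 x r).symm

end DGMod

/-! ### The homotopy category -/

/-- The homotopy category `Ho(Mod-R)`: the localization of `Mod-R` at the quasi-isomorphisms. -/
abbrev Ho (R : DGRing ι) := (DGMod.quasiIso R).Localization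

/-- The distinguished triangles of `Ho(Mod-R)`: those isomorphic to the triangle of a cone. -/
def hoTriangles (R : DGRing ι) : Set (Triangle (Ho R)) :=
  {T | ∃ (M N : DGMod R) (f : M ⟶ N),
    Nonempty (T ≅ (DGMod.quasiIso R).Q.mapTriangle.obj (DGMod.coneTriangle f))}

/-- The free module `F_G` as an object of `Ho(Mod-R)`. -/
def hoFree (R : DGRing ι) (G : ι) : Ho R := (DGMod.quasiIso R).Q.obj (DGMod.free R G)

/-- The homotopy class of maps `[z] : Σ^p F_G ⟶ F_G'` of a cycle `z ∈ R(G, G')_p`. -/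
def hoMap {R : DGRing ι} {G G' : ι} {p : ℤ} (z : (R.Hom G G').cycles p) :
    (hoFree R G)⟦p⟧ ⟶ hoFree R G' :=
  ((DGMod.quasiIso R).Q.commShiftIso p).inv.app (DGMod.free R G) ≫
    (DGMod.quasiIso R).Q.map (DGMod.leftMul z)

/-! ### Higher Toda brackets -/

section Toda

universe v u

variable {C : Type u} [Category.{v} C] [HasShift C ℤ]

/-- The `k`-fold suspension `Σ^k h : Σ^{k+1} X ⟶ Σ^k Y` of `h : ΣX ⟶ Y`. -/
def suspMap {X Y : C} (h : X⟦(1 : ℤ)⟧ ⟶ Y) (k : ℕ) : X⟦((k + 1 : ℕ) : ℤ)⟧ ⟶ Y⟦(k : ℤ)⟧ :=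
  (shiftFunctorAdd' C 1 (k : ℤ) ((k + 1 : ℕ) : ℤ) (by push_cast; ring)).hom.app X ≫
    h⟦(k : ℤ)⟧'

/-- The `(m+1)`-filtered objects which are elements of `{f_1, …, f_m}`, for composable maps
`A_m ⟶ ⋯ ⟶ A_1 ⟶ A_0` in a category with shift and class `T` of distinguished triangles;
`f k` is the map `f_{k+1} : A_{k+1} ⟶ A_k`. Only `A_k` for `k ≤ m` and `f k` for `k < m` matter,
as do only the terms `F k` for `k ≤ m + 1` and the triangles with index `k ≤ m`.
The cofiber of `F k ⟶ F (k+1)` is identified with `Σ^k A_k`, as part of the data. -/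
structure FilteredObj (T : Set (Triangle C)) (A : ℕ → C) (f : ∀ k, A (k + 1) ⟶ A k) (m : ℕ) where
  F : ℕ → C
  isZero : IsZero (F 0)
  i : ∀ k, F k ⟶ F (k + 1)
  π : ∀ k : ℕ, F (k + 1) ⟶ (A k)⟦(k : ℤ)⟧
  δ : ∀ k : ℕ, (A k)⟦(k : ℤ)⟧ ⟶ (F k)⟦(1 : ℤ)⟧
  mem : ∀ k : ℕ, k ≤ m → Triangle.mk (i k) (π k) (δ k) ∈ T
  isIso : IsIso (π 0)
  comp_eq : ∀ k : ℕ, k < m → δ (k + 1) ≫ (π k)⟦(1 : ℤ)⟧' =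
    (f k)⟦((k + 1 : ℕ) : ℤ)⟧' ≫
      (shiftFunctorAdd' C (k : ℤ) 1 ((k + 1 : ℕ) : ℤ) (by push_cast; ring)).hom.app (A k)

namespace FilteredObj

variable {T : Set (Triangle C)} {A : ℕ → C} {f : ∀ k, A (k + 1) ⟶ A k} {m : ℕ}

/-- The underlying object `X = F_{m+1} X`. -/
def X (x : FilteredObj T A f m) : C := x.F (m + 1)

/-- The composite `F_1 X ⟶ F_{k+1} X`. -/
def incl (x : FilteredObj T A f m) : ∀ k : ℕ, x.F 1 ⟶ x.F (k + 1)
  | 0 => 𝟙 _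
  | k + 1 => incl x k ≫ x.i (k + 1)

/-- The map `σ'_X : A_0 ≅ F_1 X ⟶ X`. -/
def σ' (x : FilteredObj T A f m) : A 0 ⟶ x.X :=
  (shiftFunctorZero C ℤ).inv.app (A 0) ≫ (@inv _ _ _ _ (x.π 0) x.isIso) ≫ x.incl m

/-- The map `σ_X : X = F_{m+1} X ⟶ F_{m+1} X / F_m X ≅ Σ^m A_m`. -/
def σ (x : FilteredObj T A f m) : x.X ⟶ (A m)⟦(m : ℤ)⟧ := x.π m

end FilteredObj

/-- The `(m+2)`-fold Toda bracket `⟨f, g_1, …, g_m, h⟩` of the composable sequence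
`Z --h--> A_m --g_m--> ⋯ --g_1--> A_0 --f--> Y`, as a set of maps `Σ^m Z ⟶ Y`. -/
def todaBracket (T : Set (Triangle C)) {Y Z : C} (A : ℕ → C) (f : A 0 ⟶ Y)
    (g : ∀ k, A (k + 1) ⟶ A k) (m : ℕ) (h : Z ⟶ A m) : Set (Z⟦(m : ℤ)⟧ ⟶ Y) :=
  {θ | ∃ (x : FilteredObj T A g m) (β : Z⟦(m : ℤ)⟧ ⟶ x.X) (α : x.X ⟶ Y),
    β ≫ x.σ = h⟦(m : ℤ)⟧' ∧ x.σ' ≫ α = f ∧ θ = β ≫ α}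

end Toda

/-! ### Massey products -/

/-- `ε(a) = (-1)^{deg a + 1} a` for `a` of degree `n`. -/
def eps {V : Type} [AddCommGroup V] (n : ℤ) (a : V) : V := (n + 1).negOnePow • a

/-- The degree of the entry of a defining system which belongs to `⟨γ_i, …, γ_{j-1}⟩`, where
`γ_k` has degree `p k`. -/
def degA (p : ℕ → ℤ) (i j : ℕ) : ℤ := ∑ k ∈ Finset.Ico i j, p k + (j - i - 1)

/-- The degree of the entry of a defining system which belongs to `⟨γf, γ_0, …, γ_{j-1}⟩`, where
`γf` has degree `pf` and `γ_k` has degree `p k`. -/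
def degU (pf : ℤ) (p : ℕ → ℤ) (j : ℕ) : ℤ := pf + ∑ k ∈ Finset.range j, p k + j

/-- The degree of the entry of a defining system which belongs to `⟨γ_i, …, γ_{m-1}, γl⟩`, where
`γl` has degree `pl` and `γ_k` has degree `p k`. -/
def degV (pl : ℤ) (p : ℕ → ℤ) (m i : ℕ) : ℤ := ∑ k ∈ Finset.Ico i m, p k + pl + (m - i)

/-- A defining system for the `(m+2)`-fold Massey product `⟨γf, γ_0, …, γ_{m-1}, γl⟩` of classes
`γf ∈ H_{pf} R(G_0, y)`, `γ_k ∈ H_{p_k} R(G_{k+1}, G_k)` and `γl ∈ H_{pl} R(z, G_m)`.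
The upper triangular matrix of elements (without its corner entry) is written in blocks: `u` is
its first row, `v` its last column and `a` the rest. The diagonal consists of
`u 0, a 0 1, …, a (m-1) m, v m`, and `u j`, `a i j`, `v i` belong to the sub-products
`⟨γf, γ_0, …, γ_{j-1}⟩`, `⟨γ_i, …, γ_{j-1}⟩` and `⟨γ_i, …, γ_{m-1}, γl⟩`.
Only the indices `i < j ≤ m` matter. -/
structure DefiningSystem (R : DGRing ι) {y z : ι} {pf pl : ℤ} (G : ℕ → ι) (p : ℕ → ℤ)
    (γf : (R.Hom (G 0) y).H pf) (γ : ∀ k, (R.Hom (G (k + 1)) (G k)).H (p k)) (m : ℕ)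
    (γl : (R.Hom z (G m)).H pl) where
  u : ∀ j, (R.Hom (G j) y).V
  a : ∀ i j, (R.Hom (G j) (G i)).V
  v : ∀ i, (R.Hom z (G i)).V
  u_mem : ∀ j, j ≤ m → u j ∈ (R.Hom (G j) y).gr (degU pf p j)
  a_mem : ∀ i j, i < j → j ≤ m → a i j ∈ (R.Hom (G j) (G i)).gr (degA p i j)
  v_mem : ∀ i, i ≤ m → v i ∈ (R.Hom z (G i)).gr (degV pl p m i)
  u_rep : ∃ c : (R.Hom (G 0) y).cycles pf, c.1 = u 0 ∧ Cx.cls c = γf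
  a_rep : ∀ k, k < m → ∃ c : (R.Hom (G (k + 1)) (G k)).cycles (p k),
    c.1 = a k (k + 1) ∧ Cx.cls c = γ k
  v_rep : ∃ c : (R.Hom z (G m)).cycles pl, c.1 = v m ∧ Cx.cls c = γl
  d_u : ∀ j, j ≤ m → (R.Hom (G j) y).d (u j) =
    ∑ r ∈ Finset.range j, R.comp (eps (degU pf p r) (u r)) (a r j)
  d_a : ∀ i j, i < j → j ≤ m → (R.Hom (G j) (G i)).d (a i j) =
    ∑ r ∈ Finset.Ioo i j, R.comp (eps (degA p i r) (a i r)) (a r j)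
  d_v : ∀ i, i ≤ m → (R.Hom z (G i)).d (v i) =
    ∑ r ∈ Finset.Ioc i m, R.comp (eps (degA p i r) (a i r)) (v r)

/-- The `(m+2)`-fold Massey product `⟨γf, γ_0, …, γ_{m-1}, γl⟩`: the set of homology classes of
the cycles associated to all defining systems. -/
def masseyProduct (R : DGRing ι) {y z : ι} {pf pl : ℤ} (G : ℕ → ι) (p : ℕ → ℤ)
    (γf : (R.Hom (G 0) y).H pf) (γ : ∀ k, (R.Hom (G (k + 1)) (G k)).H (p k)) (m : ℕ)
    (γl : (R.Hom z (G m)).H pl) (q : ℤ) (_hq : pf + ∑ k ∈ Finset.range m, p k + pl + m = q) :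
    Set ((R.Hom z y).H q) :=
  {γ' | ∃ (s : DefiningSystem R G p γf γ m γl) (c : (R.Hom z y).cycles q),
    c.1 = ∑ r ∈ Finset.range (m + 1), R.comp (eps (degU pf p r) (s.u r)) (s.v r) ∧
      Cx.cls c = γ'}

/-! ### The differential graded ring `E_a` -/

/-- The finite subgroups of the circle group. -/
abbrev FinSub : Type := {H : Subgroup Circle // Finite H}

/-- The objects of `E_a`: one for each finite subgroup of the circle group, and one for the
circle group itself. -/
inductive Cell : Type
  | fin (H : FinSub)
  | circ

/-- The homogeneous basis of the morphisms of `E_a`: `id_H`, `m_1^H`, `f_0^H`, `g_{2k+1}^H`,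
`g_{2k+2}^H`, `i_{2k+1}^H` and the identity of the circle group. There are no basis elements
between distinct finite subgroups. -/
inductive EBasis : Cell → Cell → Type
  | idH {K H : FinSub} (h : K = H) : EBasis (.fin K) (.fin H)
  | m₁ {K H : FinSub} (h : K = H) : EBasis (.fin K) (.fin H)
  | f₀ (H : FinSub) : EBasis (.fin H) .circ
  | gOdd (H : FinSub) (k : ℕ) : EBasis .circ (.fin H)
  | gEven (H : FinSub) (k : ℕ) : EBasis .circ (.fin H)
  | idT : EBasis .circ .circ
  | iOdd (H : FinSub) (k : ℕ) : EBasis .circ .circ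

namespace EBasis

/-- The degrees of the basis elements. -/
def deg : ∀ {a b : Cell}, EBasis a b → ℤ
  | _, _, idH _ => 0
  | _, _, m₁ _ => 1
  | _, _, f₀ _ => 0
  | _, _, gOdd _ k => 2 * k + 1
  | _, _, gEven _ k => 2 * k + 2
  | _, _, idT => 0
  | _, _, iOdd _ k => 2 * k + 1

/-- The differential: `d g_{2k+3} = g_{2k+2}`; all other basis elements are cycles. -/
def diff : ∀ {a b : Cell}, EBasis a b → (EBasis a b →₀ ℚ)
  | _, _, gOdd H (k + 1) => Finsupp.single (gEven H k) 1
  | _, _, _ => 0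

open Classical in
/-- The composites `x y` of basis elements. Apart from those with identities, the nonzero ones are
`m_1 g_{2k+1} = g_{2k+2}`, `f_0 g_{2k+1} = i_{2k+1}`, `g_1 f_0 = m_1`, `g_1 i_{2k+1} = g_{2k+2}`
for a fixed finite subgroup. -/
def mul : ∀ {a b c : Cell}, EBasis b c → EBasis a b → (EBasis a c →₀ ℚ)
  | _, _, _, idH h, idH h' => Finsupp.single (idH (h'.trans h)) 1
  | _, _, _, idH h, m₁ h' => Finsupp.single (m₁ (h'.trans h)) 1
  | _, _, _, idH (H := H) _, gOdd _ k => Finsupp.single (gOdd H k) 1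
  | _, _, _, idH (H := H) _, gEven _ k => Finsupp.single (gEven H k) 1
  | _, _, _, m₁ h, idH h' => Finsupp.single (m₁ (h'.trans h)) 1
  | _, _, _, m₁ (H := H) _, gOdd _ k => Finsupp.single (gEven H k) 1
  | _, _, _, f₀ _, idH (K := K) _ => Finsupp.single (f₀ K) 1
  | _, _, _, f₀ H, gOdd _ k => Finsupp.single (iOdd H k) 1
  | _, _, _, gOdd H 0, f₀ K => if h : K = H then Finsupp.single (m₁ h) 1 else 0
  | _, _, _, gOdd H 0, iOdd K k => if K = H then Finsupp.single (gEven H k) 1 else 0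
  | _, _, _, gOdd H k, idT => Finsupp.single (gOdd H k) 1
  | _, _, _, gEven H k, idT => Finsupp.single (gEven H k) 1
  | _, _, _, idT, f₀ H => Finsupp.single (f₀ H) 1
  | _, _, _, idT, idT => Finsupp.single idT 1
  | _, _, _, idT, iOdd H k => Finsupp.single (iOdd H k) 1
  | _, _, _, iOdd H k, idT => Finsupp.single (iOdd H k) 1
  | _, _, _, _, _ => 0

/-- The identities. -/
def one : ∀ a : Cell, EBasis a a
  | .fin _ => idH rfl
  | .circ => idT

end EBasis

/-- The rational chain complex `E_a(a, b)`. -/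
def eHom (a b : Cell) : Cx where
  V := EBasis a b →₀ ℚ
  gr n := Finsupp.supported ℚ ℚ {x | x.deg = n}
  internal := by
    refine (DirectSum.isInternal_submodule_iff_iSupIndep_and_iSup_eq_top _).2 ⟨?_, ?_⟩
    · intro n
      have h : (⨆ (j : ℤ) (_ : j ≠ n), Finsupp.supported ℚ ℚ {x : EBasis a b | x.deg = j}) ≤
          Finsupp.supported ℚ ℚ {x : EBasis a b | x.deg ≠ n} :=
        iSup₂_le fun j hj => Finsupp.supported_mono fun x hx => by
          change x.deg ≠ n
          have hx' : x.deg = j := hx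
          rwa [hx']
      exact (Finsupp.disjoint_supported_supported
        (Set.disjoint_left.2 fun (x : EBasis a b) (hx : x.deg = n) (hx' : x.deg ≠ n) =>
          hx' hx)).mono_right h
    · rw [← Finsupp.supported_iUnion, eq_top_iff, ← Finsupp.supported_univ]
      exact Finsupp.supported_mono fun x _ => by simp
  d := Finsupp.linearCombination ℚ EBasis.diff
  d_mem {n x} hx := by
    rw [Finsupp.linearCombination_apply]
    refine Submodule.sum_mem _ fun b hb => Submodule.smul_mem _ _ ?_
    have hb' : b.deg = n := hx hb
    subst hb'
    rcases b with _ | _ | _ | ⟨H, _ | k⟩ | _ | _ | _ <;> try exact zero_mem _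
    refine Finsupp.single_mem_supported ℚ _ ?_
    simp [EBasis.deg]
    ring
  d_d x := by
    induction x using Finsupp.induction_linear with
    | zero => simp
    | add x y hx hy => simp only [map_add, hx, hy, add_zero]
    | single b r =>
      rcases b with _ | _ | _ | ⟨H, _ | k⟩ | _ | _ | _ <;> simp [EBasis.diff]

/-- Composition in `E_a`. -/
def eComp {a b c : Cell} : (EBasis b c →₀ ℚ) →ₗ[ℚ] (EBasis a b →₀ ℚ) →ₗ[ℚ] (EBasis a c →₀ ℚ) :=
  Finsupp.linearCombination ℚ fun x => Finsupp.linearCombination ℚ fun y => EBasis.mul x y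

@[simp]
lemma eComp_single {a b c : Cell} (x : EBasis b c) (y : EBasis a b) (r s : ℚ) :
    eComp (Finsupp.single x r) (Finsupp.single y s) = r • s • EBasis.mul x y := by
  simp [eComp]

lemma mul_mem {a b c : Cell} (x : EBasis b c) (y : EBasis a b) :
    EBasis.mul x y ∈ (eHom a c).gr (x.deg + y.deg) := by
  classical
  have key : ∀ (w : EBasis a c) (n : ℤ), w.deg = n → Finsupp.single w 1 ∈ (eHom a c).gr n :=
    fun w n h => Finsupp.single_mem_supported ℚ _ h
  rcases x with _ | _ | _ | ⟨H, _ | k⟩ | _ | _ | _ <;> cases y <;> try exact zero_mem _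
  all_goals simp only [EBasis.mul]
  all_goals try split_ifs
  all_goals try exact zero_mem _
  all_goals
    refine key _ _ ?_
    simp [EBasis.deg]
    try ring

set_option maxHeartbeats 2000000 in
lemma mul_assoc' {a b c e : Cell} (x : EBasis c e) (y : EBasis b c) (z : EBasis a b) :
    eComp (EBasis.mul x y) (Finsupp.single z 1) = eComp (Finsupp.single x 1) (EBasis.mul y z) := by
  classical
  rcases x with h | h | _ | ⟨_, _ | _⟩ | _ | _ | _ <;>
    rcases y with h' | h' | _ | ⟨_, _ | _⟩ | _ | _ | _ <;>
    rcases z with h'' | h'' | _ | ⟨_, _ | _⟩ | _ | _ | _ <;>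
    (try subst h) <;> (try subst h') <;> (try subst h'') <;>
    simp only [EBasis.mul] <;> (try split_ifs) <;> (try subst_vars) <;>
    simp_all [EBasis.mul]

lemma one_mul' {a b : Cell} (x : EBasis a b) :
    EBasis.mul (EBasis.one b) x = Finsupp.single x 1 := by
  rcases x with h | h | _ | _ | _ | _ | _ <;> simp [EBasis.mul, EBasis.one]

lemma mul_one' {a b : Cell} (x : EBasis a b) :
    EBasis.mul x (EBasis.one a) = Finsupp.single x 1 := by
  rcases x with h | h | _ | ⟨_, _ | _⟩ | _ | _ | _ <;> simp [EBasis.mul, EBasis.one]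

lemma leibniz' {a b c : Cell} (x : EBasis b c) (y : EBasis a b) :
    (eHom a c).d (EBasis.mul x y) = eComp (EBasis.diff x) (Finsupp.single y 1) +
      x.deg.negOnePow • eComp (Finsupp.single x 1) (EBasis.diff y) := by
  classical
  change Finsupp.linearCombination ℚ EBasis.diff (EBasis.mul x y) = _
  rcases x with h | h | _ | ⟨_, _ | _⟩ | _ | _ | _ <;>
    rcases y with h' | h' | _ | ⟨_, _ | _⟩ | _ | _ | _ <;>
    (try subst h) <;> (try subst h') <;>
    simp only [EBasis.mul, EBasis.diff] <;> (try split_ifs) <;> (try subst_vars) <;>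
    simp_all [EBasis.mul, EBasis.diff, EBasis.deg]

lemma eComp_mem {a b c : Cell} {m n : ℤ} {x : EBasis b c →₀ ℚ} {y : EBasis a b →₀ ℚ}
    (hx : x ∈ (eHom b c).gr m) (hy : y ∈ (eHom a b).gr n) :
    eComp x y ∈ (eHom a c).gr (m + n) := by
  rw [eComp, Finsupp.linearCombination_apply, Finsupp.sum, LinearMap.sum_apply]
  refine Submodule.sum_mem _ fun s hs => ?_
  rw [LinearMap.smul_apply, Finsupp.linearCombination_apply]
  refine Submodule.smul_mem _ _ (Submodule.sum_mem _ fun t ht => Submodule.smul_mem _ _ ?_)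
  have h1 : s.deg = m := hx hs
  have h2 : t.deg = n := hy ht
  rw [← h1, ← h2]
  exact mul_mem s t

lemma single_eq {a b : Cell} (x : EBasis a b) (r : ℚ) :
    Finsupp.single x r = r • Finsupp.single x 1 := by
  simp

lemma eComp_assoc {a b c e : Cell} (x : EBasis c e →₀ ℚ) (y : EBasis b c →₀ ℚ)
    (z : EBasis a b →₀ ℚ) : eComp (eComp x y) z = eComp x (eComp y z) := by
  induction x using Finsupp.induction_linear with
  | zero => simp
  | add x x' hx hx' => simp only [map_add, LinearMap.add_apply, hx, hx']
  | single x r =>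
    induction y using Finsupp.induction_linear with
    | zero => simp
    | add y y' hy hy' => simp only [map_add, LinearMap.add_apply, hy, hy']
    | single y s =>
      induction z using Finsupp.induction_linear with
      | zero => simp
      | add z z' hz hz' => simp only [map_add, hz, hz']
      | single z t =>
        have h := mul_assoc' x y z
        rw [eComp_single, eComp_single, single_eq z t, single_eq x r]
        simp only [map_smul, LinearMap.smul_apply, h]
        module

lemma eComp_leibniz {a b c : Cell} {m : ℤ} {x : EBasis b c →₀ ℚ} (y : EBasis a b →₀ ℚ)
    (hx : x ∈ (eHom b c).gr m) :
    Finsupp.linearCombination ℚ EBasis.diff (eComp x y) =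
      eComp (Finsupp.linearCombination ℚ EBasis.diff x) y +
        m.negOnePow • eComp x (Finsupp.linearCombination ℚ EBasis.diff y) := by
  rw [← Finsupp.sum_single x, Finsupp.sum]
  simp only [map_sum, LinearMap.sum_apply, Finset.smul_sum, ← Finset.sum_add_distrib]
  refine Finset.sum_congr rfl fun s hs => ?_
  have h1 : s.deg = m := hx hs
  subst h1
  rw [single_eq s]
  induction y using Finsupp.induction_linear with
  | zero => simp
  | add y y' hy hy' =>
    simp only [map_add, hy, hy', smul_add]
    abel
  | single t r =>
    have h : Finsupp.linearCombination ℚ EBasis.diff (EBasis.mul s t) = _ := leibniz' s t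
    rw [single_eq t]
    simp only [map_smul, LinearMap.smul_apply, eComp_single, one_smul, h,
      Finsupp.linearCombination_single, Units.smul_def]
    module

/-- The rational differential graded ring `E_a`. -/
def Ea : DGRing Cell where
  Hom := eHom
  comp := eComp
  one a := Finsupp.single (EBasis.one a) 1
  comp_mem hx hy := eComp_mem hx hy
  one_mem a := Finsupp.single_mem_supported ℚ _ (by cases a <;> rfl)
  assoc x y z := eComp_assoc x y z
  one_comp {a b} x := by
    change eComp _ x = x
    induction x using Finsupp.induction_linear with
    | zero => simp
    | add x x' hx hx' => simp only [map_add, hx, hx']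
    | single x r => simp [one_mul']
  comp_one {a b} x := by
    change eComp x _ = x
    induction x using Finsupp.induction_linear with
    | zero => simp
    | add x x' hx hx' => simp only [map_add, LinearMap.add_apply, hx, hx']
    | single x r => simp [mul_one']
  leibniz y hx := eComp_leibniz y hx

namespace Ea

/-- A cycle of degree `n` of `E_a` given by a basis element. -/
def basisCycle {a b : Cell} (x : EBasis a b) (n : ℤ) (hn : x.deg = n) (hx : x.diff = 0) :
    (Ea.Hom a b).cycles n :=
  ⟨Finsupp.single x 1, Finsupp.single_mem_supported ℚ _ hn, LinearMap.mem_ker.2 (by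
    change Finsupp.linearCombination ℚ EBasis.diff (Finsupp.single x 1) = 0
    simp [hx])⟩

variable (H : FinSub)

/-- The cycle `f_0^H`. -/
def f₀ : (Ea.Hom (.fin H) .circ).cycles 0 := basisCycle (.f₀ H) 0 rfl rfl

/-- The cycle `m_1^H`. -/
def m₁ : (Ea.Hom (.fin H) (.fin H)).cycles 1 := basisCycle (.m₁ rfl) 1 rfl rfl

/-- The element `g_{2n+1}^H`. -/
def g (n : ℕ) : (Ea.Hom .circ (.fin H)).V := Finsupp.single (EBasis.gOdd H n) 1

/-- The cycle `g_1^H`. -/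
def g₁ : (Ea.Hom .circ (.fin H)).cycles 1 :=
  basisCycle (.gOdd H 0) 1 (by simp [EBasis.deg]) rfl

/-- The cycle `i_{2n+1}^H`. -/
def i (n : ℕ) : (Ea.Hom .circ .circ).cycles (2 * n + 1) := basisCycle (.iOdd H n) _ rfl rfl

lemma f₀_comp_g (n : ℕ) : Ea.comp (f₀ H).1 (g H n) = (i H n).1 :=
  (eComp_single _ _ _ _).trans (by rw [one_smul, one_smul]; rfl)

/-- The cycle `f_0^H g_{2n+1}^H`. -/
def f₀g (n : ℕ) : (Ea.Hom .circ .circ).cycles (2 * n + 1) :=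
  ⟨Ea.comp (f₀ H).1 (g H n), by rw [f₀_comp_g]; exact (i H n).2⟩

end Ea

/-- A map `Σ^{2n+1} X ⟶ Y` viewed as a map `Σ^n Σ^{n+1} X ⟶ Y`. -/
def desuspMap {C : Type*} [Category* C] [HasShift C ℤ] {X Y : C} (n : ℕ)
    (h : X⟦(2 * n + 1 : ℤ)⟧ ⟶ Y) : X⟦((n + 1 : ℕ) : ℤ)⟧⟦(n : ℤ)⟧ ⟶ Y :=
  (shiftFunctorAdd' C ((n + 1 : ℕ) : ℤ) (n : ℤ) (2 * n + 1 : ℤ)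
    (by push_cast; ring)).inv.app X ≫ h

end DG

end

/-! Put m = m_1^H and `g n` = g_{2n+1}^H, so that m m = 0, d (g 0) = 0 and d (g (n+1)) = m (g n). An
object X of {[m], Σ[m], …} behaves like a module with cells e_0, …, e_n, where e_j has degree 2j and
d e_{j+1} = -e_j m. Then ∑ e_j (g (n-j)) is a cycle of degree 2n+1, because its boundary telescopes,
and it lifts the class e_n g_1 of the top quotient; so it is the value of β on the generator. A map
α : X ⟶ F_𝕋 extending f_0 sends e_0 to f_0, and sends e_j for j > 0 to an element of degree 2j of
E_a(H, 𝕋), which is concentrated in degree 0. Hence only f_0 g_{2n+1} survives in the composite.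

Two facts remove all choices. The homology of F_H at H and at 𝕋 vanishes in degrees ≥ 2, so F_k X
has no homology in degrees ≥ 2k and π_k is injective in those degrees (`filtration_ext`). And maps
out of a suspended free module in Ho are homology classes (`isGen_hoOne`, `IsGen.shift`), so they
can be compared on one generator.

An object of Ho has no preferred cells. They are replaced by twisted sequences x_0, …, x_L with d
x_{j+1} = -x_j m, taken up to homotopy. The set of homotopy classes is invariant under
quasi-isomorphisms (`seqFunctor_inverts`) and so makes sense in Ho. A twisted sequence extends over
a triangle (`exists_seqHo_succ`); iterating this gives `exists_seqHo`, and `comp_eq_desuspMap`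
concludes that each element of the bracket is the expected one. The bracket is nonempty by an
explicit tower of cell attachments (`towerObj`), with `exists_lift` providing β and `towerMap`
providing α.

For the Massey product, the degrees and the differential leave exactly one defining system, with
f_0, 0, 0, … in the first row, m next to the diagonal of the block `a`, and the g's in the last
column. Its only contribution is ε(f_0) g_{2n+1} = -i_{2n+1}, which is the source of the sign. -/

noncomputable section

/-! ### Total homology and its descent to the homotopy category. -/

namespace DG

namespace Cx

variable {C D : Cx}

/-! ### Homogeneous components -/

/-- The homogeneous component of degree `n`. -/
def proj (C : Cx) (n : ℤ) : C.V →ₗ[ℚ] C.V :=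
  letI := C.internal.chooseDecomposition
  (C.gr n).subtype ∘ₗ DirectSum.component ℚ ℤ (fun i => C.gr i) n ∘ₗ
    (DirectSum.decomposeLinearEquiv C.gr).toLinearMap

lemma proj_mem (n : ℤ) (x : C.V) : C.proj n x ∈ C.gr n := Subtype.mem _

lemma proj_same {n : ℤ} {x : C.V} (hx : x ∈ C.gr n) : C.proj n x = x :=
  letI := C.internal.chooseDecomposition
  DirectSum.decompose_of_mem_same C.gr hx

lemma proj_ne {m n : ℤ} {x : C.V} (hx : x ∈ C.gr m) (h : m ≠ n) : C.proj n x = 0 :=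
  letI := C.internal.chooseDecomposition
  DirectSum.decompose_of_mem_ne C.gr hx h

lemma exists_sum_proj (x : C.V) : ∃ S : Finset ℤ, ∑ n ∈ S, C.proj n x = x := by
  classical
  let := C.internal.chooseDecomposition
  exact ⟨_, DirectSum.sum_support_decompose C.gr x⟩

lemma proj_comm (L : C.V →ₗ[ℚ] D.V) (k : ℤ)
    (hL : ∀ (n : ℤ) (x : C.V), x ∈ C.gr n → L x ∈ D.gr (n + k)) (n : ℤ) (x : C.V) :
    D.proj (n + k) (L x) = L (C.proj n x) := by
  obtain ⟨S, hS⟩ := exists_sum_proj x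
  rw [← hS]
  simp only [map_sum]
  refine Finset.sum_congr rfl fun m _ => ?_
  by_cases h : m = n
  · subst h
    rw [proj_same (hL _ _ (proj_mem m x)), proj_same (proj_mem m x)]
  · rw [proj_ne (hL _ _ (proj_mem m x)) (by omega), proj_ne (proj_mem m x) h, map_zero]

lemma d_proj (n : ℤ) (x : C.V) : C.d (C.proj (n + 1) x) = C.proj n (C.d x) := by
  have h := proj_comm C.d (-1) (fun n x hx => C.d_mem hx) (n + 1) x
  rw [← h, show n + 1 + -1 = n by ring]

lemma d_proj_eq_zero {x : C.V} (hx : C.d x = 0) (n : ℤ) : C.d (C.proj n x) = 0 := by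
  have h := d_proj (n - 1) x
  rw [sub_add_cancel, hx, map_zero] at h
  exact h

lemma Hom.map_proj (f : Hom C D) (n : ℤ) (x : C.V) :
    f.lin (C.proj n x) = D.proj n (f.lin x) := by
  have h := proj_comm f.lin 0 (fun n x hx => by rw [add_zero]; exact f.map_gr hx) n x
  rw [← h, add_zero]

/-- Total homology forgets degrees, so the primitives found there may be inhomogeneous. As `d` is
homogeneous, the component of degree `p + 1` serves as well. -/
lemma exists_homogeneous_primitive {p : ℤ} {x : C.V} (hx : x ∈ C.gr p) (h : ∃ w, C.d w = x) :
    ∃ w ∈ C.gr (p + 1), C.d w = x := by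
  obtain ⟨w, hw⟩ := h
  exact ⟨C.proj (p + 1) w, proj_mem _ _, by rw [d_proj, hw, proj_same hx]⟩

/-! ### Total homology -/

/-- The total homology of a complex. -/
abbrev HT (C : Cx) : Type :=
  LinearMap.ker C.d ⧸ (LinearMap.range C.d).submoduleOf (LinearMap.ker C.d)

/-- The class of a cycle in total homology. -/
def hcl (x : C.V) (hx : C.d x = 0) : C.HT := Submodule.Quotient.mk ⟨x, hx⟩

lemma exists_hcl (c : C.HT) : ∃ (x : C.V) (hx : C.d x = 0), hcl x hx = c := by
  obtain ⟨⟨x, hx⟩, rfl⟩ := Submodule.Quotient.mk_surjective _ c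
  exact ⟨x, hx, rfl⟩

lemma hcl_eq_iff {x y : C.V} {hx : C.d x = 0} {hy : C.d y = 0} :
    hcl x hx = hcl y hy ↔ ∃ w, C.d w = x - y := by
  unfold hcl
  rw [Submodule.Quotient.eq]
  exact Iff.rfl

lemma hcl_eq_zero_iff {x : C.V} {hx : C.d x = 0} : hcl x hx = 0 ↔ ∃ w, C.d w = x := by
  unfold hcl
  rw [Submodule.Quotient.mk_eq_zero]
  exact Iff.rfl

/-- The homogeneous part of degree `p` of total homology. -/
def HTgr (C : Cx) (p : ℤ) : Submodule ℚ C.HT :=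
  ((C.gr p).submoduleOf (LinearMap.ker C.d)).map (Submodule.mkQ _)

lemma mem_HTgr {p : ℤ} {c : C.HT} :
    c ∈ C.HTgr p ↔ ∃ (x : C.V) (hx : C.d x = 0), x ∈ C.gr p ∧ hcl x hx = c := by
  constructor
  · rintro ⟨⟨x, hx⟩, h, rfl⟩
    exact ⟨x, hx, h, rfl⟩
  · rintro ⟨x, hx, h, rfl⟩
    exact ⟨⟨x, hx⟩, h, rfl⟩

/-- The map induced on total homology by a linear map commuting with the differentials up to a
unit. -/
def htMap (L : C.V →ₗ[ℚ] D.V) (u : ℤˣ) (h : ∀ x, L (C.d x) = u • D.d (L x)) :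
    C.HT →ₗ[ℚ] D.HT :=
  Submodule.mapQ _ _ (L.restrict (p := LinearMap.ker C.d) (q := LinearMap.ker D.d) (fun x hx => by
    have h1 := h x
    rw [LinearMap.mem_ker.1 hx, map_zero] at h1
    exact (smul_eq_zero_iff_eq u).1 h1.symm)) (by
    rintro ⟨x, hx⟩ ⟨y, hy⟩
    have hy' : C.d y = x := hy
    refine ⟨u • L y, ?_⟩
    have h1 := h y
    change D.d (u • L y) = L x
    rw [← hy', h1, Units.smul_def, Units.smul_def, map_zsmul])

/-- The map induced on total homology by a chain map. -/
def Hom.mapHT (f : Hom C D) : C.HT →ₗ[ℚ] D.HT :=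
  htMap f.lin 1 (fun x => by rw [one_smul, f.map_d])

lemma Hom.d_lin (f : Hom C D) {x : C.V} (hx : C.d x = 0) : D.d (f.lin x) = 0 := by
  rw [← f.map_d, hx, map_zero]

lemma Hom.mapHT_hcl (f : Hom C D) (x : C.V) (hx : C.d x = 0) :
    f.mapHT (hcl x hx) = hcl (f.lin x) (f.d_lin hx) := rfl

/-- Quasi-isomorphisms are defined degree by degree; a cycle splits into finitely many homogeneous
components, each again a cycle, and the primitives add up. -/
lemma Hom.IsQuasiIso.injective {f : Hom C D} (hf : f.IsQuasiIso) :
    Function.Injective f.mapHT := by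
  rw [injective_iff_map_eq_zero]
  intro c hc
  obtain ⟨x, hx, rfl⟩ := exists_hcl c
  rw [Hom.mapHT_hcl, hcl_eq_zero_iff] at hc
  obtain ⟨y, hy⟩ := hc
  have key : ∀ n : ℤ, ∃ w, C.d w = C.proj n x := fun n => by
    obtain ⟨w, -, hw⟩ := ((f.isQuasiIso_iff.1 hf) n).1 (C.proj n x) (proj_mem n x)
      (d_proj_eq_zero hx n) ⟨D.proj (n + 1) y, proj_mem _ _, by rw [d_proj, hy, f.map_proj]⟩
    exact ⟨w, hw⟩
  choose w hw using key
  obtain ⟨S, hS⟩ := exists_sum_proj x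
  exact hcl_eq_zero_iff.2 ⟨∑ n ∈ S, w n, by simp only [map_sum, hw, hS]⟩

lemma Hom.IsQuasiIso.surjective {f : Hom C D} (hf : f.IsQuasiIso) :
    Function.Surjective f.mapHT := by
  intro c
  obtain ⟨y, hy, rfl⟩ := exists_hcl c
  have key := fun n : ℤ => ((f.isQuasiIso_iff.1 hf) n).2 (D.proj n y) (proj_mem n y)
    (d_proj_eq_zero hy n)
  choose x _ hx w _ hw using key
  obtain ⟨S, hS⟩ := exists_sum_proj y
  refine ⟨hcl (∑ n ∈ S, x n) (by simp [hx]), ?_⟩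
  rw [Hom.mapHT_hcl, hcl_eq_iff]
  refine ⟨∑ n ∈ S, w n, ?_⟩
  simp only [map_sum, hw, Finset.sum_sub_distrib, hS]

lemma Hom.IsQuasiIso.exists_mem_HTgr {f : Hom C D} (hf : f.IsQuasiIso) {p : ℤ} {c : D.HT}
    (hc : c ∈ D.HTgr p) : ∃ b ∈ C.HTgr p, f.mapHT b = c := by
  obtain ⟨y, hy, hyp, rfl⟩ := mem_HTgr.1 hc
  obtain ⟨x, hxp, hx, w, -, hw⟩ := ((f.isQuasiIso_iff.1 hf) p).2 y hyp hy
  exact ⟨hcl x hx, mem_HTgr.2 ⟨x, hx, hxp, rfl⟩, hcl_eq_iff.2 ⟨w, hw⟩⟩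

lemma Hom.mapHT_mem (f : Hom C D) {p : ℤ} {c : C.HT} (hc : c ∈ C.HTgr p) :
    f.mapHT c ∈ D.HTgr p := by
  obtain ⟨y, hy, hyp, rfl⟩ := mem_HTgr.1 hc
  exact mem_HTgr.2 ⟨_, f.d_lin hy, f.map_gr hyp, rfl⟩

end Cx

variable {ι : Type} {R : DGRing ι}

/-! ### Total homology on the homotopy category -/

/-- Total homology at the object `a` as a functor on `Mod-R`. -/
def htFunctor (R : DGRing ι) (a : ι) : DGMod R ⥤ ModuleCat.{0} ℚ where
  obj M := ModuleCat.of ℚ (M.obj a).HT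
  map f := ModuleCat.ofHom (f.app a).mapHT
  map_id M := ModuleCat.hom_ext <| LinearMap.ext fun c => by
    obtain ⟨x, hx, rfl⟩ := Cx.exists_hcl c
    rfl
  map_comp f g := ModuleCat.hom_ext <| LinearMap.ext fun c => by
    obtain ⟨x, hx, rfl⟩ := Cx.exists_hcl c
    rfl

lemma htFunctor_inverts (R : DGRing ι) (a : ι) :
    (DGMod.quasiIso R).IsInvertedBy (htFunctor R a) := fun _ _ _ hf =>
  (ConcreteCategory.isIso_iff_bijective _).2 ⟨(hf a).injective, (hf a).surjective⟩

/-- Total homology at the object `a` as a functor on `Ho(Mod-R)`. -/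
def hhFunctor (R : DGRing ι) (a : ι) : Ho R ⥤ ModuleCat.{0} ℚ :=
  Localization.Construction.lift (htFunctor R a) (htFunctor_inverts R a)

/-- The total homology at the object `a` of an object of `Ho(Mod-R)`. -/
abbrev HH (a : ι) (X : Ho R) : Type := (hhFunctor R a).obj X

/-- The map induced on total homology by a map in `Ho(Mod-R)`. -/
def hmap (a : ι) {X Y : Ho R} (f : X ⟶ Y) : HH a X →ₗ[ℚ] HH a Y := ((hhFunctor R a).map f).hom

@[simp]
lemma hmap_id (a : ι) (X : Ho R) (c : HH a X) : hmap a (𝟙 X) c = c := by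
  simp [hmap]

@[simp]
lemma hmap_comp (a : ι) {X Y Z : Ho R} (f : X ⟶ Y) (g : Y ⟶ Z) (c : HH a X) :
    hmap a (f ≫ g) c = hmap a g (hmap a f c) := by
  simp [hmap]

/-- The localization functor. -/
abbrev toHo (R : DGRing ι) : DGMod R ⥤ Ho R := (DGMod.quasiIso R).Q

/-- The class of a cycle in the total homology of the object of `Ho(Mod-R)` given by a module. -/
def qcl {a : ι} (M : DGMod R) (x : (M.obj a).V) (hx : (M.obj a).d x = 0) :
    HH a ((toHo R).obj M) := Cx.hcl x hx

lemma exists_qcl {a : ι} {M : DGMod R} (c : HH a ((toHo R).obj M)) :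
    ∃ (x : (M.obj a).V) (hx : (M.obj a).d x = 0), qcl M x hx = c := Cx.exists_hcl c

lemma qcl_eq_iff {a : ι} {M : DGMod R} {x y : (M.obj a).V} {hx : (M.obj a).d x = 0}
    {hy : (M.obj a).d y = 0} : qcl M x hx = qcl M y hy ↔ ∃ w, (M.obj a).d w = x - y :=
  Cx.hcl_eq_iff

lemma qcl_eq_zero_iff {a : ι} {M : DGMod R} {x : (M.obj a).V} {hx : (M.obj a).d x = 0} :
    qcl M x hx = 0 ↔ ∃ w, (M.obj a).d w = x :=
  Cx.hcl_eq_zero_iff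

/-- The lift factors strictly through the localization functor, which is why `qcl` can be a homology
class of the module itself. -/
lemma hmap_Q_eq (a : ι) {M N : DGMod R} (f : M ⟶ N) :
    (hhFunctor R a).map ((toHo R).map f) = (htFunctor R a).map f := by
  have h := Functor.congr_hom (Localization.Construction.fac (htFunctor R a)
    (htFunctor_inverts R a)) f
  exact (h.trans (Category.id_comp _)).trans (Category.comp_id _)

lemma hmap_Q (a : ι) {M N : DGMod R} (f : M ⟶ N) (c : HH a ((toHo R).obj M)) :
    hmap a ((toHo R).map f) c = (f.app a).mapHT c := by
  unfold hmap
  rw [hmap_Q_eq]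
  rfl

lemma hmap_qcl {a : ι} {M N : DGMod R} (f : M ⟶ N) (x : (M.obj a).V) (hx : (M.obj a).d x = 0) :
    hmap a ((toHo R).map f) (qcl M x hx) = qcl N ((f.app a).lin x) ((f.app a).d_lin hx) :=
  hmap_Q a f _

@[elab_as_elim]
lemma Ho.obj_ind {P : Ho R → Prop} (h : ∀ M : DGMod R, P ((toHo R).obj M)) (X : Ho R) : P X := by
  have := h ((Localization.Construction.objEquiv _).symm X)
  exact ((Localization.Construction.objEquiv _).right_inv X) ▸ this

/-- Induction on morphisms of `Ho(Mod-R)`. -/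
lemma Ho.hom_ind (P : ∀ {X Y : Ho R}, (X ⟶ Y) → Prop)
    (hcomp : ∀ {X Y Z : Ho R} (f : X ⟶ Y) (g : Y ⟶ Z), P f → P g → P (f ≫ g))
    (hQ : ∀ {M N : DGMod R} (f : M ⟶ N), P ((toHo R).map f))
    (hinv : ∀ {M N : DGMod R} (w : M ⟶ N) (hw : DGMod.quasiIso R w),
      P (Localization.Construction.wInv w hw)) {X Y : Ho R} (f : X ⟶ Y) : P f := by
  let P' : MorphismProperty (Ho R) := fun _ _ f => P f
  have : P'.IsStableUnderComposition := ⟨fun f g hf hg => hcomp f g hf hg⟩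
  have h : P' = ⊤ := Localization.Construction.morphismProperty_eq_top P'
    (fun _ _ f => hQ f) (fun _ _ w hw => hinv w hw)
  have h' : P' f := by rw [h]; trivial
  exact h'

/-- The homogeneous part of degree `p` of total homology. -/
def HHgr (a : ι) (p : ℤ) (X : Ho R) : Submodule ℚ (HH a X) :=
  Cx.HTgr ((((Localization.Construction.objEquiv _).symm X : DGMod R)).obj a) p

lemma mem_HHgr_qcl {a : ι} {p : ℤ} {M : DGMod R} {c : HH a ((toHo R).obj M)} :
    c ∈ HHgr a p ((toHo R).obj M) ↔
      ∃ (x : (M.obj a).V) (hx : (M.obj a).d x = 0), x ∈ (M.obj a).gr p ∧ qcl M x hx = c :=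
  Cx.mem_HTgr

lemma hmap_wInv {a : ι} {M N : DGMod R} (w : M ⟶ N) (hw : DGMod.quasiIso R w)
    (c : HH a ((toHo R).obj M)) :
    hmap a (Localization.Construction.wInv w hw) (hmap a ((toHo R).map w) c) = c := by
  rw [← hmap_comp]
  have h : (toHo R).map w ≫ Localization.Construction.wInv w hw = 𝟙 _ :=
    (Localization.Construction.wIso w hw).hom_inv_id
  rw [h, hmap_id]

/-- The grading is read off from the underlying module, so its invariance is checked on generating
morphisms. For a formal inverse, the point is that a quasi-isomorphism lifts homogeneous classes to
homogeneous classes. -/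
lemma hmap_mem {a : ι} {p : ℤ} {X Y : Ho R} (f : X ⟶ Y) {c : HH a X} (hc : c ∈ HHgr a p X) :
    hmap a f c ∈ HHgr a p Y := by
  revert c
  refine Ho.hom_ind (fun {X Y} f => ∀ {c : HH a X}, c ∈ HHgr a p X → hmap a f c ∈ HHgr a p Y)
    ?_ ?_ ?_ f
  · intro X Y Z f g hf hg c hc
    rw [hmap_comp]
    exact hg (hf hc)
  · intro M N f c hc
    rw [hmap_Q]
    exact (f.app a).mapHT_mem hc
  · intro M N w hw c hc
    obtain ⟨b, hb, rfl⟩ := (hw a).exists_mem_HTgr hc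
    have h := (congrArg (hmap a (Localization.Construction.wInv w hw)) (hmap_Q a w b)).symm.trans
      (hmap_wInv w hw b)
    exact h.symm ▸ hb

end DG

/-! ### The action of cycles and the suspension isomorphisms on total homology. -/

namespace DG

variable {ι : Type} {R : DGRing ι}

/-- A natural transformation between total homology functors on `Mod-R` extends to `Ho(Mod-R)`. -/
def hhExtend {a b : ι} (τ : htFunctor R b ⟶ htFunctor R a) :
    hhFunctor R b ⟶ hhFunctor R a :=
  Localization.Construction.natTransExtension
    { app := fun M => τ.app M
      naturality := fun M N f => by
        have h1 := hmap_Q_eq b f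
        have h2 := hmap_Q_eq a f
        exact (congrArg (· ≫ τ.app N) h1).trans
          ((τ.naturality f).trans (congrArg (τ.app M ≫ ·) h2.symm)) }

lemma hhExtend_app {a b : ι} (τ : htFunctor R b ⟶ htFunctor R a) (M : DGMod R) :
    (hhExtend τ).app ((toHo R).obj M) = τ.app M :=
  Localization.Construction.NatTransExtension.app_eq _ M

/-! ### The right action of cycles on total homology -/

namespace DGMod

/-- The degree of `x` enters the Leibniz rule only through the sign of the term with `d r`, which
vanishes; so `x` need not be homogeneous. -/
lemma d_act (M : DGMod R) {a b : ι} (x : (M.obj b).V) {r : (R.Hom a b).V}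
    (hr : (R.Hom a b).d r = 0) : (M.obj a).d (M.act x r) = M.act ((M.obj b).d x) r := by
  obtain ⟨S, hS⟩ := Cx.exists_sum_proj x
  rw [← hS]
  simp only [map_sum, LinearMap.sum_apply]
  refine Finset.sum_congr rfl fun n _ => ?_
  rw [M.leibniz r (Cx.proj_mem n x), hr, map_zero, smul_zero, add_zero]

lemma d_act_zero (M : DGMod R) {a b : ι} {x : (M.obj b).V} (hx : (M.obj b).d x = 0)
    {r : (R.Hom a b).V} (hr : (R.Hom a b).d r = 0) : (M.obj a).d (M.act x r) = 0 := by
  rw [M.d_act x hr, hx, map_zero, LinearMap.zero_apply]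

end DGMod

/-- The right action of a cycle on total homology, on modules. -/
def htAct {a b : ι} (r : (R.Hom a b).V) (hr : (R.Hom a b).d r = 0) :
    htFunctor R b ⟶ htFunctor R a where
  app M := ModuleCat.ofHom (Cx.htMap (C := M.obj b) (D := M.obj a) (M.act.flip r) 1 (fun x => by
    rw [one_smul]
    exact (M.d_act x hr).symm))
  naturality M N f := ModuleCat.hom_ext <| LinearMap.ext fun c => by
    obtain ⟨x, hx, rfl⟩ := Cx.exists_hcl c
    exact Cx.hcl_eq_iff.2 ⟨0, by
      rw [map_zero]; exact (sub_eq_zero.2 (f.map_act x r).symm).symm⟩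

/-- The right action of a cycle on total homology. -/
def ract {a b : ι} (r : (R.Hom a b).V) (hr : (R.Hom a b).d r = 0) (X : Ho R) :
    HH b X →ₗ[ℚ] HH a X := ((hhExtend (htAct r hr)).app X).hom

lemma ract_qcl {a b : ι} (r : (R.Hom a b).V) (hr : (R.Hom a b).d r = 0) (M : DGMod R)
    (x : (M.obj b).V) (hx : (M.obj b).d x = 0) :
    ract r hr _ (qcl M x hx) = qcl M (M.act x r) (M.d_act_zero hx hr) := by
  unfold ract
  rw [hhExtend_app]
  rfl

lemma hmap_ract {a b : ι} (r : (R.Hom a b).V) (hr : (R.Hom a b).d r = 0) {X Y : Ho R}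
    (f : X ⟶ Y) (c : HH b X) : hmap a f (ract r hr X c) = ract r hr Y (hmap b f c) := by
  have h := (hhExtend (htAct r hr)).naturality f
  exact (congrArg (fun g => g.hom c) h).symm

/-! ### Suspension isomorphisms in total homology -/

/-- The suspension isomorphism in total homology of complexes. -/
def Cx.htShift (C : Cx) (k : ℤ) : C.HT →ₗ[ℚ] (C.shift k).HT :=
  Cx.htMap (C := C) (D := C.shift k) LinearMap.id k.negOnePow (fun x => by
    change C.d x = k.negOnePow • k.negOnePow • C.d x
    rw [smul_smul, ← Int.negOnePow_add, Int.negOnePow_even _ ⟨k, rfl⟩, one_smul])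

namespace DGMod

/-- The identification of the elements of `Σ^k M` with those of `M`. -/
def shE (M : DGMod R) {a : ι} (k : ℤ) : (M.obj a).V ≃ₗ[ℚ] ((M⟦k⟧).obj a).V :=
  LinearEquiv.refl ℚ _

variable {M : DGMod R} {a : ι} {k : ℤ}

lemma d_shE (x : (M.obj a).V) :
    ((M⟦k⟧).obj a).d (M.shE k x) = k.negOnePow • M.shE k ((M.obj a).d x) := rfl

lemma shE_mem_iff {p q : ℤ} (h : p + k = q) {x : (M.obj a).V} :
    M.shE k x ∈ ((M⟦k⟧).obj a).gr q ↔ x ∈ (M.obj a).gr p := by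
  have h' : q - k = p := by omega
  subst h'
  exact Iff.rfl

lemma d_shE_eq_zero_iff {x : (M.obj a).V} :
    ((M⟦k⟧).obj a).d (M.shE k x) = 0 ↔ (M.obj a).d x = 0 := by
  rw [d_shE, smul_eq_zero_iff_eq, map_eq_zero_iff _ (M.shE k).injective]

lemma exists_d_shE_iff {x : (M.obj a).V} :
    (∃ w, ((M⟦k⟧).obj a).d w = M.shE k x) ↔ ∃ w, (M.obj a).d w = x := by
  constructor
  · rintro ⟨w, hw⟩
    obtain ⟨w, rfl⟩ := (M.shE k).surjective w
    refine ⟨k.negOnePow • w, (M.shE k).injective ?_⟩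
    rw [← hw, d_shE, Units.smul_def, Units.smul_def, map_zsmul, map_zsmul]
  · rintro ⟨w, rfl⟩
    refine ⟨k.negOnePow • M.shE k w, ?_⟩
    rw [Units.smul_def, map_zsmul, d_shE, ← Units.smul_def, smul_smul, ← Int.negOnePow_add,
      Int.negOnePow_even _ ⟨k, rfl⟩, one_smul]

/-- The underlying element of a module is unchanged by the identification `Σ^k = Σ^j Σ^i`. -/
lemma shiftAdd_apply {i j k : ℤ} (h : i + j = k) (M : DGMod R) (a : ι) (x : (M.obj a).V) :
    (DGMod.Hom.app ((shiftFunctorAdd' (DGMod R) i j k h).hom.app M) a).lin (M.shE k x) =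
      (M⟦i⟧).shE j (M.shE i x) := by
  subst h
  rw [shiftFunctorAdd'_eq_shiftFunctorAdd]
  rfl

lemma shiftZero_apply (M : DGMod R) (a : ι) (x : (M.obj a).V) :
    (DGMod.Hom.app ((shiftFunctorZero (DGMod R) ℤ).hom.app M) a).lin (M.shE 0 x) = x := rfl

end DGMod

/-- The suspension map in total homology as a natural transformation. -/
def shTrans (R : DGRing ι) (a : ι) (k : ℤ) :
    hhFunctor R a ⟶ shiftFunctor (Ho R) k ⋙ hhFunctor R a :=
  Localization.Construction.natTransExtension
    { app := fun M => (ModuleCat.ofHom ((M.obj a).htShift k) : (hhFunctor R a).obj ((toHo R).obj M) ⟶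
        (hhFunctor R a).obj ((toHo R).obj (M⟦k⟧))) ≫
          (hhFunctor R a).map (((toHo R).commShiftIso k).hom.app M)
      naturality := fun M N f => by
        have h1 : (hhFunctor R a).map ((toHo R).map f) ≫
            (ModuleCat.ofHom ((N.obj a).htShift k) : (hhFunctor R a).obj ((toHo R).obj N) ⟶
              (hhFunctor R a).obj ((toHo R).obj (N⟦k⟧))) =
            (ModuleCat.ofHom ((M.obj a).htShift k) : (hhFunctor R a).obj ((toHo R).obj M) ⟶
              (hhFunctor R a).obj ((toHo R).obj (M⟦k⟧))) ≫
              (hhFunctor R a).map ((toHo R).map (f⟦k⟧')) := by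
          rw [hmap_Q_eq, hmap_Q_eq]
          refine ModuleCat.hom_ext <| LinearMap.ext fun c => ?_
          obtain ⟨x, hx, rfl⟩ := Cx.exists_hcl c
          rfl
        have h2 := ((toHo R).commShiftIso k).hom.naturality f
        have h3 := congrArg (hhFunctor R a).map h2
        rw [Functor.map_comp, Functor.map_comp] at h3
        refine (Category.assoc _ _ _).symm.trans ?_
        refine (congrArg (· ≫ (hhFunctor R a).map (((toHo R).commShiftIso k).hom.app N)) h1).trans ?_
        refine (Category.assoc _ _ _).trans ?_
        refine Eq.trans ?_ (Category.assoc _ _ _).symm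
        exact congrArg (_ ≫ ·) h3 }

/-- The suspension isomorphism in total homology. -/
def sh {a : ι} (k : ℤ) {X : Ho R} : HH a X →ₗ[ℚ] HH a (X⟦k⟧) := ((shTrans R a k).app X).hom

lemma sh_qcl {a : ι} (k : ℤ) (M : DGMod R) (x : (M.obj a).V) (hx : (M.obj a).d x = 0) :
    sh k (qcl M x hx) = hmap a (((toHo R).commShiftIso k).hom.app M)
      (qcl (M⟦k⟧) (M.shE k x) (DGMod.d_shE_eq_zero_iff.2 hx)) := by
  unfold sh
  have h : (shTrans R a k).app ((toHo R).obj M) = _ :=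
    Localization.Construction.NatTransExtension.app_eq _ M
  rw [h]
  rfl

lemma hmap_sh {a : ι} (k : ℤ) {X Y : Ho R} (f : X ⟶ Y) (c : HH a X) :
    hmap a (f⟦k⟧') (sh k c) = sh k (hmap a f c) := by
  have h := (shTrans R a k).naturality f
  exact (congrArg (fun g => g.hom c) h).symm

lemma ract_sh {a b : ι} (k : ℤ) (r : (R.Hom a b).V) (hr : (R.Hom a b).d r = 0) (X : Ho R)
    (c : HH b X) : ract r hr _ (sh k c) = sh k (ract r hr X c) := by
  induction X using Ho.obj_ind with
  | h M =>
    obtain ⟨x, hx, rfl⟩ := exists_qcl c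
    rw [ract_qcl, sh_qcl, sh_qcl, ← hmap_ract]
    exact congrArg _ (ract_qcl r hr (M⟦k⟧) (M.shE k x) _)

lemma hmap_qcl' {a : ι} {M N : DGMod R} (f : M ⟶ N) {x : (M.obj a).V} {hx : (M.obj a).d x = 0}
    {y : (N.obj a).V} {hy : (N.obj a).d y = 0} (h : (f.app a).lin x = y) :
    hmap a ((toHo R).map f) (qcl M x hx) = qcl N y hy := by
  subst h
  exact hmap_qcl f x hx

/-- On modules the identification Σ^{i+j} = Σ^j Σ^i is the identity on elements, and
`commShiftIso_add'` carries this to Ho. No sign appears. -/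
lemma sh_add {a : ι} {i j k : ℤ} (h : i + j = k) (X : Ho R) (c : HH a X) :
    hmap a ((shiftFunctorAdd' (Ho R) i j k h).hom.app X) (sh k c) = sh j (sh i c) := by
  induction X using Ho.obj_ind with
  | h M =>
    obtain ⟨x, hx, rfl⟩ := exists_qcl c
    rw [sh_qcl, sh_qcl, ← hmap_sh, (toHo R).commShiftIso_add' h]
    rw [Functor.CommShift.isoAdd'_hom_app, ← hmap_comp]
    simp only [Category.assoc, Iso.inv_hom_id_app, Category.comp_id, Functor.comp_obj]
    rw [hmap_comp, hmap_comp, sh_qcl]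
    exact congrArg _ (congrArg _ (hmap_qcl' _ (DGMod.shiftAdd_apply h M a x)))

lemma sh_zero {a : ι} (X : Ho R) (c : HH a X) :
    hmap a ((shiftFunctorZero (Ho R) ℤ).inv.app X) c = sh 0 c := by
  induction X using Ho.obj_ind with
  | h M =>
    obtain ⟨x, hx, rfl⟩ := exists_qcl c
    rw [sh_qcl, (toHo R).commShiftIso_zero ℤ]
    rw [Functor.CommShift.isoZero_hom_app, hmap_comp]
    exact congrArg _ (hmap_qcl' _ (DGMod.shiftZero_apply M a x)).symm

lemma hmap_iso_bijective (a : ι) {X Y : Ho R} (f : X ⟶ Y) [IsIso f] :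
    Function.Bijective (hmap a f) := by
  refine ⟨Function.LeftInverse.injective (g := hmap a (inv f)) fun c => ?_,
    Function.RightInverse.surjective (g := hmap a (inv f)) fun c => ?_⟩
  · rw [← hmap_comp]; simp
  · rw [← hmap_comp]; simp

lemma hmap_mem_iff {a : ι} {p : ℤ} {X Y : Ho R} (f : X ⟶ Y) [IsIso f] {c : HH a X} :
    hmap a f c ∈ HHgr a p Y ↔ c ∈ HHgr a p X := by
  refine ⟨fun h => ?_, hmap_mem f⟩
  have h' := hmap_mem (inv f) h
  rwa [← hmap_comp, IsIso.hom_inv_id, hmap_id] at h'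

lemma sh_surjective {a : ι} (k : ℤ) (X : Ho R) :
    Function.Surjective (sh k : HH a X → HH a (X⟦k⟧)) := by
  induction X using Ho.obj_ind with
  | h M =>
    intro c
    obtain ⟨c, rfl⟩ := (hmap_iso_bijective a (((toHo R).commShiftIso k).hom.app M)).2 c
    obtain ⟨x, hx, rfl⟩ := exists_qcl (M := M⟦k⟧) c
    obtain ⟨x, rfl⟩ := (M.shE k).surjective x
    exact ⟨qcl M x (DGMod.d_shE_eq_zero_iff.1 hx), sh_qcl _ _ _ _⟩

lemma sh_injective {a : ι} (k : ℤ) (X : Ho R) :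
    Function.Injective (sh k : HH a X → HH a (X⟦k⟧)) := by
  induction X using Ho.obj_ind with
  | h M =>
    rw [injective_iff_map_eq_zero]
    intro c hc
    obtain ⟨x, hx, rfl⟩ := exists_qcl c
    rw [sh_qcl] at hc
    have h := (hmap_iso_bijective a (((toHo R).commShiftIso k).hom.app M)).1
      (hc.trans (map_zero _).symm)
    exact qcl_eq_zero_iff.2 (DGMod.exists_d_shE_iff.1 (qcl_eq_zero_iff.1 h))

lemma sh_mem_iff {a : ι} {p k q : ℤ} (h : p + k = q) {X : Ho R} {c : HH a X} :
    sh k c ∈ HHgr a q (X⟦k⟧) ↔ c ∈ HHgr a p X := by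
  induction X using Ho.obj_ind with
  | h M =>
    constructor
    · intro hc
      obtain ⟨x, hx, rfl⟩ := exists_qcl c
      rw [sh_qcl, hmap_mem_iff] at hc
      obtain ⟨y, hy, hyq, hxy⟩ := mem_HHgr_qcl.1 hc
      obtain ⟨y, rfl⟩ := (M.shE k).surjective y
      refine mem_HHgr_qcl.2 ⟨y, DGMod.d_shE_eq_zero_iff.1 hy, (DGMod.shE_mem_iff h).1 hyq,
        qcl_eq_iff.2 ((DGMod.exists_d_shE_iff (k := k)).1 ?_)⟩
      obtain ⟨w, hw⟩ := qcl_eq_iff.1 hxy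
      exact ⟨w, hw.trans (map_sub _ _ _).symm⟩
    · intro hc
      obtain ⟨x, hx, hxp, rfl⟩ := mem_HHgr_qcl.1 hc
      rw [sh_qcl, hmap_mem_iff]
      exact mem_HHgr_qcl.2 ⟨_, _, (DGMod.shE_mem_iff h).2 hxp, rfl⟩

end DG

/-! ### Module-level tools: cones, maps out of free modules, homotopies, the zero module. -/

namespace DG

variable {ι : Type} {R : DGRing ι}

namespace DGMod

/-! ### Elements of cones -/

/-- An element of the cone of `f`. -/
def cmk {M N : DGMod R} (f : M ⟶ N) {a : ι} (x : (M.obj a).V) (y : (N.obj a).V) :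
    ((cone f).obj a).V := (x, y)

section Cone

variable {M N : DGMod R} (f : M ⟶ N) {a : ι}

lemma exists_cmk (w : ((cone f).obj a).V) : ∃ x y, w = cmk f x y := ⟨w.1, w.2, rfl⟩

lemma cmk_inj {x x' : (M.obj a).V} {y y' : (N.obj a).V} :
    cmk f x y = cmk f x' y' ↔ x = x' ∧ y = y' := Prod.mk_inj

lemma cmk_add (x x' : (M.obj a).V) (y y' : (N.obj a).V) :
    cmk f x y + cmk f x' y' = cmk f (x + x') (y + y') := rfl

lemma cmk_sub (x x' : (M.obj a).V) (y y' : (N.obj a).V) :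
    cmk f x y - cmk f x' y' = cmk f (x - x') (y - y') := rfl

lemma cmk_zero : (0 : ((cone f).obj a).V) = cmk f 0 0 := rfl

lemma d_cmk (x : (M.obj a).V) (y : (N.obj a).V) :
    ((cone f).obj a).d (cmk f x y) =
      cmk f (-(M.obj a).d x) ((N.obj a).d y + (f.app a).lin x) := rfl

lemma act_cmk {b : ι} (x : (M.obj b).V) (y : (N.obj b).V) (r : (R.Hom a b).V) :
    (cone f).act (cmk f x y) r = cmk f (M.act x r) (N.act y r) := rfl

lemma cmk_mem_iff {n m : ℤ} (h : m + 1 = n) {x : (M.obj a).V} {y : (N.obj a).V} :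
    cmk f x y ∈ ((cone f).obj a).gr n ↔ x ∈ (M.obj a).gr m ∧ y ∈ (N.obj a).gr n := by
  have h' : n - 1 = m := by omega
  subst h'
  exact Iff.rfl

/-- The inclusion of the target in the cone. -/
abbrev coneIn : N ⟶ cone f := (coneTriangle f).mor₂

/-- The projection of the cone onto the suspension of the source. -/
abbrev coneOut : cone f ⟶ M⟦(1 : ℤ)⟧ := (coneTriangle f).mor₃

lemma coneIn_apply (y : (N.obj a).V) : ((coneIn f).app a).lin y = cmk f 0 y := rfl

lemma coneOut_apply (x : (M.obj a).V) (y : (N.obj a).V) :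
    ((coneOut f).app a).lin (cmk f x y) = M.shE 1 x := rfl

end Cone

/-! ### Maps out of free modules -/

/-- The map out of a free module given by a cycle of degree `0`. -/
def ev {G : ι} (M : DGMod R) (z : (M.obj G).V) (hz : z ∈ (M.obj G).gr 0)
    (hd : (M.obj G).d z = 0) : free R G ⟶ M where
  app a :=
    { lin := M.act z
      map_gr := fun {n x} hx => by
        have h := M.act_mem hz hx
        rwa [zero_add] at h
      map_d := fun (x : (R.Hom a G).V) => by
        have h := M.leibniz x hz
        rw [hd, map_zero, LinearMap.zero_apply, zero_add, Int.negOnePow_zero, one_smul] at h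
        exact h.symm }
  map_act x r := M.act_comp z x r

lemma ev_comp {G : ι} {M N : DGMod R} (f : M ⟶ N) (z : (M.obj G).V) (hz : z ∈ (M.obj G).gr 0)
    (hd : (M.obj G).d z = 0) :
    ev M z hz hd ≫ f = ev N ((f.app G).lin z) ((f.app G).map_gr hz) ((f.app G).d_lin hd) := by
  ext a x
  exact f.map_act z x

lemma ev_congr {G : ι} {M : DGMod R} {z z' : (M.obj G).V} (h : z = z') (hz : z ∈ (M.obj G).gr 0)
    (hd : (M.obj G).d z = 0) : ev M z hz hd = ev M z' (h ▸ hz) (h ▸ hd) := by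
  subst h
  rfl

lemma ev_one (G : ι) (h : (R.Hom G G).d (R.one G) = 0) :
    ev (free R G) (R.one G) (R.one_mem G) h = 𝟙 _ := by
  ext a x
  exact R.one_comp x

/-- The map out of a suspended free module given by a cycle of degree `p`. -/
def evShift {G : ι} (M : DGMod R) (p : ℤ) (z : (M.obj G).V) (hz : z ∈ (M.obj G).gr p)
    (hd : (M.obj G).d z = 0) : (free R G)⟦p⟧ ⟶ M where
  app a :=
    { lin := M.act z
      map_gr := fun {n x} hx => by
        have h := M.act_mem hz hx
        rw [show p + (n - p) = n by ring] at h
        exact h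
      map_d := fun (x : (R.Hom a G).V) => by
        have h := M.leibniz x hz
        rw [hd, map_zero, LinearMap.zero_apply, zero_add] at h
        change M.act z (p.negOnePow • (R.Hom a G).d x) = (M.obj a).d (M.act z x)
        rw [h, Units.smul_def, Units.smul_def, map_zsmul] }
  map_act x r := M.act_comp z x r

lemma evShift_apply {G : ι} (M : DGMod R) (p : ℤ) (z : (M.obj G).V) (hz : z ∈ (M.obj G).gr p)
    (hd : (M.obj G).d z = 0) {a : ι} (r : (R.Hom a G).V) :
    ((evShift M p z hz hd).app a).lin ((free R G).shE p r) = M.act z r := rfl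

/-- The Leibniz rule for 1 = 1·1 reads d 1 = d 1 + d 1. -/
lemma d_one (R : DGRing ι) (G : ι) : (R.Hom G G).d (R.one G) = 0 := by
  have h := R.leibniz (R.one G) (R.one_mem G)
  rw [R.one_comp, R.comp_one, R.one_comp, Int.negOnePow_zero, one_smul, left_eq_add] at h
  exact h

/-! ### Homotopies -/

/-- The path object of `ΣN`. -/
abbrev pathObj (N : DGMod R) : DGMod R := cone (coneIn (𝟙 N))

/-- The first projection of the path object. -/
abbrev pathFst (N : DGMod R) : pathObj N ⟶ N⟦(1 : ℤ)⟧ := coneOut (coneIn (𝟙 N))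

/-- The second projection of the path object. -/
def pathSnd (N : DGMod R) : pathObj N ⟶ N⟦(1 : ℤ)⟧ where
  app a :=
    { lin := -((N.shE 1).toLinearMap ∘ₗ LinearMap.fst ℚ (N.obj a).V (N.obj a).V ∘ₗ
        LinearMap.snd ℚ (N.obj a).V ((N.obj a).V × (N.obj a).V))
      map_gr := fun hx => neg_mem hx.2.1
      map_d := fun w => by
        obtain ⟨x, v, rfl⟩ := exists_cmk _ w
        obtain ⟨y, z, rfl⟩ := exists_cmk _ v
        change -(-(N.obj a).d y + 0) = (1 : ℤ).negOnePow • (N.obj a).d (-y)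
        rw [Int.negOnePow_one, Units.neg_smul, one_smul, map_neg, add_zero] }
  map_act {a b} x r := (by rw [map_neg, LinearMap.neg_apply] :
    -N.act (show (N.obj b).V from x.2.1) r = N.act (-(show (N.obj b).V from x.2.1)) r)

/-- The constant paths. -/
def pathConst (N : DGMod R) : N⟦(1 : ℤ)⟧ ⟶ pathObj N where
  app a :=
    { lin := (LinearMap.id.prod ((-LinearMap.id).prod 0) :
        (N.obj a).V →ₗ[ℚ] (N.obj a).V × ((N.obj a).V × (N.obj a).V))
      map_gr := fun hx => ⟨hx, neg_mem hx, zero_mem _⟩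
      map_d := fun (x : (N.obj a).V) => by
        change ((((1 : ℤ).negOnePow • (N.obj a).d x : (N.obj a).V),
          (-((1 : ℤ).negOnePow • (N.obj a).d x) : (N.obj a).V), (0 : (N.obj a).V)) :
            (N.obj a).V × ((N.obj a).V × (N.obj a).V)) =
          ((-(N.obj a).d x, -(N.obj a).d (-x) + 0, (N.obj a).d 0 + -x + x) :
            (N.obj a).V × ((N.obj a).V × (N.obj a).V))
        rw [Int.negOnePow_one, Units.neg_smul, one_smul]
        simp }
  map_act {a b} (x : (N.obj b).V) r := by
    change ((N.act x r, -N.act x r, 0) : (N.obj a).V × ((N.obj a).V × (N.obj a).V)) =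
      (N.act x r, N.act (-x) r, N.act 0 r)
    rw [map_neg, LinearMap.neg_apply, map_zero, LinearMap.zero_apply]

lemma pathConst_fst (N : DGMod R) : pathConst N ≫ pathFst N = 𝟙 _ := rfl

lemma pathConst_snd (N : DGMod R) : pathConst N ≫ pathSnd N = 𝟙 _ := by
  ext a x
  exact neg_neg _

/-- The path object is the cone of a map from N to the acyclic module `cone (𝟙 N)`, so projecting it
to ΣN loses no homology. -/
lemma pathFst_quasiIso (N : DGMod R) : quasiIso R (pathFst N) := by
  intro a
  rw [Cx.Hom.isQuasiIso_iff]
  intro n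
  constructor
  · rintro w hw hdw ⟨u, hu, hdu⟩
    obtain ⟨x, v, rfl⟩ := exists_cmk _ w
    obtain ⟨y, z, rfl⟩ := exists_cmk _ v
    obtain ⟨u, rfl⟩ := (N.shE 1).surjective u
    rw [coneOut_apply, d_shE, Int.negOnePow_one, Units.neg_smul, one_smul, ← map_neg,
      EmbeddingLike.apply_eq_iff_eq] at hdu
    rw [d_cmk, d_cmk, coneIn_apply, cmk_add, cmk_zero, cmk_inj, cmk_zero, cmk_inj] at hdw
    have h1 : (N.obj a).d z + y + x = 0 := hdw.2.2
    have hw' := (cmk_mem_iff _ (sub_add_cancel n 1)).1 hw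
    have hw2 := (cmk_mem_iff _ (sub_add_cancel n 1)).1 hw'.2
    have hu' : u ∈ (N.obj a).gr n := (shE_mem_iff rfl).1 hu
    -- For a cycle (x, (y, z)) with x = -d u, the cycle condition gives y = d u - d z, and the
    -- boundary of (u, (z - u, 0)) is (-d u, (d u - d z, z)).
    refine ⟨cmk _ u (cmk _ (z - u) 0), (cmk_mem_iff _ rfl).2 ⟨hu', (cmk_mem_iff _ rfl).2
      ⟨sub_mem hw2.2 hu', zero_mem _⟩⟩, ?_⟩
    rw [d_cmk, d_cmk, coneIn_apply, cmk_add, cmk_inj, cmk_inj]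
    refine ⟨hdu, ?_, ?_⟩
    · rw [map_sub, add_zero]
      rw [← hdu] at h1
      linear_combination (norm := module) (-1 : ℚ) • h1
    · change (N.obj a).d 0 + (z - u) + u = z
      simp
  · intro x hx hdx
    exact ⟨((pathConst N).app a).lin x, ((pathConst N).app a).map_gr hx,
      ((pathConst N).app a).d_lin hdx, 0, zero_mem _, by
        rw [map_zero]; exact (sub_self _).symm⟩

instance (N : DGMod R) : IsIso ((toHo R).map (pathFst N)) :=
  Localization.inverts _ (quasiIso R) _ (pathFst_quasiIso N)

/-- Both projections are split by `pathConst`. The first is invertible in Ho, so `pathConst` becomes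
its inverse, and the second projection must agree with it. -/
lemma toHo_pathFst (N : DGMod R) : (toHo R).map (pathFst N) = (toHo R).map (pathSnd N) := by
  have h1 : (toHo R).map (pathConst N) ≫ (toHo R).map (pathFst N) = 𝟙 _ := by
    rw [← Functor.map_comp, pathConst_fst, CategoryTheory.Functor.map_id]
  have h2 : (toHo R).map (pathConst N) ≫ (toHo R).map (pathSnd N) = 𝟙 _ := by
    rw [← Functor.map_comp, pathConst_snd, CategoryTheory.Functor.map_id]
  have h3 : (toHo R).map (pathConst N) = inv ((toHo R).map (pathFst N)) := by
    rw [← cancel_mono ((toHo R).map (pathFst N)), h1, IsIso.inv_hom_id]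
  rw [h3, IsIso.inv_comp_eq, Category.comp_id] at h2
  exact h2.symm

/-- A primitive `w` of `z - z'` makes (z, (-z', w)) a cycle of the path object, that is, a map from
the free module whose two projections are the given maps. -/
lemma toHo_ev_shift {G : ι} (N : DGMod R) (z z' : ((N⟦(1 : ℤ)⟧).obj G).V)
    (hz : z ∈ ((N⟦(1 : ℤ)⟧).obj G).gr 0) (hd : ((N⟦(1 : ℤ)⟧).obj G).d z = 0)
    (hz' : z' ∈ ((N⟦(1 : ℤ)⟧).obj G).gr 0) (hd' : ((N⟦(1 : ℤ)⟧).obj G).d z' = 0)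
    (w : ((N⟦(1 : ℤ)⟧).obj G).V) (hw : w ∈ ((N⟦(1 : ℤ)⟧).obj G).gr 1)
    (hdw : ((N⟦(1 : ℤ)⟧).obj G).d w = z - z') :
    (toHo R).map (ev _ z hz hd) = (toHo R).map (ev _ z' hz' hd') := by
  obtain ⟨x, rfl⟩ := (N.shE 1).surjective z
  obtain ⟨y, rfl⟩ := (N.shE 1).surjective z'
  obtain ⟨v, rfl⟩ := (N.shE 1).surjective w
  rw [d_shE_eq_zero_iff] at hd hd'
  rw [shE_mem_iff (p := -1) (by norm_num)] at hz hz'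
  rw [shE_mem_iff (p := 0) (by norm_num)] at hw
  rw [d_shE, Int.negOnePow_one, Units.neg_smul, one_smul, ← map_neg, ← map_sub,
    EmbeddingLike.apply_eq_iff_eq] at hdw
  let e : ((pathObj N).obj G).V := cmk _ x (cmk _ (-y) v)
  have he : e ∈ ((pathObj N).obj G).gr 0 :=
    (cmk_mem_iff _ (m := -1) (by norm_num)).2 ⟨hz, (cmk_mem_iff _ (m := -1) (by norm_num)).2
      ⟨neg_mem hz', hw⟩⟩
  have hde : ((pathObj N).obj G).d e = 0 := by
    rw [d_cmk, d_cmk, coneIn_apply, cmk_add, cmk_zero, cmk_inj, cmk_zero, cmk_inj, map_neg, hd, hd']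
    refine ⟨neg_zero, by simp, ?_⟩
    change (N.obj G).d v + -y + x = 0
    linear_combination (norm := module) (-1 : ℚ) • hdw
  have h1 := ev_comp (pathFst N) e he hde
  have h2 := ev_comp (pathSnd N) e he hde
  have h3 : (toHo R).map (ev _ e he hde ≫ pathFst N) = (toHo R).map (ev _ e he hde ≫ pathSnd N) := by
    rw [Functor.map_comp, Functor.map_comp, toHo_pathFst]
  rw [h1, h2] at h3
  refine h3.trans (congrArg _ (ev_congr ?_ _ _))
  change -(-y) = y
  exact neg_neg y

/-- Homologous cycles give equal maps in `Ho(Mod-R)`. -/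
lemma toHo_ev_eq {G : ι} (M : DGMod R) (z z' : (M.obj G).V)
    (hz : z ∈ (M.obj G).gr 0) (hd : (M.obj G).d z = 0)
    (hz' : z' ∈ (M.obj G).gr 0) (hd' : (M.obj G).d z' = 0)
    (w : (M.obj G).V) (hdw : (M.obj G).d w = z - z') :
    (toHo R).map (ev _ z hz hd) = (toHo R).map (ev _ z' hz' hd') := by
  obtain ⟨w, hw, hdw⟩ := Cx.exists_homogeneous_primitive (sub_mem hz hz') ⟨w, hdw⟩
  -- The path object is available for suspensions only, so `M` is replaced by Σ Σ⁻¹ M.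
  let e : (M⟦(-1 : ℤ)⟧)⟦(1 : ℤ)⟧ ≅ M := (shiftFunctorCompIsoId (DGMod R) (-1 : ℤ) 1 (by norm_num)).app M
  rw [← cancel_mono ((toHo R).map e.inv), ← Functor.map_comp, ← Functor.map_comp, ev_comp, ev_comp]
  exact toHo_ev_shift (M⟦(-1 : ℤ)⟧) _ _ _ _ _ _ ((Hom.app e.inv G).lin w)
    ((Hom.app e.inv G).map_gr hw) (by rw [← Cx.Hom.map_d, hdw, map_sub])

/-! ### The zero module -/

/-- The zero module. -/
def zeroMod (R : DGRing ι) : DGMod R where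
  obj _ :=
    { V := PUnit
      gr := fun _ => ⊥
      internal := (DirectSum.isInternal_submodule_iff_iSupIndep_and_iSup_eq_top _).2
        ⟨fun _ => disjoint_bot_left, Subsingleton.elim _ _⟩
      d := 0
      d_mem := fun _ => Subsingleton.elim _ _
      d_d := fun _ => rfl }
  act := 0
  act_mem _ _ := Subsingleton.elim _ _
  act_one _ := rfl
  act_comp _ _ _ := rfl
  leibniz _ _ := Subsingleton.elim _ _

instance (a : ι) : Subsingleton (((zeroMod R).obj a).V) := inferInstanceAs (Subsingleton PUnit)

/-- The zero morphism to the zero module. -/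
def toZero (M : DGMod R) : M ⟶ zeroMod R where
  app _ := ⟨0, fun _ => zero_mem _, fun _ => Subsingleton.elim _ _⟩
  map_act _ _ := Subsingleton.elim _ _

/-- The zero morphism from the zero module. -/
def ofZero (M : DGMod R) : zeroMod R ⟶ M where
  app _ := ⟨0, fun _ => zero_mem _, fun _ => by simp⟩
  map_act _ _ := by simp

lemma toZero_uniq {M : DGMod R} (f g : M ⟶ zeroMod R) : f = g := by
  ext a x
  exact Subsingleton.elim _ _

lemma ofZero_uniq {M : DGMod R} (f g : zeroMod R ⟶ M) : f = g := by
  ext a x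
  rw [Subsingleton.elim x 0, map_zero, map_zero]

end DGMod

end DG

/-! ### Zero object, corepresentability of homology by free modules, exactness of triangles. -/

namespace DG

variable {ι : Type} {R : DGRing ι}

open DGMod

/-! ### The zero object -/

/-- The module underlying an object of `Ho(Mod-R)`. -/
abbrev Ho.rep (X : Ho R) : DGMod R := (Localization.Construction.objEquiv _).symm X

/-- The zero map into an object of `Ho(Mod-R)`. -/
def Ho.ofZero (X : Ho R) : (toHo R).obj (zeroMod R) ⟶ X := (toHo R).map (DGMod.ofZero X.rep)

/-- The zero map out of an object of `Ho(Mod-R)`. -/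
def Ho.toZero (X : Ho R) : X ⟶ (toHo R).obj (zeroMod R) := (toHo R).map (DGMod.toZero X.rep)

lemma Ho.ofZero_comp {X Y : Ho R} (f : X ⟶ Y) : Ho.ofZero X ≫ f = Ho.ofZero Y := by
  refine Ho.hom_ind (fun {X Y} f => Ho.ofZero X ≫ f = Ho.ofZero Y) ?_ ?_ ?_ f
  · intro X Y Z f g hf hg
    rw [← Category.assoc, hf, hg]
  · intro M N f
    exact ((toHo R).map_comp _ _).symm.trans (congrArg _ (ofZero_uniq _ _))
  · intro M N w hw
    have h : Ho.ofZero ((toHo R).obj M) ≫ (toHo R).map w = Ho.ofZero ((toHo R).obj N) :=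
      ((toHo R).map_comp _ _).symm.trans (congrArg _ (ofZero_uniq _ _))
    exact ((Iso.eq_comp_inv (Localization.Construction.wIso w hw)).2 h).symm

lemma Ho.comp_toZero {X Y : Ho R} (f : X ⟶ Y) : f ≫ Ho.toZero Y = Ho.toZero X := by
  refine Ho.hom_ind (fun {X Y} f => f ≫ Ho.toZero Y = Ho.toZero X) ?_ ?_ ?_ f
  · intro X Y Z f g hf hg
    rw [Category.assoc, hg, hf]
  · intro M N f
    exact ((toHo R).map_comp _ _).symm.trans (congrArg _ (toZero_uniq _ _))
  · intro M N w hw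
    have h : (toHo R).map w ≫ Ho.toZero ((toHo R).obj N) = Ho.toZero ((toHo R).obj M) :=
      ((toHo R).map_comp _ _).symm.trans (congrArg _ (toZero_uniq _ _))
    exact (Iso.inv_comp_eq (Localization.Construction.wIso w hw)).2 h.symm

lemma Ho.isZero_zeroMod : IsZero ((toHo R).obj (zeroMod R)) where
  unique_to X := ⟨⟨⟨Ho.ofZero X⟩, fun f => by
    have h' := Ho.ofZero_comp f
    have h : Ho.ofZero ((toHo R).obj (zeroMod R)) = 𝟙 _ :=
      (congrArg (toHo R).map (ofZero_uniq _ (𝟙 _))).trans ((toHo R).map_id _)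
    rw [h, Category.id_comp] at h'
    exact h'⟩⟩
  unique_from X := ⟨⟨⟨Ho.toZero X⟩, fun f => by
    have h' := Ho.comp_toZero f
    have h : Ho.toZero ((toHo R).obj (zeroMod R)) = 𝟙 _ :=
      (congrArg (toHo R).map (toZero_uniq _ (𝟙 _))).trans ((toHo R).map_id _)
    rw [h, Category.comp_id] at h'
    exact h'⟩⟩

lemma hh_eq_zero_of_isZero {X : Ho R} (hX : IsZero X) {a : ι} (c : HH a X) : c = 0 := by
  let e := hX.iso (Ho.isZero_zeroMod (R := R))
  refine (hmap_iso_bijective a e.hom).1 ?_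
  rw [map_zero]
  obtain ⟨x, hx, h⟩ := exists_qcl (hmap a e.hom c)
  rw [← h]
  exact qcl_eq_zero_iff.2 ⟨0, Subsingleton.elim _ _⟩

/-! ### Generators -/

/-- `c` is a generator of `Y`: maps out of `Y` correspond to homology classes of degree `p`. -/
def IsGen (a : ι) (p : ℤ) (Y : Ho R) (c : HH a Y) : Prop :=
  c ∈ HHgr a p Y ∧ ∀ (Z : Ho R) (b : HH a Z), b ∈ HHgr a p Z → ∃! f : Y ⟶ Z, hmap a f c = b

lemma IsGen.ext {a : ι} {p : ℤ} {Y : Ho R} {c : HH a Y} (h : IsGen a p Y c) {Z : Ho R}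
    {f g : Y ⟶ Z} (hfg : hmap a f c = hmap a g c) : f = g :=
  (h.2 Z _ (hmap_mem g h.1)).unique hfg rfl

/-- Suspension is an equivalence of Ho, so any target may be taken to be a suspension `Z'⟦k⟧`, and
the universal property is transported from `Z'`. -/
lemma IsGen.shift {a : ι} {p q k : ℤ} (hq : p + k = q) {Y : Ho R} {c : HH a Y}
    (h : IsGen a p Y c) : IsGen a q (Y⟦k⟧) (sh k c) := by
  refine ⟨(sh_mem_iff hq).2 h.1, fun Z b hb => ?_⟩
  let Z' := (shiftFunctor (Ho R) k).objPreimage Z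
  let e : Z'⟦k⟧ ≅ Z := (shiftFunctor (Ho R) k).objObjPreimageIso Z
  obtain ⟨b', hb'⟩ := sh_surjective k Z' (hmap a e.inv b)
  have hb'' : b' ∈ HHgr a p Z' := by
    rw [← sh_mem_iff hq, hb']
    exact hmap_mem _ hb
  obtain ⟨f, hf, -⟩ := h.2 Z' b' hb''
  refine ⟨f⟦k⟧' ≫ e.hom, ?_, fun g hg => ?_⟩
  · dsimp only
    rw [hmap_comp, hmap_sh, hf, hb', ← hmap_comp, Iso.inv_hom_id, hmap_id]
  · obtain ⟨g', hg'⟩ := (shiftFunctor (Ho R) k).map_surjective (g ≫ e.inv)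
    have h1 : g' = f := h.ext (sh_injective k Z' (by
      rw [← hmap_sh, hg', hmap_comp, hg, hf, hb']))
    rw [← h1, hg', Category.assoc, Iso.inv_hom_id, Category.comp_id]

/-- `g` is the localization of the morphism given by a cycle with class `c`. -/
def IsEv {G : ι} (X : Ho R) (c : HH G X) (g : hoFree R G ⟶ X) : Prop :=
  ∃ (z : (X.rep.obj G).V) (hz : z ∈ (X.rep.obj G).gr 0) (hd : (X.rep.obj G).d z = 0),
    qcl X.rep z hd = c ∧ (toHo R).map (ev X.rep z hz hd) = g

lemma isEv_mk {G : ι} (M : DGMod R) (z : (M.obj G).V) (hz : z ∈ (M.obj G).gr 0)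
    (hd : (M.obj G).d z = 0) :
    IsEv ((toHo R).obj M) (qcl M z hd) ((toHo R).map (ev M z hz hd)) :=
  ⟨z, hz, hd, rfl, rfl⟩

/-- This is the inductive core of the Yoneda lemma for free modules in Ho. For the formal inverse of
a quasi-isomorphism, a cycle is lifted up to a boundary, and `toHo_ev_eq` absorbs the boundary. -/
lemma IsEv.comp {G : ι} {X Y : Ho R} (f : X ⟶ Y) : ∀ {c : HH G X} {g : hoFree R G ⟶ X},
    IsEv X c g → IsEv Y (hmap G f c) (g ≫ f) := by
  refine Ho.hom_ind (fun {X Y} f => ∀ {c : HH G X} {g : hoFree R G ⟶ X},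
    IsEv X c g → IsEv Y (hmap G f c) (g ≫ f)) ?_ ?_ ?_ f
  · intro X Y Z f f' hf hf' c g h
    rw [hmap_comp, ← Category.assoc]
    exact hf' (hf h)
  · rintro M N f c g ⟨z, hz, hd, rfl, rfl⟩
    have h1 := hmap_qcl f z hd
    have h2 : (toHo R).map (ev M z hz hd) ≫ (toHo R).map f = _ :=
      ((toHo R).map_comp _ _).symm.trans (congrArg _ (ev_comp f z hz hd))
    exact h1.symm ▸ h2.symm ▸ isEv_mk N _ _ _
  · rintro M N w hw c g ⟨z, hz, hd, rfl, rfl⟩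
    obtain ⟨x, hx, hdx, y, -, hy⟩ := (Cx.Hom.isQuasiIso_iff _).1 (hw G) 0 |>.2 z hz hd
    have h1 : hmap G ((toHo R).map w) (qcl _ x hdx) = qcl _ z hd :=
      (hmap_qcl w x hdx).trans (qcl_eq_iff.2 ⟨y, hy⟩)
    have h2 : (toHo R).map (ev _ x hx hdx) ≫ (toHo R).map w = (toHo R).map (ev _ z hz hd) :=
      ((toHo R).map_comp _ _).symm.trans ((congrArg _ (ev_comp w x hx hdx)).trans
        (toHo_ev_eq _ _ _ _ _ _ _ y hy))
    have h3 : hmap G (Localization.Construction.wInv w hw) (qcl _ z hd) = qcl _ x hdx :=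
      (congrArg _ h1.symm).trans (hmap_wInv w hw _)
    have h4 : (toHo R).map (ev _ z hz hd) ≫ Localization.Construction.wInv w hw =
        (toHo R).map (ev _ x hx hdx) :=
      (Iso.comp_inv_eq (Localization.Construction.wIso w hw)).2 h2.symm
    exact h3.symm ▸ h4.symm ▸ isEv_mk _ _ _ _

/-- The class of the identity in the total homology of a free module. -/
def hoOne (R : DGRing ι) (G : ι) : HH G (hoFree R G) := qcl (free R G) (R.one G) (d_one R G)

/-- The identity is `ev` of the unit, so `IsEv.comp` exhibits every map out of F_G as `ev` of a
cycle; by `toHo_ev_eq` only the class of that cycle matters. -/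
lemma isGen_hoOne (G : ι) : IsGen G 0 (hoFree R G) (hoOne R G) := by
  refine ⟨mem_HHgr_qcl.2 ⟨_, _, R.one_mem G, rfl⟩, fun Z b hb => ?_⟩
  have h1 : ∀ f : hoFree R G ⟶ Z, IsEv Z (hmap G f (hoOne R G)) f := fun f => by
    have h := (isEv_mk (free R G) (R.one G) (R.one_mem G) (d_one R G)).comp f
    have e : (toHo R).map (ev (free R G) (R.one G) (R.one_mem G) (d_one R G)) = 𝟙 _ :=
      (congrArg _ (ev_one G _)).trans ((toHo R).map_id _)
    rw [e] at h
    exact (congrArg (IsEv Z _) (Category.id_comp f)).mp h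
  obtain ⟨z, hd, hz, h⟩ := (mem_HHgr_qcl (M := Z.rep)).1 hb
  refine ⟨(toHo R).map (ev Z.rep z hz hd), ?_, fun f hf => ?_⟩
  · dsimp only
    rw [← h]
    exact hmap_qcl' (M := free R G) (N := Z.rep) _ (Z.rep.act_one z)
  · obtain ⟨z', hz', hd', h', rfl⟩ := h1 f
    obtain ⟨y, hy⟩ := qcl_eq_iff.1 (h'.trans (hf.trans h.symm))
    exact toHo_ev_eq _ _ _ _ _ _ _ y hy

/-! ### Exactness -/

/-- The triangle of a cone in `Ho(Mod-R)`. -/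
abbrev hoCone {M N : DGMod R} (f : M ⟶ N) : Triangle (Ho R) :=
  (toHo R).mapTriangle.obj (coneTriangle f)

lemma hoCone_mor₂ {M N : DGMod R} (f : M ⟶ N) {a : ι} {y : (N.obj a).V} (hy : (N.obj a).d y = 0)
    (hy' : ((DGMod.cone f).obj a).d (cmk f 0 y) = 0) :
    hmap a (hoCone f).mor₂ (qcl N y hy) = qcl (DGMod.cone f) (cmk f 0 y) hy' :=
  hmap_qcl' (coneIn f) rfl

lemma hoCone_mor₃ {M N : DGMod R} (f : M ⟶ N) {a : ι} {x : (M.obj a).V} {y : (N.obj a).V}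
    (hx : (M.obj a).d x = 0) (h : ((DGMod.cone f).obj a).d (cmk f x y) = 0) :
    hmap a (hoCone f).mor₃ (qcl (DGMod.cone f) (cmk f x y) h) = sh 1 (qcl M x hx) := by
  rw [sh_qcl]
  refine (hmap_comp a _ _ _).trans ?_
  exact congrArg _ (hmap_qcl' (coneOut f) rfl)

lemma cone_cycle_iff {M N : DGMod R} (f : M ⟶ N) {a : ι} {x : (M.obj a).V} {y : (N.obj a).V} :
    ((DGMod.cone f).obj a).d (cmk f x y) = 0 ↔
      (M.obj a).d x = 0 ∧ (N.obj a).d y + (f.app a).lin x = 0 := by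
  rw [d_cmk, cmk_zero, cmk_inj, neg_eq_zero]

/-- A homogeneous primitive (u, v) of (0, y) in the cone satisfies d u = 0 and f u = y - d v, so the
class of `u` maps to that of `y`. -/
lemma hoCone_exact₂ {M N : DGMod R} (f : M ⟶ N) {a : ι} {p : ℤ} {c : HH a (hoCone f).obj₂}
    (hc : c ∈ HHgr a p _) (h : hmap a (hoCone f).mor₂ c = 0) :
    ∃ b ∈ HHgr a p (hoCone f).obj₁, hmap a (hoCone f).mor₁ b = c := by
  obtain ⟨y, hy, hyp, rfl⟩ := (mem_HHgr_qcl (M := N)).1 hc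
  rw [hoCone_mor₂ f hy (by rw [cone_cycle_iff, map_zero, hy, map_zero, add_zero]; simp)] at h
  have hmem : cmk f 0 y ∈ ((DGMod.cone f).obj a).gr p :=
    (cmk_mem_iff f (sub_add_cancel p 1)).2 ⟨zero_mem _, hyp⟩
  obtain ⟨w, hw, hdw⟩ := Cx.exists_homogeneous_primitive hmem (qcl_eq_zero_iff.1 h)
  obtain ⟨u, v, rfl⟩ := exists_cmk f w
  rw [d_cmk, cmk_inj, neg_eq_zero] at hdw
  refine ⟨qcl M u hdw.1, mem_HHgr_qcl.2 ⟨u, hdw.1, ((cmk_mem_iff f rfl).1 hw).1, rfl⟩, ?_⟩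
  refine (hmap_qcl f u hdw.1).trans (qcl_eq_iff.2 ⟨-v, ?_⟩)
  rw [map_neg, ← hdw.2]
  abel

lemma exact₂ {T : Triangle (Ho R)} (hT : T ∈ hoTriangles R) {a : ι} {p : ℤ} {c : HH a T.obj₂}
    (hc : c ∈ HHgr a p T.obj₂) (h : hmap a T.mor₂ c = 0) :
    ∃ b ∈ HHgr a p T.obj₁, hmap a T.mor₁ b = c := by
  obtain ⟨M, N, f, ⟨e⟩⟩ := hT
  obtain ⟨b, hb, hbc⟩ := hoCone_exact₂ f (hmap_mem e.hom.hom₂ hc) (by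
    rw [← hmap_comp, ← e.hom.comm₂, hmap_comp, h, map_zero])
  refine ⟨hmap a e.inv.hom₁ b, hmap_mem _ hb, ?_⟩
  rw [← hmap_comp, ← e.inv.comm₁, hmap_comp, hbc, ← hmap_comp, e.hom_inv_id_triangle_hom₂, hmap_id]

end DG

/-! ### Twisted sequences in modules and their invariance under quasi-isomorphisms. -/

namespace DG

variable {ι : Type} {R : DGRing ι}

open DGMod

/-- An element `m` of degree `1` with `d m = 0` and `m m = 0`, and elements `g_n` of degree
`2n+1` with `d g_0 = 0` and `d g_{n+1} = m g_n`. -/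
structure TwistData (R : DGRing ι) (h t : ι) where
  m : (R.Hom h h).V
  m_mem : m ∈ (R.Hom h h).gr 1
  d_m : (R.Hom h h).d m = 0
  m_m : R.comp m m = 0
  g : ℕ → (R.Hom t h).V
  d_g_zero : (R.Hom t h).d (g 0) = 0
  d_g_succ : ∀ n, (R.Hom t h).d (g (n + 1)) = R.comp m (g n)

namespace TwistData

variable {h t : ι} (D : TwistData R h t)

lemma act_m_m (M : DGMod R) (x : (M.obj h).V) : M.act (M.act x D.m) D.m = 0 := by
  rw [← M.act_comp, D.m_m, map_zero]

lemma act_d_g (M : DGMod R) (y : ℕ → (M.obj h).V) (L : ℕ) :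
    ∑ j ∈ Finset.range (L + 1), M.act (y j) ((R.Hom t h).d (D.g (L - j))) =
      ∑ j ∈ Finset.range L, M.act (M.act (y j) D.m) (D.g (L - (j + 1))) := by
  rw [Finset.sum_range_succ, Nat.sub_self, D.d_g_zero, map_zero, add_zero]
  refine Finset.sum_congr rfl fun j hj => ?_
  have hj' : L - j = L - (j + 1) + 1 := by
    have := Finset.mem_range.1 hj
    omega
  rw [hj', D.d_g_succ, M.act_comp]

end TwistData

/-! ### Twisted sequences -/

/-- Sequences `x_0, …, x_L` of elements of a module with `deg x_j = 2j`, `d x_0 = 0` and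
`d x_{j+1} = -x_j m`. -/
structure TwistSeq {h t : ι} (D : TwistData R h t) (L : ℕ) (M : DGMod R) where
  x : ℕ → (M.obj h).V
  mem : ∀ j : ℕ, x j ∈ (M.obj h).gr (2 * j)
  d_zero : (M.obj h).d (x 0) = 0
  d_succ : ∀ j, j < L → (M.obj h).d (x (j + 1)) = -M.act (x j) D.m

namespace TwistSeq

variable {h t : ι} {D : TwistData R h t} {L : ℕ} {M N : DGMod R}

/-- Homotopies of twisted sequences. -/
def Homotopic (x y : TwistSeq D L M) : Prop :=
  ∃ s : ℕ → (M.obj h).V, (∀ j : ℕ, s j ∈ (M.obj h).gr (2 * j + 1)) ∧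
    (M.obj h).d (s 0) = x.x 0 - y.x 0 ∧
    ∀ j, j < L → (M.obj h).d (s (j + 1)) - M.act (s j) D.m = x.x (j + 1) - y.x (j + 1)

variable (D L M) in
instance setoid : Setoid (TwistSeq D L M) where
  r := Homotopic
  iseqv :=
    { refl := fun x => ⟨0, fun _ => zero_mem _, by simp, fun j _ => by simp⟩
      symm := by
        rintro x y ⟨s, h1, h2, h3⟩
        refine ⟨-s, fun j => neg_mem (h1 j), ?_, fun j hj => ?_⟩
        · simp only [Pi.neg_apply, map_neg, h2, neg_sub]
        · simp only [Pi.neg_apply, map_neg, LinearMap.neg_apply]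
          rw [← neg_sub (x.x _), ← h3 j hj]
          abel
      trans := by
        rintro x y z ⟨s, h1, h2, h3⟩ ⟨s', h1', h2', h3'⟩
        refine ⟨s + s', fun j => add_mem (h1 j) (h1' j), ?_, fun j hj => ?_⟩
        · simp only [Pi.add_apply, map_add, h2, h2']
          abel
        · simp only [Pi.add_apply, map_add, LinearMap.add_apply]
          rw [← sub_add_sub_cancel (x.x _) (y.x _), ← h3 j hj, ← h3' j hj]
          abel }

/-- The image of a twisted sequence. -/
def map (f : M ⟶ N) (x : TwistSeq D L M) : TwistSeq D L N where
  x j := (f.app h).lin (x.x j)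
  mem j := (f.app h).map_gr (x.mem j)
  d_zero := (f.app h).d_lin x.d_zero
  d_succ j hj := by rw [← Cx.Hom.map_d, x.d_succ j hj, map_neg, f.map_act]

lemma map_homotopic (f : M ⟶ N) {x y : TwistSeq D L M} (hxy : Homotopic x y) :
    Homotopic (x.map f) (y.map f) := by
  obtain ⟨s, h1, h2, h3⟩ := hxy
  refine ⟨fun j => (f.app h).lin (s j), fun j => (f.app h).map_gr (h1 j), ?_, fun j hj => ?_⟩
  · rw [← Cx.Hom.map_d, h2, map_sub]
    rfl
  · rw [← Cx.Hom.map_d, ← f.map_act, ← map_sub, h3 j hj, map_sub]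
    rfl

lemma d_act_m (x : TwistSeq D L M) {j : ℕ} (hj : j ≤ L) :
    (M.obj h).d (M.act (x.x j) D.m) = 0 := by
  rw [M.d_act _ D.d_m]
  cases j with
  | zero => rw [x.d_zero, map_zero, LinearMap.zero_apply]
  | succ j => rw [x.d_succ j hj, map_neg, LinearMap.neg_apply, D.act_m_m, neg_zero]

/-- The element `∑ x_j g_{L-j}`. -/
def pairing (x : TwistSeq D L M) : (M.obj t).V :=
  ∑ j ∈ Finset.range (L + 1), M.act (x.x j) (D.g (L - j))

/-- The boundary telescopes: x_j d(g_{L-j}) = x_j m g_{L-j-1} cancels d(x_{j+1}) g_{L-j-1}. The even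
degree of x_j keeps the Leibniz sign positive. -/
lemma d_pairing (x : TwistSeq D L M) : (M.obj t).d x.pairing = 0 := by
  have h1 : ∀ j, (M.obj t).d (M.act (x.x j) (D.g (L - j))) =
      M.act ((M.obj h).d (x.x j)) (D.g (L - j)) +
        M.act (x.x j) ((R.Hom t h).d (D.g (L - j))) := fun j => by
    rw [M.leibniz _ (x.mem j), Int.negOnePow_two_mul, one_smul]
  unfold pairing
  simp only [map_sum, h1, Finset.sum_add_distrib]
  rw [D.act_d_g, Finset.sum_range_succ', x.d_zero, map_zero, LinearMap.zero_apply, add_zero,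
    ← Finset.sum_add_distrib]
  refine Finset.sum_eq_zero fun j hj => ?_
  rw [x.d_succ j (Finset.mem_range.1 hj), map_neg, LinearMap.neg_apply, neg_add_cancel]

/-- The primitive is ∑ s_j g_{L-j}. The odd degree of s_j gives the minus sign that matches the term
-s_j m in the definition of a homotopy. -/
lemma pairing_homotopic {x y : TwistSeq D L M} (hxy : Homotopic x y) :
    ∃ w, (M.obj t).d w = x.pairing - y.pairing := by
  obtain ⟨s, h1, h2, h3⟩ := hxy
  have h4 : ∀ j, (M.obj t).d (M.act (s j) (D.g (L - j))) =
      M.act ((M.obj h).d (s j)) (D.g (L - j)) -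
        M.act (s j) ((R.Hom t h).d (D.g (L - j))) := fun j => by
    rw [M.leibniz _ (h1 j), Int.negOnePow_two_mul_add_one, Units.neg_smul, one_smul, sub_eq_add_neg]
  refine ⟨∑ j ∈ Finset.range (L + 1), M.act (s j) (D.g (L - j)), ?_⟩
  unfold pairing
  simp only [map_sum, h4, Finset.sum_sub_distrib]
  rw [D.act_d_g, Finset.sum_range_succ', h2, Finset.sum_range_succ' (fun j => M.act (x.x j) _),
    Finset.sum_range_succ' (fun j => M.act (y.x j) _), map_sub, LinearMap.sub_apply]
  have h5 : ∑ j ∈ Finset.range L, M.act ((M.obj h).d (s (j + 1))) (D.g (L - (j + 1))) =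
      ∑ j ∈ Finset.range L, M.act (M.act (s j) D.m) (D.g (L - (j + 1))) +
      (∑ j ∈ Finset.range L, M.act (x.x (j + 1)) (D.g (L - (j + 1))) -
        ∑ j ∈ Finset.range L, M.act (y.x (j + 1)) (D.g (L - (j + 1)))) := by
    rw [← Finset.sum_sub_distrib, ← Finset.sum_add_distrib]
    refine Finset.sum_congr rfl fun j hj => ?_
    rw [← LinearMap.sub_apply, ← map_sub, ← h3 j (Finset.mem_range.1 hj), ← LinearMap.add_apply,
      ← map_add, add_sub_cancel]
  rw [h5]
  abel

/-- The class of x_L m is the obstruction to adding a term x_{L+1}. It is homotopy invariant because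
m m = 0 kills the correction term in d(s_L m). -/
lemma act_m_homotopic {x y : TwistSeq D L M} (hxy : Homotopic x y) :
    ∃ w, (M.obj h).d w = M.act (x.x L) D.m - M.act (y.x L) D.m := by
  obtain ⟨s, h1, h2, h3⟩ := hxy
  refine ⟨M.act (s L) D.m, ?_⟩
  rw [M.d_act _ D.d_m, ← LinearMap.sub_apply, ← map_sub]
  cases L with
  | zero => rw [h2]
  | succ L => rw [← h3 L (Nat.lt_succ_self L), map_sub, LinearMap.sub_apply, D.act_m_m, sub_zero]

/-! ### Invariance under quasi-isomorphisms -/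

/-- This is acyclicity of the mapping cone: up to signs, (a, b) is a cycle there and (w, u) is a
primitive of it. -/
lemma _root_.DG.Cx.Hom.IsQuasiIso.exists_lift {C E : Cx} {f : Cx.Hom C E} (hf : f.IsQuasiIso)
    {p : ℤ} {a : C.V} {b : E.V} (ha : a ∈ C.gr p) (hb : b ∈ E.gr (p + 1)) (hda : C.d a = 0)
    (hab : E.d b = f.lin a) :
    ∃ w ∈ C.gr (p + 1), C.d w = a ∧ ∃ u ∈ E.gr (p + 1 + 1), E.d u = f.lin w - b := by
  obtain ⟨w, hw, hdw⟩ := (f.isQuasiIso_iff.1 hf p).1 a ha hda ⟨b, hb, hab⟩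
  obtain ⟨c, hc, hdc, u, hu, hdu⟩ := (f.isQuasiIso_iff.1 hf (p + 1)).2 (f.lin w - b)
    (sub_mem (f.map_gr hw) hb) (by rw [map_sub, ← f.map_d, hdw, hab, sub_self])
  refine ⟨w - c, sub_mem hw hc, by rw [map_sub, hdc, sub_zero, hdw], -u, neg_mem hu, ?_⟩
  rw [map_neg, hdu, map_sub]
  abel

/-- Dependent choice, where `I` is the invariant that allows the next step and `Q` links consecutive
terms. -/
lemma exists_seq {S : Type} (I : ℕ → S → Prop) (Q : ℕ → S → S → Prop) (s₀ : S) (h₀ : I 0 s₀)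
    (hs : ∀ j s, I j s → ∃ s', I (j + 1) s' ∧ Q j s s') :
    ∃ σ : ℕ → S, σ 0 = s₀ ∧ ∀ j, I j (σ j) ∧ Q j (σ j) (σ (j + 1)) := by
  choose F hF hQ using hs
  let σ : ∀ j, {s // I j s} := fun j => Nat.rec ⟨s₀, h₀⟩ (fun j s => ⟨F j s.1 s.2, hF _ _ _⟩) j
  exact ⟨fun j => (σ j).1, rfl, fun j => ⟨(σ j).2, hQ _ _ _⟩⟩

/-- The lifted term `w` and the homotopy `u` are built together by `exists_lift`. The invariant
records d w and d u only after multiplication by m, which is all that the next lifting problem sees.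
-/
lemma exists_map_homotopic {f : M ⟶ N} (hf : quasiIso R f) (y : TwistSeq D L N) :
    ∃ x : TwistSeq D L M, Homotopic (x.map f) y := by
  -- With `a = 0` the lifting lemma yields a cycle whose image is homologous to y_0.
  obtain ⟨w₀, hw₀, hdw₀, u₀, hu₀, hdu₀⟩ := (hf h).exists_lift (p := -1) (a := 0) (b := y.x 0)
    (zero_mem _) (by simpa using y.mem 0) (map_zero _) (by rw [y.d_zero, map_zero])
  obtain ⟨σ, hσ0, hσ⟩ := exists_seq (S := (M.obj h).V × (N.obj h).V)
    (fun j s => s.1 ∈ (M.obj h).gr (2 * j) ∧ s.2 ∈ (N.obj h).gr (2 * j + 1) ∧ (j ≤ L →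
      M.act ((M.obj h).d s.1) D.m = 0 ∧ N.act ((N.obj h).d s.2) D.m =
        (f.app h).lin (M.act s.1 D.m) - N.act (y.x j) D.m))
    (fun j s s' => j < L → (M.obj h).d s'.1 = -M.act s.1 D.m ∧
      (N.obj h).d s'.2 - N.act s.2 D.m = (f.app h).lin s'.1 - y.x (j + 1)) (w₀, u₀)
    ⟨by simpa using hw₀, by simpa using hu₀, fun _ => ⟨by rw [hdw₀, map_zero, LinearMap.zero_apply], by
      rw [hdu₀, map_sub, LinearMap.sub_apply, f.map_act]⟩⟩ (by
      rintro j ⟨w, u⟩ ⟨hw, hu, hj⟩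
      dsimp only at hw hu hj
      by_cases hjL : j < L
      · obtain ⟨h1, h2⟩ := hj hjL.le
        have hdeg : (2 * (j : ℤ) + 1 + 1) = 2 * ((j + 1 : ℕ) : ℤ) := by push_cast; ring
        obtain ⟨w', hw', hdw', u', hu', hdu'⟩ := (hf h).exists_lift (p := 2 * j + 1)
          (a := -M.act w D.m) (b := y.x (j + 1) - N.act u D.m)
          (neg_mem (M.act_mem hw D.m_mem))
          (sub_mem (hdeg ▸ y.mem (j + 1)) (N.act_mem hu D.m_mem))
          (by rw [map_neg, M.d_act _ D.d_m, h1, neg_zero])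
          (by
            rw [map_sub, y.d_succ j hjL, N.d_act _ D.d_m, h2, map_neg]
            abel)
        refine ⟨(w', u'), ⟨hdeg ▸ hw', hdeg ▸ hu', fun _ => ⟨?_, ?_⟩⟩, fun _ => ⟨hdw', ?_⟩⟩
        · rw [hdw', map_neg, LinearMap.neg_apply, D.act_m_m, neg_zero]
        · rw [hdu', map_sub, map_sub, LinearMap.sub_apply, LinearMap.sub_apply, D.act_m_m,
            sub_zero, f.map_act]
        · rw [hdu']
          abel
      -- Beyond the index `L` only the degrees are constrained, so zero will do.
      · exact ⟨(0, 0), ⟨zero_mem _, zero_mem _, fun hj' => absurd hj' hjL⟩,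
          fun hj' => absurd hj' hjL⟩)
  refine ⟨⟨fun j => (σ j).1, fun j => (hσ j).1.1, ?_, fun j hj => ((hσ j).2 hj).1⟩,
    fun j => (σ j).2, fun j => (hσ j).1.2.1, ?_, fun j hj => ((hσ j).2 hj).2⟩
  · rw [hσ0]; exact hdw₀
  · change (N.obj h).d (σ 0).2 = (f.app h).lin (σ 0).1 - y.x 0
    rw [hσ0]
    exact hdu₀

/-- The same lifting argument one degree higher: the homotopy `s` between the images lifts to `w`,
while `u` compares f(w) with `s`. -/
lemma homotopic_of_map {f : M ⟶ N} (hf : quasiIso R f) {x y : TwistSeq D L M}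
    (hxy : Homotopic (x.map f) (y.map f)) : Homotopic x y := by
  obtain ⟨s, hs, hs0, hsj⟩ := hxy
  obtain ⟨w₀, hw₀, hdw₀, u₀, hu₀, hdu₀⟩ := (hf h).exists_lift (p := 0) (a := x.x 0 - y.x 0)
    (b := s 0) (sub_mem (x.mem 0) (y.mem 0)) (hs 0)
    (by rw [map_sub, x.d_zero, y.d_zero, sub_self]) (by rw [hs0, map_sub]; rfl)
  obtain ⟨σ, hσ0, hσ⟩ := exists_seq (S := (M.obj h).V × (N.obj h).V)
    (fun j r => r.1 ∈ (M.obj h).gr (2 * j + 1) ∧ r.2 ∈ (N.obj h).gr (2 * j + 1 + 1) ∧ (j ≤ L →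
      M.act ((M.obj h).d r.1) D.m = M.act (x.x j - y.x j) D.m ∧
      N.act ((N.obj h).d r.2) D.m = (f.app h).lin (M.act r.1 D.m) - N.act (s j) D.m))
    (fun j r r' => j < L → (M.obj h).d r'.1 - M.act r.1 D.m = x.x (j + 1) - y.x (j + 1)) (w₀, u₀)
    ⟨by simpa using hw₀, by simpa using hu₀, fun _ => ⟨by rw [hdw₀], by
      rw [hdu₀, map_sub, LinearMap.sub_apply, f.map_act]⟩⟩ (by
      rintro j ⟨w, u⟩ ⟨hw, hu, hj⟩
      dsimp only at hw hu hj
      by_cases hjL : j < L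
      · obtain ⟨h1, h2⟩ := hj hjL.le
        have hdeg : (2 * (j : ℤ) + 1 + 1) = 2 * ((j + 1 : ℕ) : ℤ) := by push_cast; ring
        obtain ⟨w', hw', hdw', u', hu', hdu'⟩ := (hf h).exists_lift (p := 2 * j + 1 + 1)
          (a := x.x (j + 1) - y.x (j + 1) + M.act w D.m) (b := s (j + 1) + N.act u D.m)
          (add_mem (hdeg ▸ sub_mem (x.mem (j + 1)) (y.mem (j + 1))) (M.act_mem hw D.m_mem))
          (add_mem (hdeg ▸ hs (j + 1)) (N.act_mem hu D.m_mem))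
          (by
            rw [map_add, map_sub, x.d_succ j hjL, y.d_succ j hjL, M.d_act _ D.d_m, h1, map_sub,
              LinearMap.sub_apply]
            abel)
          (by
            have h3 : (N.obj h).d (s (j + 1)) - N.act (s j) D.m =
              (f.app h).lin (x.x (j + 1)) - (f.app h).lin (y.x (j + 1)) := hsj j hjL
            rw [map_add, N.d_act _ D.d_m, h2, sub_eq_iff_eq_add.1 h3, map_add, map_sub]
            abel)
        refine ⟨(w', u'), ⟨hdeg ▸ hw', hdeg ▸ hu', fun _ => ⟨?_, ?_⟩⟩, fun _ => ?_⟩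
        · rw [hdw', map_add, LinearMap.add_apply, D.act_m_m, add_zero]
        · rw [hdu', map_sub, map_add, LinearMap.sub_apply, LinearMap.add_apply, D.act_m_m,
            add_zero, f.map_act]
        · rw [hdw']
          abel
      · exact ⟨(0, 0), ⟨zero_mem _, zero_mem _, fun hj' => absurd hj' hjL⟩,
          fun hj' => absurd hj' hjL⟩)
  refine ⟨fun j => (σ j).1, fun j => (hσ j).1.1, ?_, fun j hj => (hσ j).2 hj⟩
  dsimp only
  rw [hσ0]; exact hdw₀

end TwistSeq

end DG

/-! ### Twisted sequences in the homotopy category and their extension along triangles. -/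

namespace DG

variable {ι : Type} {R : DGRing ι}

open DGMod

/-! ### Twisted sequences in the homotopy category -/

section

variable {h t : ι} (D : TwistData R h t) (L : ℕ)

/-- Homotopy classes of twisted sequences. -/
def seqFunctor : DGMod R ⥤ Type where
  obj M := Quotient (TwistSeq.setoid D L M)
  map f := TypeCat.ofHom (Quotient.map (TwistSeq.map f) fun _ _ => TwistSeq.map_homotopic f)
  map_id M := by
    ext c
    obtain ⟨x, rfl⟩ := Quotient.exists_rep c
    rfl
  map_comp f g := by
    ext c
    obtain ⟨x, rfl⟩ := Quotient.exists_rep c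
    rfl

lemma seqFunctor_inverts : (quasiIso R).IsInvertedBy (seqFunctor D L) := fun M N f hf => by
  rw [ConcreteCategory.isIso_iff_bijective]
  constructor
  · intro c c'
    obtain ⟨x, rfl⟩ := Quotient.exists_rep c
    obtain ⟨y, rfl⟩ := Quotient.exists_rep c'
    intro hxy
    exact Quotient.sound (TwistSeq.homotopic_of_map hf (Quotient.exact hxy))
  · intro c
    obtain ⟨y, rfl⟩ := Quotient.exists_rep c
    obtain ⟨x, hx⟩ := TwistSeq.exists_map_homotopic hf y
    exact ⟨Quotient.mk _ x, Quotient.sound hx⟩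

/-- Homotopy classes of twisted sequences as a functor on `Ho(Mod-R)`. -/
def seqHoFunctor : Ho R ⥤ Type :=
  Localization.Construction.lift (seqFunctor D L) (seqFunctor_inverts D L)

/-- Homotopy classes of twisted sequences in an object of `Ho(Mod-R)`. -/
abbrev SeqHo (X : Ho R) : Type := (seqHoFunctor D L).obj X

variable {D L}

/-- The class of a twisted sequence. -/
def scl {M : DGMod R} (x : TwistSeq D L M) : SeqHo D L ((toHo R).obj M) := Quotient.mk _ x

lemma exists_scl {M : DGMod R} (c : SeqHo D L ((toHo R).obj M)) :
    ∃ x : TwistSeq D L M, scl x = c := Quotient.exists_rep c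

lemma scl_eq_iff {M : DGMod R} {x y : TwistSeq D L M} : scl x = scl y ↔ x.Homotopic y :=
  ⟨fun hxy => Quotient.exact hxy, fun hxy => Quotient.sound hxy⟩

/-- The map induced on homotopy classes of twisted sequences. -/
def smap {X Y : Ho R} (f : X ⟶ Y) (c : SeqHo D L X) : SeqHo D L Y := (seqHoFunctor D L).map f c

lemma smap_comp {X Y Z : Ho R} (f : X ⟶ Y) (g : Y ⟶ Z) (c : SeqHo D L X) :
    smap (f ≫ g) c = smap g (smap f c) := by
  unfold smap
  rw [Functor.map_comp]
  rfl

lemma smap_id {X : Ho R} (c : SeqHo D L X) : smap (𝟙 X) c = c := by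
  unfold smap
  rw [CategoryTheory.Functor.map_id]
  rfl

lemma smap_scl {M N : DGMod R} (f : M ⟶ N) (x : TwistSeq D L M) :
    smap ((toHo R).map f) (scl x) = scl (x.map f) := by
  have h := Functor.congr_hom (Localization.Construction.fac (seqFunctor D L)
    (seqFunctor_inverts D L)) f
  have h' := (h.trans (Category.id_comp _)).trans (Category.comp_id _)
  exact congrArg (fun g => (ConcreteCategory.hom g) (scl x)) h'

/-- Naturality along a formal inverse follows from naturality along the quasi-isomorphism itself, so
only module maps need to be checked. -/
lemma seqHo_natural {a : ι} (τ : ∀ X : Ho R, SeqHo D L X → HH a X)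
    (hτ : ∀ {M N : DGMod R} (f : M ⟶ N) (c : SeqHo D L ((toHo R).obj M)),
      hmap a ((toHo R).map f) (τ _ c) = τ _ (smap ((toHo R).map f) c))
    {X Y : Ho R} (f : X ⟶ Y) (c : SeqHo D L X) : hmap a f (τ X c) = τ Y (smap f c) := by
  refine Ho.hom_ind (fun {X Y} f => ∀ c : SeqHo D L X, hmap a f (τ X c) = τ Y (smap f c))
    ?_ ?_ ?_ f c
  · intro X Y Z f g hf hg c
    rw [hmap_comp, hf, hg, smap_comp]
  · intro M N f c
    exact hτ f c
  · intro M N w hw c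
    let e := Localization.Construction.wIso w hw
    have h1 : c = smap e.hom (smap e.inv c) := by
      rw [← smap_comp, e.inv_hom_id, smap_id]
    have h2 : hmap a e.hom (τ _ (smap e.inv c)) = τ _ (smap e.hom (smap e.inv c)) := hτ w _
    rw [← h1] at h2
    change hmap a e.inv _ = τ _ (smap e.inv c)
    rw [← h2, ← hmap_comp, e.hom_inv_id, hmap_id]

/-- The class of `x_0`. -/
def seqFirst (X : Ho R) (c : SeqHo D L X) : HH h X :=
  Quotient.lift (s := TwistSeq.setoid D L X.rep) (fun x => qcl X.rep (x.x 0) x.d_zero)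
    (fun _ _ ⟨s, _, hs, _⟩ => qcl_eq_iff.2 ⟨s 0, hs⟩) c

lemma seqFirst_scl {M : DGMod R} (x : TwistSeq D L M) :
    seqFirst _ (scl x) = qcl M (x.x 0) x.d_zero := rfl

lemma hmap_seqFirst {X Y : Ho R} (f : X ⟶ Y) (c : SeqHo D L X) :
    hmap h f (seqFirst X c) = seqFirst Y (smap f c) :=
  seqHo_natural seqFirst (fun f c => by
    obtain ⟨x, rfl⟩ := exists_scl c
    rw [smap_scl]
    exact hmap_qcl f _ _) f c

/-- The class of `x_L m`. -/
def seqTop (X : Ho R) (c : SeqHo D L X) : HH h X :=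
  Quotient.lift (s := TwistSeq.setoid D L X.rep)
    (fun x => qcl X.rep (X.rep.act (x.x L) D.m) (x.d_act_m le_rfl))
    (fun _ _ hxy => qcl_eq_iff.2 (TwistSeq.act_m_homotopic hxy)) c

lemma seqTop_scl {M : DGMod R} (x : TwistSeq D L M) :
    seqTop _ (scl x) = qcl M (M.act (x.x L) D.m) (x.d_act_m le_rfl) := rfl

lemma hmap_seqTop {X Y : Ho R} (f : X ⟶ Y) (c : SeqHo D L X) :
    hmap h f (seqTop X c) = seqTop Y (smap f c) :=
  seqHo_natural seqTop (fun f c => by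
    obtain ⟨x, rfl⟩ := exists_scl c
    rw [smap_scl]
    exact hmap_qcl' f (f.map_act _ _)) f c

lemma TwistSeq.map_pairing {M N : DGMod R} (f : M ⟶ N) (x : TwistSeq D L M) :
    (f.app t).lin x.pairing = (x.map f).pairing := by
  unfold TwistSeq.pairing
  rw [map_sum]
  exact Finset.sum_congr rfl fun j _ => f.map_act _ _

/-- The class of `∑ x_j g_{L-j}`. -/
def seqPair (X : Ho R) (c : SeqHo D L X) : HH t X :=
  Quotient.lift (s := TwistSeq.setoid D L X.rep)
    (fun x => qcl X.rep x.pairing x.d_pairing)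
    (fun _ _ hxy => qcl_eq_iff.2 (TwistSeq.pairing_homotopic hxy)) c

lemma seqPair_scl {M : DGMod R} (x : TwistSeq D L M) :
    seqPair _ (scl x) = qcl M x.pairing x.d_pairing := rfl

lemma hmap_seqPair {X Y : Ho R} (f : X ⟶ Y) (c : SeqHo D L X) :
    hmap t f (seqPair X c) = seqPair Y (smap f c) :=
  seqHo_natural seqPair (fun f c => by
    obtain ⟨x, rfl⟩ := exists_scl c
    rw [smap_scl]
    exact hmap_qcl' f (TwistSeq.map_pairing f x)) f c

/-- The twisted sequence `0, …, 0, z`. -/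
def TwistSeq.single {M : DGMod R} (z : (M.obj h).V) (hz : z ∈ (M.obj h).gr (2 * L))
    (hd : (M.obj h).d z = 0) : TwistSeq D L M where
  x j := if j = L then z else 0
  mem j := by
    split_ifs with hj
    · exact hj ▸ hz
    · exact zero_mem _
  d_zero := by
    split_ifs
    · exact hd
    · exact map_zero _
  d_succ j hj := by
    rw [if_neg hj.ne, map_zero, LinearMap.zero_apply, neg_zero]
    split_ifs
    · exact hd
    · exact map_zero _

lemma TwistSeq.single_self {M : DGMod R} (z : (M.obj h).V) (hz : z ∈ (M.obj h).gr (2 * L))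
    (hd : (M.obj h).d z = 0) : (TwistSeq.single (D := D) z hz hd).x L = z := if_pos rfl

lemma TwistSeq.single_of_ne {M : DGMod R} (z : (M.obj h).V) (hz : z ∈ (M.obj h).gr (2 * L))
    (hd : (M.obj h).d z = 0) {j : ℕ} (hj : j ≠ L) :
    (TwistSeq.single (D := D) z hz hd).x j = 0 := if_neg hj

lemma seqTop_single {M : DGMod R} (z : (M.obj h).V) (hz : z ∈ (M.obj h).gr (2 * L))
    (hd : (M.obj h).d z = 0) :
    seqTop _ (scl (TwistSeq.single (D := D) z hz hd)) = ract D.m D.d_m _ (qcl M z hd) := by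
  rw [seqTop_scl, ract_qcl, qcl_eq_iff]
  refine ⟨0, ?_⟩
  rw [TwistSeq.single_self, sub_self, map_zero]

lemma seqPair_single {M : DGMod R} (z : (M.obj h).V) (hz : z ∈ (M.obj h).gr (2 * L))
    (hd : (M.obj h).d z = 0) :
    seqPair _ (scl (TwistSeq.single (D := D) z hz hd)) =
      ract (D.g 0) D.d_g_zero _ (qcl M z hd) := by
  rw [seqPair_scl, ract_qcl, qcl_eq_iff]
  refine ⟨0, ?_⟩
  rw [TwistSeq.pairing, Finset.sum_range_succ, Finset.sum_eq_zero, TwistSeq.single_self,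
    Nat.sub_self, zero_add, sub_self, map_zero]
  intro j hj
  rw [TwistSeq.single_of_ne _ _ _ (Finset.mem_range.1 hj).ne, map_zero, LinearMap.zero_apply]

/-- Let d w = X - x_L m. The new sequence is f(x_0), …, f(x_L), Y + f(w); the cycle condition d Y =
-f(X) gives its last relation d(Y + f(w)) = -f(x_L) m. In the cone, (x_j, 0) is a nullhomotopy of
the terms f(x_j), and (w, 0) moves the last term to (X, Y). -/
lemma exists_seq_succ_cone {M N : DGMod R} (f : M ⟶ N) (x : TwistSeq D L M)
    (X : (M.obj h).V) (Y : (N.obj h).V)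
    (hmem : cmk f X Y ∈ ((DGMod.cone f).obj h).gr (2 * ((L + 1 : ℕ) : ℤ)))
    (hd : ((DGMod.cone f).obj h).d (cmk f X Y) = 0)
    (hX : ∃ w, (M.obj h).d w = X - M.act (x.x L) D.m) :
    ∃ z : TwistSeq D (L + 1) N, z.x 0 = (f.app h).lin (x.x 0) ∧
      (z.map (coneIn f)).Homotopic (TwistSeq.single (cmk f X Y) hmem hd) := by
  obtain ⟨hdX, hdY⟩ := (cone_cycle_iff f).1 hd
  have hdeg : (2 * (L : ℤ) + 1) + 1 = 2 * ((L + 1 : ℕ) : ℤ) := by push_cast; ring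
  obtain ⟨hXm, hYm⟩ := (cmk_mem_iff f hdeg).1 hmem
  obtain ⟨w, hw, hdw⟩ := Cx.exists_homogeneous_primitive
    (sub_mem hXm (M.act_mem (x.mem L) D.m_mem)) hX
  rw [hdeg] at hw
  let z : TwistSeq D (L + 1) N :=
    { x := fun j => if j ≤ L then (f.app h).lin (x.x j) else
        if j = L + 1 then Y + (f.app h).lin w else 0
      mem := fun j => by
        split_ifs with h1 h2
        · exact (f.app h).map_gr (x.mem j)
        · subst h2
          exact add_mem hYm ((f.app h).map_gr hw)
        · exact zero_mem _
      d_zero := by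
        rw [if_pos (Nat.zero_le L)]
        exact (f.app h).d_lin x.d_zero
      d_succ := fun j hj => by
        rw [if_pos (Nat.lt_succ_iff.1 hj)]
        rcases Nat.lt_succ_iff_lt_or_eq.1 hj with hj' | rfl
        · rw [if_pos (Nat.succ_le_of_lt hj'), ← Cx.Hom.map_d, x.d_succ j hj', map_neg, f.map_act]
        · rw [if_neg (by omega), if_pos rfl, map_add, ← Cx.Hom.map_d, hdw, map_sub, f.map_act,
            eq_neg_of_add_eq_zero_left hdY]
          abel }
  have hz1 : ∀ j, j ≤ L → z.x j = (f.app h).lin (x.x j) := fun j hj => by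
    dsimp only [z]
    rw [if_pos hj]
  have hz2 : z.x (L + 1) = Y + (f.app h).lin w := by
    dsimp only [z]
    rw [if_neg (by omega), if_pos rfl]
  have hz3 : ∀ j, (z.map (coneIn f)).x j = cmk f 0 (z.x j) := fun _ => rfl
  refine ⟨z, hz1 0 (Nat.zero_le L), fun j => if j ≤ L then cmk f (x.x j) 0 else
    if j = L + 1 then cmk f w 0 else 0, fun j => ?_, ?_, fun j hj => ?_⟩
  · dsimp only
    split_ifs with h1 h2
    · exact (cmk_mem_iff f rfl).2 ⟨x.mem j, zero_mem _⟩
    · subst h2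
      exact (cmk_mem_iff f rfl).2 ⟨hw, zero_mem _⟩
    · exact zero_mem _
  · dsimp only
    rw [if_pos (Nat.zero_le L), hz3, hz1 0 (Nat.zero_le L), TwistSeq.single_of_ne _ _ _ (by omega),
      d_cmk, x.d_zero, cmk_zero, cmk_sub, cmk_inj]
    simp
  · dsimp only
    rw [if_pos (Nat.lt_succ_iff.1 hj), act_cmk, hz3]
    rcases Nat.lt_succ_iff_lt_or_eq.1 hj with hj' | rfl
    · rw [if_pos (Nat.succ_le_of_lt hj'), hz1 _ (Nat.succ_le_of_lt hj'),
        TwistSeq.single_of_ne _ _ _ (by omega), d_cmk, x.d_succ j hj', cmk_zero, cmk_sub,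
        cmk_sub, cmk_inj]
      simp
    · rw [if_neg (by omega), if_pos rfl, hz2, TwistSeq.single_self, d_cmk, hdw,
        cmk_sub, cmk_sub, cmk_inj]
      simp

lemma exists_seqHo_succ_cone {M N : DGMod R} (f : M ⟶ N) (ξ : SeqHo D L (hoCone f).obj₁)
    (c : HH h (hoCone f).obj₃) (hc : c ∈ HHgr h (2 * ((L + 1 : ℕ) : ℤ)) (hoCone f).obj₃)
    (hξ : hmap h (hoCone f).mor₃ c = sh 1 (seqTop _ ξ)) :
    ∃ ξ' : SeqHo D (L + 1) (hoCone f).obj₂,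
      seqFirst _ ξ' = hmap h (hoCone f).mor₁ (seqFirst _ ξ) ∧
      hmap h (hoCone f).mor₂ (seqTop _ ξ') = ract D.m D.d_m _ c ∧
      hmap t (hoCone f).mor₂ (seqPair _ ξ') = ract (D.g 0) D.d_g_zero _ c := by
  obtain ⟨x, rfl⟩ := exists_scl (M := M) ξ
  obtain ⟨w, hdw, hw, rfl⟩ := (mem_HHgr_qcl (M := DGMod.cone f)).1 hc
  obtain ⟨X, Y, rfl⟩ := exists_cmk f w
  rw [hoCone_mor₃ f ((cone_cycle_iff f).1 hdw).1] at hξ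
  obtain ⟨z, hz0, hz⟩ := exists_seq_succ_cone f x X Y hw hdw
    (qcl_eq_iff.1 ((sh_injective 1 _ hξ).trans (seqTop_scl x)))
  have hs : smap (hoCone f).mor₂ (scl z) = scl (TwistSeq.single _ hw hdw) :=
    (smap_scl (coneIn f) z).trans (scl_eq_iff.2 hz)
  refine ⟨scl z, ?_, ?_, ?_⟩
  · exact (hmap_qcl' f hz0.symm).symm
  · exact (hmap_seqTop _ _).trans ((congrArg _ hs).trans (seqTop_single _ hw hdw))
  · exact (hmap_seqPair _ _).trans ((congrArg _ hs).trans (seqPair_single _ hw hdw))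

/-- Extension of a twisted sequence along a distinguished triangle. -/
lemma exists_seqHo_succ {T : Triangle (Ho R)} (hT : T ∈ hoTriangles R) (ξ : SeqHo D L T.obj₁)
    (c : HH h T.obj₃) (hc : c ∈ HHgr h (2 * ((L + 1 : ℕ) : ℤ)) T.obj₃)
    (hξ : hmap h T.mor₃ c = sh 1 (seqTop _ ξ)) :
    ∃ ξ' : SeqHo D (L + 1) T.obj₂,
      seqFirst _ ξ' = hmap h T.mor₁ (seqFirst _ ξ) ∧
      hmap h T.mor₂ (seqTop _ ξ') = ract D.m D.d_m _ c ∧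
      hmap t T.mor₂ (seqPair _ ξ') = ract (D.g 0) D.d_g_zero _ c := by
  obtain ⟨M, N, f, ⟨e⟩⟩ := hT
  obtain ⟨ξ', h1, h2, h3⟩ := exists_seqHo_succ_cone f (smap e.hom.hom₁ ξ) (hmap h e.hom.hom₃ c)
    (hmap_mem _ hc) (by
      rw [← hmap_comp, ← e.hom.comm₃, hmap_comp, hξ, hmap_sh, hmap_seqTop])
  refine ⟨smap e.inv.hom₂ ξ', ?_, ?_, ?_⟩
  · rw [← hmap_seqFirst, h1, ← hmap_seqFirst, ← hmap_comp, ← hmap_comp, e.inv.comm₁,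
      ← Category.assoc, e.hom_inv_id_triangle_hom₁, Category.id_comp]
  · rw [← hmap_seqTop, ← hmap_comp, ← e.inv.comm₂, hmap_comp, h2, hmap_ract, ← hmap_comp,
      e.hom_inv_id_triangle_hom₃, hmap_id]
  · rw [← hmap_seqPair, ← hmap_comp, ← e.inv.comm₂, hmap_comp, h3, hmap_ract, ← hmap_comp,
      e.hom_inv_id_triangle_hom₃, hmap_id]

end

end DG

/-! ### Evaluation of maps on generators, and the homology of E_a. -/

namespace DG

variable {ι : Type} {R : DGRing ι}

open DGMod

/-! ### Evaluating maps on total homology -/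

lemma d_cycle {a b : ι} {p : ℤ} (z : (R.Hom a b).cycles p) : (R.Hom a b).d z.1 = 0 :=
  LinearMap.mem_ker.1 z.2.2

/-- Together with `IsGen.ext` this turns identities between maps built from cycles into identities
of homology classes. -/
lemma hmap_hoMap {G G' : ι} {p : ℤ} (z : (R.Hom G G').cycles p) :
    hmap G (hoMap z) (sh p (hoOne R G)) = qcl (free R G') z.1 (d_cycle z) := by
  have h1 : hmap G (((toHo R).commShiftIso p).inv.app (free R G)) (sh p (hoOne R G)) =
      qcl ((free R G)⟦p⟧) ((free R G).shE p (R.one G)) (d_shE_eq_zero_iff.2 (d_one R G)) := by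
    refine (congrArg _ (sh_qcl p (free R G) (R.one G) (d_one R G))).trans ?_
    rw [← hmap_comp, Iso.hom_inv_id_app, hmap_id]
  exact (hmap_comp G _ _ _).trans ((congrArg _ h1).trans
    (hmap_qcl' (leftMul z) (R.comp_one z.1)))

lemma hmap_suspMap {a : ι} {X Y : Ho R} (f : X⟦(1 : ℤ)⟧ ⟶ Y) (k : ℕ) (c : HH a X) :
    hmap a (suspMap f k) (sh ((k + 1 : ℕ) : ℤ) c) = sh (k : ℤ) (hmap a f (sh 1 c)) := by
  unfold suspMap
  rw [hmap_comp, sh_add, hmap_sh]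

lemma hmap_desuspMap {a : ι} {X Y : Ho R} (n : ℕ) (f : X⟦(2 * n + 1 : ℤ)⟧ ⟶ Y) (c : HH a X) :
    hmap a (desuspMap n f) (sh (n : ℤ) (sh ((n + 1 : ℕ) : ℤ) c)) = hmap a f (sh _ c) := by
  unfold desuspMap
  rw [hmap_comp, ← sh_add (show ((n + 1 : ℕ) : ℤ) + n = 2 * n + 1 by push_cast; ring),
    ← hmap_comp a _ (_ : (X⟦((n + 1 : ℕ) : ℤ)⟧)⟦(n : ℤ)⟧ ⟶ _), Iso.hom_inv_id_app, hmap_id]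

section

variable {h t : ι} {D : TwistData R h t} {L : ℕ}

lemma seqTop_mem {X : Ho R} (ξ : SeqHo D L X) : seqTop X ξ ∈ HHgr h (2 * L + 1) X := by
  induction X using Ho.obj_ind with
  | h M =>
    obtain ⟨x, rfl⟩ := exists_scl ξ
    exact mem_HHgr_qcl.2 ⟨_, _, M.act_mem (x.mem L) D.m_mem, rfl⟩

lemma seqPair_mem (hg : ∀ n : ℕ, D.g n ∈ (R.Hom t h).gr (2 * n + 1)) {X : Ho R}
    (ξ : SeqHo D L X) : seqPair X ξ ∈ HHgr t (2 * L + 1) X := by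
  induction X using Ho.obj_ind with
  | h M =>
    obtain ⟨x, rfl⟩ := exists_scl ξ
    refine mem_HHgr_qcl.2 ⟨_, _, Submodule.sum_mem _ fun j hj => ?_, rfl⟩
    have h1 := M.act_mem (x.mem j) (hg (L - j))
    have h2 : (2 * (j : ℤ) + (2 * ((L - j : ℕ) : ℤ) + 1)) = 2 * L + 1 := by
      have := Finset.mem_range.1 hj
      omega
    rwa [h2] at h1

lemma exists_seqHo_zero {X : Ho R} {c : HH h X} (hc : c ∈ HHgr h 0 X) :
    ∃ ξ : SeqHo D 0 X, seqFirst X ξ = c ∧ seqTop X ξ = ract D.m D.d_m X c ∧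
      seqPair X ξ = ract (D.g 0) D.d_g_zero X c := by
  induction X using Ho.obj_ind with
  | h M =>
    obtain ⟨z, hd, hz, rfl⟩ := mem_HHgr_qcl.1 hc
    exact ⟨scl (TwistSeq.single z (by simpa using hz) hd), rfl, seqTop_single _ _ _,
      seqPair_single _ _ _⟩

end

/-! ### The structure of `E_a` -/

lemma eHom_eq_zero {a b : Cell} {n : ℤ} {x : EBasis a b →₀ ℚ} (hx : x ∈ (eHom a b).gr n)
    (h : ∀ y : EBasis a b, y.deg ≠ n) : x = 0 := by
  ext y
  by_contra hy
  exact h y (hx (Finsupp.mem_support_iff.2 hy))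

lemma eHom_eq_single {a b : Cell} {n : ℤ} {x : EBasis a b →₀ ℚ} (hx : x ∈ (eHom a b).gr n)
    (w : EBasis a b) (h : ∀ y : EBasis a b, y.deg = n → y = w) :
    ∃ r : ℚ, x = Finsupp.single w r := by
  refine ⟨x w, ?_⟩
  ext y
  by_cases hy : y = w
  · rw [hy, Finsupp.single_eq_same]
  · rw [Finsupp.single_eq_of_ne hy]
    by_contra hy'
    exact hy (h y (hx (Finsupp.mem_support_iff.2 hy')))

lemma eHom_d_single {a b : Cell} (w : EBasis a b) (r : ℚ) :
    (eHom a b).d (Finsupp.single w r) = (r • w.diff : EBasis a b →₀ ℚ) :=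
  Finsupp.linearCombination_single (M := EBasis a b →₀ ℚ) (v := EBasis.diff) ℚ r w

namespace Ea

variable (H : FinSub)

lemma d_fin {a : Cell} {K : FinSub} (x : (Ea.Hom (.fin K) a).V) : (Ea.Hom (.fin K) a).d x = 0 := by
  have h : (EBasis.diff : EBasis (.fin K) a → _) = fun _ => 0 := by
    funext w
    cases w <;> rfl
  change Finsupp.linearCombination ℚ EBasis.diff (show EBasis (.fin K) a →₀ ℚ from x) = 0
  rw [h, Finsupp.linearCombination_apply]
  exact Finset.sum_eq_zero fun _ _ => smul_zero _

lemma f₀_comp_m₁ : Ea.comp (f₀ H).1 (m₁ H).1 = 0 :=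
  (eComp_single _ _ _ _).trans (by rw [one_smul, one_smul]; rfl)

lemma m₁_comp_m₁ : Ea.comp (m₁ H).1 (m₁ H).1 = 0 :=
  (eComp_single _ _ _ _).trans (by rw [one_smul, one_smul]; rfl)

lemma m₁_comp_g (n : ℕ) : Ea.comp (m₁ H).1 (g H n) = Finsupp.single (EBasis.gEven H n) 1 :=
  (eComp_single _ _ _ _).trans (by rw [one_smul, one_smul]; rfl)

lemma d_g_zero : (Ea.Hom .circ (.fin H)).d (g H 0) = 0 :=
  (eHom_d_single _ _).trans (smul_zero (A := EBasis .circ (.fin H) →₀ ℚ) _)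

lemma d_g_succ (n : ℕ) :
    (Ea.Hom .circ (.fin H)).d (g H (n + 1)) = Finsupp.single (EBasis.gEven H n) 1 :=
  (eHom_d_single _ _).trans (one_smul _ _)

lemma g_mem (n : ℕ) : g H n ∈ (Ea.Hom .circ (.fin H)).gr (2 * n + 1) :=
  Finsupp.single_mem_supported ℚ _ rfl

/-- The element `m_1^H` and the elements `g_{2n+1}^H`. -/
def twistData : TwistData Ea (.fin H) .circ where
  m := (m₁ H).1
  m_mem := (m₁ H).2.1
  d_m := d_fin _
  m_m := m₁_comp_m₁ H
  g := g H
  d_g_zero := d_g_zero H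
  d_g_succ n := (d_g_succ H n).trans (m₁_comp_g H n).symm

lemma hom_fin_circ_eq_zero {n : ℤ} (hn : n ≠ 0) {x : (Ea.Hom (.fin H) .circ).V}
    (hx : x ∈ (Ea.Hom (.fin H) .circ).gr n) : x = 0 :=
  eHom_eq_zero hx fun y => by cases y; exact hn.symm

lemma hom_fin_fin_eq_zero {n : ℤ} (hn : 2 ≤ n) {x : (Ea.Hom (.fin H) (.fin H)).V}
    (hx : x ∈ (Ea.Hom (.fin H) (.fin H)).gr n) : x = 0 :=
  eHom_eq_zero hx fun y => by
    cases y <;> simp only [EBasis.deg] <;> omega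

lemma gEven_of_mem {k : ℕ} {x : (Ea.Hom .circ (.fin H)).V}
    (hx : x ∈ (Ea.Hom .circ (.fin H)).gr (2 * k + 2)) :
    ∃ r : ℚ, x = Finsupp.single (EBasis.gEven H k) r :=
  eHom_eq_single hx _ fun y hy => by
    cases y <;> simp only [EBasis.deg] at hy
    · omega
    · congr 1; omega

lemma gOdd_of_mem {k : ℕ} {x : (Ea.Hom .circ (.fin H)).V}
    (hx : x ∈ (Ea.Hom .circ (.fin H)).gr (2 * k + 1)) :
    ∃ r : ℚ, x = Finsupp.single (EBasis.gOdd H k) r :=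
  eHom_eq_single hx _ fun y hy => by
    cases y <;> simp only [EBasis.deg] at hy
    · congr 1; omega
    · omega

/-- In degree 2j+2 everything is a multiple of g_{2j+2} = d g_{2j+3}, and in degree 2j+3 the
differential is injective. So above degree 1 the complex E_a(𝕋, H) is acyclic. -/
lemma exists_d_eq {n : ℤ} (hn : 2 ≤ n) {x : (Ea.Hom .circ (.fin H)).V}
    (hx : x ∈ (Ea.Hom .circ (.fin H)).gr n) (hd : (Ea.Hom .circ (.fin H)).d x = 0) :
    ∃ w, (Ea.Hom .circ (.fin H)).d w = x := by
  rcases Int.even_or_odd' n with ⟨k, rfl | rfl⟩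
  · obtain ⟨j, rfl⟩ : ∃ j : ℕ, k = j + 1 := ⟨(k - 1).toNat, by omega⟩
    obtain ⟨r, rfl⟩ := gEven_of_mem H (k := j) (by rwa [mul_add] at hx)
    refine ⟨Finsupp.single (EBasis.gOdd H (j + 1)) r, (eHom_d_single _ _).trans ?_⟩
    simp only [EBasis.diff, Finsupp.smul_single, smul_eq_mul, mul_one]
    rfl
  · obtain ⟨j, rfl⟩ : ∃ j : ℕ, k = (j + 1 : ℕ) := ⟨(k - 1).toNat, by omega⟩
    obtain ⟨r, rfl⟩ := gOdd_of_mem H hx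
    have h : (r • (EBasis.gOdd H (j + 1)).diff : EBasis .circ (.fin H) →₀ ℚ) = 0 :=
      (eHom_d_single (EBasis.gOdd H (j + 1)) r).symm.trans hd
    simp only [EBasis.diff, Finsupp.smul_single, smul_eq_mul, mul_one] at h
    rw [Finsupp.single_eq_zero] at h
    exact ⟨0, (map_zero _).trans (by rw [h, Finsupp.single_zero]; rfl)⟩

lemma hh_fin_eq_zero {n : ℤ} (hn : 2 ≤ n) {c : HH (.fin H) (hoFree Ea (.fin H))}
    (hc : c ∈ HHgr (.fin H) n (hoFree Ea (.fin H))) : c = 0 := by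
  obtain ⟨x, hd, hx, rfl⟩ := mem_HHgr_qcl.1 hc
  exact qcl_eq_zero_iff.2 ⟨0, (map_zero _).trans (hom_fin_fin_eq_zero H hn hx).symm⟩

lemma hh_circ_eq_zero {n : ℤ} (hn : 2 ≤ n) {c : HH .circ (hoFree Ea (.fin H))}
    (hc : c ∈ HHgr .circ n (hoFree Ea (.fin H))) : c = 0 := by
  obtain ⟨x, hd, hx, rfl⟩ := mem_HHgr_qcl.1 hc
  exact qcl_eq_zero_iff.2 (exists_d_eq H hn hx hd)

end Ea

end DG

/-! ### Every element of the Toda bracket is f_0 g_{2n+1}. -/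

namespace DG

variable {ι : Type} {R : DGRing ι}

open DGMod

lemma ract_hoOne {a b : ι} (r : (R.Hom a b).V) (hr : (R.Hom a b).d r = 0) :
    ract r hr _ (hoOne R b) = qcl (free R b) r hr := by
  refine (ract_qcl r hr (free R b) (R.one b) (d_one R b)).trans (qcl_eq_iff.2 ⟨0, ?_⟩)
  rw [map_zero]
  exact (sub_eq_zero.2 (R.one_comp r)).symm

lemma exact_mk {X Y Z : Ho R} {f : X ⟶ Y} {g : Y ⟶ Z} {e : Z ⟶ X⟦(1 : ℤ)⟧}
    (hT : Triangle.mk f g e ∈ hoTriangles R) {a : ι} {p : ℤ} {c : HH a Y} (hc : c ∈ HHgr a p Y)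
    (h : hmap a g c = 0) : ∃ b ∈ HHgr a p X, hmap a f b = c := exact₂ hT hc h

lemma exists_seqHo_succ_mk {h t : ι} {D : TwistData R h t} {L : ℕ} {X Y Z : Ho R} {f : X ⟶ Y}
    {g : Y ⟶ Z} {e : Z ⟶ X⟦(1 : ℤ)⟧} (hT : Triangle.mk f g e ∈ hoTriangles R) (ξ : SeqHo D L X)
    (c : HH h Z) (hc : c ∈ HHgr h (2 * ((L + 1 : ℕ) : ℤ)) Z)
    (hξ : hmap h e c = sh 1 (seqTop X ξ)) :
    ∃ ξ' : SeqHo D (L + 1) Y, seqFirst Y ξ' = hmap h f (seqFirst X ξ) ∧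
      hmap h g (seqTop Y ξ') = ract D.m D.d_m Z c ∧
      hmap t g (seqPair Y ξ') = ract (D.g 0) D.d_g_zero Z c :=
  exists_seqHo_succ hT ξ c hc hξ

lemma isGen_sh_sh (G : ι) {i j p : ℤ} (h : i + j = p) :
    IsGen G p (((hoFree R G)⟦i⟧)⟦j⟧) (sh j (sh i (hoOne R G))) := by
  have h1 : IsGen G i ((hoFree R G)⟦i⟧) (sh i (hoOne R G)) :=
    IsGen.shift (zero_add i) (isGen_hoOne G)
  exact IsGen.shift h h1

namespace Ea

variable (H : FinSub)

/-- The class of the identity of the suspended free module `Σ^k Σ^k F_H`. -/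
def cellOne (k : ℕ) : HH (.fin H) (((hoFree Ea (.fin H))⟦(k : ℤ)⟧)⟦(k : ℤ)⟧) :=
  sh (k : ℤ) (sh (k : ℤ) (hoOne Ea (.fin H)))

lemma isGen_cellOne (k : ℕ) :
    IsGen (R := Ea) (.fin H) (2 * k) (((hoFree Ea (.fin H))⟦(k : ℤ)⟧)⟦(k : ℤ)⟧) (cellOne H k) :=
  isGen_sh_sh (R := Ea) (Cell.fin H) (two_mul (k : ℤ)).symm

lemma hh_eq_zero {a : Cell} (ha : a = .fin H ∨ a = .circ) {n : ℤ} (hn : 2 ≤ n)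
    {c : HH a (hoFree Ea (.fin H))} (hc : c ∈ HHgr a n (hoFree Ea (.fin H))) : c = 0 := by
  rcases ha with rfl | rfl
  · exact hh_fin_eq_zero H hn hc
  · exact hh_circ_eq_zero H hn hc

lemma hh_cell_eq_zero {a : Cell} (ha : a = .fin H ∨ a = .circ) (k : ℕ) {p : ℤ}
    (hp : 2 * (k : ℤ) + 2 ≤ p)
    {c : HH a (((hoFree Ea (.fin H))⟦(k : ℤ)⟧)⟦(k : ℤ)⟧)} (hc : c ∈ HHgr a p _) : c = 0 := by
  obtain ⟨c, rfl⟩ := sh_surjective _ _ c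
  obtain ⟨c, rfl⟩ := sh_surjective _ _ c
  rw [sh_mem_iff (p := p - k) (by ring), sh_mem_iff (p := p - k - k) (by ring)] at hc
  rw [hh_eq_zero H ha (by omega) hc, map_zero, map_zero]

variable {H} {n : ℕ}

variable (x : FilteredObj (hoTriangles Ea) (fun k : ℕ => (hoFree Ea (.fin H))⟦(k : ℤ)⟧)
  (fun k : ℕ => suspMap (hoMap (m₁ H)) k) n)

/-- F_k is built from the cells Σ^j Σ^j F_H with j < k, each without homology in degrees ≥ 2j + 2;
exactness adds one cell at a time. -/
lemma hh_filtration_eq_zero {a : Cell} (ha : a = .fin H ∨ a = .circ) (k : ℕ) (hk : k ≤ n + 1)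
    {p : ℤ} (hp : 2 * (k : ℤ) ≤ p) {c : HH a (x.F k)} (hc : c ∈ HHgr a p (x.F k)) : c = 0 := by
  induction k with
  | zero => exact hh_eq_zero_of_isZero x.isZero c
  | succ k ih =>
    obtain ⟨b, hb, hbc⟩ := exact_mk (x.mem k (by omega)) hc
      (hh_cell_eq_zero H ha k (by push_cast at hp; omega) (hmap_mem (x.π k) hc))
    have hb0 := ih (by omega) (by push_cast at hp; omega) hb
    rw [← hbc, hb0, map_zero]

/-- The kernel of π_k comes from F_k, which has no homology in these degrees. This is what makes
attaching classes and lifts unique. -/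
lemma filtration_ext {a : Cell} (ha : a = .fin H ∨ a = .circ) {k : ℕ} (hk : k ≤ n)
    {p : ℤ} (hp : 2 * (k : ℤ) ≤ p) {b c : HH a (x.F (k + 1))} (hb : b ∈ HHgr a p _)
    (hc : c ∈ HHgr a p _) (h : hmap a (x.π k) b = hmap a (x.π k) c) : b = c := by
  obtain ⟨e, he, hec⟩ := exact_mk (x.mem k hk) (sub_mem hb hc)
    ((map_sub (hmap a (x.π k)) b c).trans (sub_eq_zero.2 h))
  have he0 := hh_filtration_eq_zero x ha k (by omega) hp he
  rw [he0, map_zero] at hec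
  exact sub_eq_zero.1 hec.symm

/-- The class of the identity of `F_H` in the first stage of a filtered object. -/
def firstOne : HH (.fin H) (x.F 1) := hmap (.fin H) (@inv _ _ _ _ (x.π 0) x.isIso) (cellOne H 0)

lemma hmap_firstOne : hmap (.fin H) (x.π 0) (firstOne x) = cellOne H 0 := by
  have := x.isIso
  unfold firstOne
  rw [← hmap_comp, IsIso.inv_hom_id, hmap_id]

lemma hmap_σ' : hmap (.fin H) x.σ' (sh 0 (hoOne Ea (.fin H))) =
    hmap (.fin H) (x.incl n) (firstOne x) := by
  have := x.isIso
  refine (hmap_comp _ _ _ _).trans ((hmap_comp _ _ _ _).trans ?_)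
  exact congrArg _ (congrArg _ (sh_zero _ _))

/-- The twisted sequence plays the role of cells e_0, …, e_k of the abstract object. The relation
Σπ_k ∘ δ_{k+1} = Σ^{k+1} f_{k+1} determines the attaching class of the next cell after projection by
π_k; by `filtration_ext` that class equals x_k m, which is the condition for extending the sequence.
-/
lemma exists_seqHo (k : ℕ) (hk : k ≤ n) : ∃ ξ : SeqHo (twistData H) k (x.F (k + 1)),
    seqFirst _ ξ = hmap (.fin H) (x.incl k) (firstOne x) ∧
    hmap (.fin H) (x.π k) (seqTop _ ξ) =
      ract (twistData H).m (twistData H).d_m _ (cellOne H k) ∧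
    hmap .circ (x.π k) (seqPair _ ξ) =
      ract ((twistData H).g 0) (twistData H).d_g_zero _ (cellOne H k) := by
  induction k with
  | zero =>
    have := x.isIso
    obtain ⟨ξ, h1, h2, h3⟩ := exists_seqHo_zero (D := twistData H)
      (hmap_mem (@inv _ _ _ _ (x.π 0) x.isIso) (isGen_cellOne H 0).1)
    refine ⟨ξ, ?_, ?_, ?_⟩
    · rw [h1, FilteredObj.incl, hmap_id]
      rfl
    · rw [h2, hmap_ract]
      exact congrArg _ (hmap_firstOne x)
    · rw [h3, hmap_ract]
      exact congrArg _ (hmap_firstOne x)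
  | succ k ih =>
    obtain ⟨ξ, h1, h2, h3⟩ := ih (by omega)
    have hc := (isGen_cellOne H (k + 1)).1
    -- `b` is the desuspended attaching class of the next cell, of degree 2k+1.
    obtain ⟨b, hb⟩ := sh_surjective 1 _ (hmap (.fin H) (x.δ (k + 1)) (cellOne H (k + 1)))
    have hbm : b ∈ HHgr (.fin H) (2 * k + 1) (x.F (k + 1)) := by
      rw [← sh_mem_iff (k := 1) (q := 2 * ((k + 1 : ℕ) : ℤ)) (by push_cast; ring), hb]
      exact hmap_mem _ hc
    have h4 : hmap (.fin H) ((x.δ (k + 1)) ≫ (x.π k)⟦(1 : ℤ)⟧') (cellOne H (k + 1)) =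
        sh 1 (ract (twistData H).m (twistData H).d_m _ (cellOne H k)) := by
      rw [x.comp_eq k hk, hmap_comp]
      have h5 : hmap (.fin H) ((suspMap (hoMap (m₁ H)) k)⟦((k + 1 : ℕ) : ℤ)⟧')
          (cellOne H (k + 1)) = sh ((k + 1 : ℕ) : ℤ) (sh (k : ℤ)
            (ract (twistData H).m (twistData H).d_m _ (hoOne Ea (.fin H)))) := by
        unfold cellOne
        rw [hmap_sh, hmap_suspMap, hmap_hoMap, ract_hoOne]
        rfl
      refine (congrArg _ h5).trans ?_
      rw [sh_add]
      unfold cellOne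
      rw [ract_sh, ract_sh]
    have h6 : b = seqTop _ ξ := by
      refine filtration_ext x (.inl rfl) (by omega) (by omega) hbm (seqTop_mem ξ) (sh_injective 1 _ ?_)
      rw [h2, ← h4, hmap_comp, ← hmap_sh, hb]
    obtain ⟨ξ', h7, h8, h9⟩ := exists_seqHo_succ_mk (x.mem (k + 1) hk) ξ (cellOne H (k + 1)) hc
      (by rw [← h6]; exact hb.symm)
    refine ⟨ξ', ?_, h8, h9⟩
    rw [h7, h1, FilteredObj.incl, hmap_comp]

/-- Both classes have degree 2n+1 ≥ 2n and the same projection to the top quotient, so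
`filtration_ext` applies and β has no freedom. -/
lemma hmap_lift_eq {β : (((hoFree Ea .circ)⟦((n + 1 : ℕ) : ℤ)⟧)⟦(n : ℤ)⟧) ⟶ x.X}
    (hβ : β ≫ x.σ = (suspMap (hoMap (g₁ H)) n)⟦(n : ℤ)⟧')
    {ξ : SeqHo (twistData H) n (x.F (n + 1))}
    (hξ : hmap .circ (x.π n) (seqPair _ ξ) =
      ract ((twistData H).g 0) (twistData H).d_g_zero _ (cellOne H n)) :
    hmap .circ β (sh (n : ℤ) (sh ((n + 1 : ℕ) : ℤ) (hoOne Ea .circ))) = seqPair _ ξ := by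
  refine filtration_ext x (.inr rfl) le_rfl (p := 2 * n + 1) (by omega) (hmap_mem β ?_)
    (seqPair_mem (g_mem H) ξ) ?_
  · exact (isGen_sh_sh (R := Ea) Cell.circ
      (show ((n + 1 : ℕ) : ℤ) + (n : ℤ) = 2 * n + 1 by push_cast; ring)).1
  · rw [hξ]
    have h1 := hmap_comp Cell.circ β x.σ
      (sh (n : ℤ) (sh ((n + 1 : ℕ) : ℤ) (hoOne Ea .circ)))
    refine h1.symm.trans ?_
    rw [hβ]
    unfold cellOne
    rw [hmap_sh, hmap_suspMap, hmap_hoMap, ract_sh, ract_sh, ract_hoOne]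
    rfl

/-- A map to the free module on the circle group takes the value of a twisted sequence to
`f_0 g_{2n+1}`. -/
lemma hmap_seqPair_circ {X : Ho Ea} (α : X ⟶ hoFree Ea .circ) (ξ : SeqHo (twistData H) n X)
    (h : hmap (.fin H) α (seqFirst X ξ) = qcl (free Ea .circ) (f₀ H).1 (d_cycle (f₀ H))) :
    hmap .circ α (seqPair X ξ) =
      qcl (free Ea .circ) (f₀g H n).1 (d_cycle (f₀g H n)) := by
  obtain ⟨y, hy⟩ := exists_scl (M := free Ea .circ) (smap α ξ)
  obtain ⟨w, hw⟩ := qcl_eq_iff.1 ((seqFirst_scl y).symm.trans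
    ((congrArg _ hy).trans ((hmap_seqFirst α ξ).symm.trans h)))
  -- The complex E_a(H, 𝕋) has zero differential, so homologous elements are equal.
  have h0 : y.x 0 = (f₀ H).1 := sub_eq_zero.1 (hw.symm.trans (d_fin w))
  have h1 : y.pairing = (f₀g H n).1 := by
    unfold TwistSeq.pairing
    rw [Finset.sum_range_succ', Finset.sum_eq_zero, zero_add, h0]
    · rfl
    · intro j _
      -- The term has degree 2(j+1) > 0, while E_a(H, 𝕋) lives in degree 0.
      have h2 : y.x (j + 1) = 0 := hom_fin_circ_eq_zero H (by omega) (y.mem (j + 1))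
      rw [h2, map_zero, LinearMap.zero_apply]
  refine (hmap_seqPair α ξ).trans ((congrArg _ hy.symm).trans
    ((seqPair_scl y).trans (qcl_eq_iff.2 ⟨0, ?_⟩)))
  rw [h1, map_zero]
  exact (sub_self _).symm

/-- The two maps are compared on the generator of Σ^n Σ^{n+1} F_𝕋: β sends it to the pairing of a
twisted sequence that starts at the image of σ', and α turns this into f_0 g_{2n+1}. -/
lemma comp_eq_desuspMap {β : (((hoFree Ea .circ)⟦((n + 1 : ℕ) : ℤ)⟧)⟦(n : ℤ)⟧) ⟶ x.X}
    {α : x.X ⟶ hoFree Ea .circ}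
    (hβ : β ≫ x.σ = (suspMap (hoMap (g₁ H)) n)⟦(n : ℤ)⟧')
    (hα : x.σ' ≫ α = hoMap (f₀ H)) : β ≫ α = desuspMap n (hoMap (f₀g H n)) := by
  obtain ⟨ξ, h1, h2, h3⟩ := exists_seqHo x n le_rfl
  refine (isGen_sh_sh (R := Ea) Cell.circ (i := ((n + 1 : ℕ) : ℤ)) (j := (n : ℤ)) rfl).ext ?_
  rw [hmap_desuspMap, hmap_hoMap, hmap_comp, hmap_lift_eq x hβ h3]
  refine hmap_seqPair_circ α ξ ?_
  refine (congrArg _ (h1.trans (hmap_σ' x).symm)).trans ?_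
  rw [← hmap_comp, hα]
  exact hmap_hoMap (f₀ H)

end Ea

end DG

/-! ### Rotated cones and the attachment of free cells. -/

namespace DG

variable {ι : Type} {R : DGRing ι}

open DGMod

/-! ### Generators and isomorphisms -/

lemma IsGen.of_iso {a : ι} {p : ℤ} {Y Z : Ho R} {c : HH a Y} (h : IsGen a p Y c) (e : Y ≅ Z) :
    IsGen a p Z (hmap a e.hom c) := by
  refine ⟨hmap_mem e.hom h.1, fun W b hb => ?_⟩
  obtain ⟨f, hf, -⟩ := h.2 W b hb
  refine ⟨e.inv ≫ f, ?_, fun g hg => ?_⟩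
  · dsimp only
    rw [← hmap_comp, Iso.hom_inv_id_assoc, hf]
  · have h1 : e.hom ≫ g = f := h.ext (by rw [hmap_comp, hg, hf])
    rw [← h1, Iso.inv_hom_id_assoc]

lemma IsGen.of_isIso {a : ι} {p : ℤ} {Y Z : Ho R} {c : HH a Z} (f : Y ⟶ Z) [IsIso f]
    (h : IsGen a p Z c) {b : HH a Y} (hb : hmap a f b = c) : IsGen a p Y b := by
  have h1 := h.of_iso (asIso f).symm
  have h2 : hmap a (asIso f).symm.hom c = b := by
    rw [← hb, ← hmap_comp]
    simp [hmap_id]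
  rwa [h2] at h1

lemma IsGen.exists_iso {a : ι} {p : ℤ} {Y Z : Ho R} {b : HH a Y} {c : HH a Z}
    (hb : IsGen a p Y b) (hc : IsGen a p Z c) : ∃ e : Y ≅ Z, hmap a e.hom b = c := by
  obtain ⟨f, hf, -⟩ := hb.2 Z c hc.1
  obtain ⟨g, hg, -⟩ := hc.2 Y b hb.1
  exact ⟨⟨f, g, hb.ext (by rw [hmap_comp, hf, hg, hmap_id]),
    hc.ext (by rw [hmap_comp, hg, hf, hmap_id])⟩, hf⟩

lemma IsGen.shE {a : ι} {p q k : ℤ} (hq : p + k = q) {M : DGMod R} {x : (M.obj a).V}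
    {hx : (M.obj a).d x = 0} (h : IsGen a p ((toHo R).obj M) (qcl M x hx)) :
    IsGen a q ((toHo R).obj (M⟦k⟧)) (qcl (M⟦k⟧) (M.shE k x) (d_shE_eq_zero_iff.2 hx)) :=
  (h.shift hq).of_isIso (((toHo R).commShiftIso k).hom.app M) (sh_qcl k M x hx).symm

/-! ### Iterated cones -/

namespace DGMod

/-- The projection of the cone of `N ⟶ cone f` to the suspension of the source of `f`. -/
def coneConeOut {M N : DGMod R} (f : M ⟶ N) : cone (coneIn f) ⟶ M⟦(1 : ℤ)⟧ where
  app a :=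
    { lin := (M.shE 1).toLinearMap ∘ₗ LinearMap.fst ℚ (M.obj a).V (N.obj a).V ∘ₗ
        LinearMap.snd ℚ (N.obj a).V ((M.obj a).V × (N.obj a).V)
      map_gr := fun hx => hx.2.1
      map_d := fun w => by
        obtain ⟨x, v, rfl⟩ := exists_cmk _ w
        obtain ⟨y, z, rfl⟩ := exists_cmk _ v
        change -(M.obj a).d y + 0 = (1 : ℤ).negOnePow • (M.obj a).d y
        rw [Int.negOnePow_one, Units.neg_smul, one_smul, add_zero] }
  map_act _ _ := rfl

lemma coneConeOut_apply {M N : DGMod R} (f : M ⟶ N) {a : ι} (x : (N.obj a).V) (s : (M.obj a).V)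
    (z : (N.obj a).V) :
    ((coneConeOut f).app a).lin (cmk (coneIn f) x (cmk f s z)) = M.shE 1 s := rfl

lemma coneConeOut_cycle_iff {M N : DGMod R} (f : M ⟶ N) {a : ι} {x : (N.obj a).V}
    {s : (M.obj a).V} {z : (N.obj a).V} :
    ((cone (coneIn f)).obj a).d (cmk (coneIn f) x (cmk f s z)) = 0 ↔
      (N.obj a).d x = 0 ∧ (M.obj a).d s = 0 ∧ (N.obj a).d z + (f.app a).lin s + x = 0 := by
  rw [d_cmk, d_cmk, coneIn_apply, cmk_add, cmk_zero, cmk_inj, cmk_zero, cmk_inj, neg_eq_zero,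
    add_zero, neg_eq_zero]

/-- This is the rotation of the cone triangle. The stages of the tower will be cones, so the cofiber
of a stage in the next one is the cone of an inclusion `coneIn`, and it must be recognized as a
suspension. -/
lemma coneConeOut_quasiIso {M N : DGMod R} (f : M ⟶ N) : quasiIso R (coneConeOut f) := by
  intro a
  rw [Cx.Hom.isQuasiIso_iff]
  intro n
  constructor
  · rintro w hw hdw ⟨u, hu, hdu⟩
    obtain ⟨x, v, rfl⟩ := exists_cmk _ w
    obtain ⟨s, z, rfl⟩ := exists_cmk _ v
    obtain ⟨u, rfl⟩ := (M.shE 1).surjective u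
    rw [coneConeOut_apply, d_shE, Int.negOnePow_one, Units.neg_smul, one_smul, ← map_neg,
      EmbeddingLike.apply_eq_iff_eq] at hdu
    obtain ⟨hdx, hds, h1⟩ := (coneConeOut_cycle_iff f).1 hdw
    have hw' := (cmk_mem_iff _ (sub_add_cancel n 1)).1 hw
    have hw2 := (cmk_mem_iff _ (sub_add_cancel n 1)).1 hw'.2
    have hu' : u ∈ (M.obj a).gr n := (shE_mem_iff rfl).1 hu
    -- The boundary of (p, (u, 0)) is (-d p, (-d u, f u + p)), so the last component forces p = z -
    -- f u.
    refine ⟨cmk _ (z - (f.app a).lin u) (cmk _ u 0), (cmk_mem_iff _ rfl).2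
      ⟨sub_mem hw2.2 ((f.app a).map_gr hu'), (cmk_mem_iff _ rfl).2 ⟨hu', zero_mem _⟩⟩, ?_⟩
    rw [d_cmk, d_cmk, coneIn_apply, cmk_add, cmk_inj, cmk_inj, add_zero, map_zero, zero_add]
    refine ⟨?_, hdu, ?_⟩
    · rw [map_sub, ← Cx.Hom.map_d, ← neg_neg ((M.obj a).d u), hdu, map_neg]
      linear_combination (norm := module) (-1 : ℚ) • h1
    · abel
  · intro s hs hds
    obtain ⟨s, rfl⟩ := (M.shE 1).surjective s
    rw [d_shE_eq_zero_iff] at hds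
    rw [shE_mem_iff (sub_add_cancel n 1)] at hs
    refine ⟨cmk _ (-(f.app a).lin s) (cmk _ s 0), (cmk_mem_iff _ (sub_add_cancel n 1)).2
      ⟨neg_mem ((f.app a).map_gr hs), (cmk_mem_iff _ (sub_add_cancel n 1)).2 ⟨hs, zero_mem _⟩⟩,
      (coneConeOut_cycle_iff f).2 ⟨?_, hds, ?_⟩, 0, zero_mem _, ?_⟩
    · rw [map_neg, (f.app a).d_lin hds, neg_zero]
    · rw [map_zero, zero_add, add_neg_cancel]
    · rw [map_zero, coneConeOut_apply, sub_self]

instance {M N : DGMod R} (f : M ⟶ N) : IsIso ((toHo R).map (coneConeOut f)) :=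
  Localization.inverts _ (quasiIso R) _ (coneConeOut_quasiIso f)

/-- Attaching nothing changes nothing. For the tower this gives the invertibility of `π 0`. -/
lemma coneIn_quasiIso {N : DGMod R} (f : zeroMod R ⟶ N) : quasiIso R (coneIn f) := by
  intro a
  rw [Cx.Hom.isQuasiIso_iff]
  intro n
  constructor
  · rintro x hx hdx ⟨w, hw, hdw⟩
    obtain ⟨u, v, rfl⟩ := exists_cmk _ w
    rw [coneIn_apply, d_cmk, cmk_inj, Subsingleton.elim u 0] at hdw
    rw [map_zero (f.app a).lin, add_zero] at hdw
    exact ⟨v, ((cmk_mem_iff f rfl).1 hw).2, hdw.2⟩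
  · rintro w hw hdw
    obtain ⟨u, v, rfl⟩ := exists_cmk _ w
    have h := ((cone_cycle_iff f).1 hdw).2
    rw [Subsingleton.elim u 0, map_zero, add_zero] at h
    refine ⟨v, ((cmk_mem_iff f (sub_add_cancel n 1)).1 hw).2, h, 0, zero_mem _, ?_⟩
    rw [map_zero, coneIn_apply, Subsingleton.elim u 0, sub_self]

/-! ### Attaching a free cell along a cycle -/

section Attach

variable {G : ι} (M : DGMod R) (q : ℤ) (y : (M.obj G).V) (hy : y ∈ (M.obj G).gr q)
  (hd : (M.obj G).d y = 0)

/-- The attaching map of a free cell along the cycle `-y`. -/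
abbrev attachMap : (free R G)⟦q⟧ ⟶ M :=
  evShift M q (-y) (neg_mem hy) (by rw [map_neg, hd, neg_zero])

lemma attachMap_apply {a : ι} (r : (R.Hom a G).V) :
    ((attachMap M q y hy hd).app a).lin ((free R G).shE q r) = -M.act y r := by
  refine (evShift_apply M q (-y) _ _ r).trans ?_
  rw [map_neg, LinearMap.neg_apply]

/-- Here the sign in `attachMap` pays off: the generator of the cofiber has first coordinate `y`, so
the connecting map sends it to `+y`. -/
lemma d_attach_gen : ((cone (coneIn (attachMap M q y hy hd))).obj G).d
    (cmk _ y (cmk _ ((free R G).shE q (R.one G)) 0)) = 0 := by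
  refine (coneConeOut_cycle_iff _).2 ⟨hd, d_shE_eq_zero_iff.2 (d_one R G), ?_⟩
  rw [map_zero, attachMap_apply, M.act_one]
  abel

/-- Both objects corepresent homology in degree q + 1, so they are isomorphic compatibly with their
generators. -/
lemma exists_attachIso {i j : ℤ} (hij : i + j = q + 1) :
    ∃ e : (toHo R).obj (cone (coneIn (attachMap M q y hy hd))) ≅ ((hoFree R G)⟦i⟧)⟦j⟧,
      hmap G e.hom (qcl _ _ (d_attach_gen M q y hy hd)) = sh j (sh i (hoOne R G)) := by
  have h0 : IsGen G 0 ((toHo R).obj (free R G)) (qcl (free R G) (R.one G) (d_one R G)) :=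
    isGen_hoOne G
  have h1 := (h0.shE (zero_add q)).shE (k := 1) rfl
  refine IsGen.exists_iso (p := q + 1) ?_ (isGen_sh_sh G hij)
  exact h1.of_isIso ((toHo R).map (coneConeOut (attachMap M q y hy hd)))
    (hmap_qcl' _ (coneConeOut_apply _ _ _ _))

/-- A map out of the module obtained by attaching a free cell. -/
def attachDesc {N : DGMod R} (α : M ⟶ N) (hα : (α.app G).lin y = 0) (t : (N.obj G).V) {p : ℤ}
    (hp : q + 1 = p) (ht : t ∈ (N.obj G).gr p) (hdt : (N.obj G).d t = 0) :
    cone (attachMap M q y hy hd) ⟶ N where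
  app a :=
    { lin := (N.act t : (R.Hom a G).V →ₗ[ℚ] (N.obj a).V).coprod (α.app a).lin
      map_gr := fun {n w} hw => by
        have h := N.act_mem ht hw.1
        rw [show p + (n - 1 - q) = n by omega] at h
        exact add_mem h ((α.app a).map_gr hw.2)
      map_d := fun w => by
        obtain ⟨x, b, rfl⟩ := exists_cmk _ w
        obtain ⟨x : (R.Hom a G).V, rfl⟩ := ((free R G).shE q).surjective x
        change N.act t (-(q.negOnePow • (R.Hom a G).d x)) + (α.app a).lin ((M.obj a).d b +
          M.act (-y) x) = (N.obj a).d (N.act t x + (α.app a).lin b)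
        rw [map_add, map_add, N.leibniz _ ht, hdt, α.map_act, map_neg (α.app G).lin, hα, neg_zero,
          Cx.Hom.map_d, ← hp, Int.negOnePow_succ]
        simp [Units.smul_def] }
  map_act {a b} w r := by
    obtain ⟨x, v, rfl⟩ := exists_cmk _ w
    obtain ⟨x : (R.Hom b G).V, rfl⟩ := ((free R G).shE q).surjective x
    change N.act t (R.comp x r) + (α.app a).lin (M.act v r) = N.act (N.act t x + (α.app _).lin v) r
    rw [N.act_comp, α.map_act, map_add, LinearMap.add_apply]

lemma attachDesc_apply {N : DGMod R} (α : M ⟶ N) (hα : (α.app G).lin y = 0) (t : (N.obj G).V)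
    {p : ℤ} (hp : q + 1 = p) (ht : t ∈ (N.obj G).gr p) (hdt : (N.obj G).d t = 0) {a : ι}
    (r : (R.Hom a G).V) (b : (M.obj a).V) :
    ((attachDesc M q y hy hd α hα t hp ht hdt).app a).lin (cmk _ ((free R G).shE q r) b) =
      N.act t r + (α.app a).lin b := rfl

lemma coneIn_attachDesc {N : DGMod R} (α : M ⟶ N) (hα : (α.app G).lin y = 0) (t : (N.obj G).V)
    {p : ℤ} (hp : q + 1 = p) (ht : t ∈ (N.obj G).gr p) (hdt : (N.obj G).d t = 0) :
    coneIn (attachMap M q y hy hd) ≫ attachDesc M q y hy hd α hα t hp ht hdt = α := by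
  ext a b
  refine (attachDesc_apply M q y hy hd α hα t hp ht hdt 0 b).trans ?_
  rw [map_zero, zero_add]

end Attach

end DGMod

end DG

/-! ### The tower of cell attachments as a filtered object. -/

namespace DG

variable {ι : Type} {R : DGRing ι}

open DGMod

/-! ### The tower of iterated cell attachments -/

/-- A module with a cycle `y` of degree `2k-1` with `y m = 0`. -/
structure AttachStage {h t : ι} (D : TwistData R h t) (k : ℕ) where
  M : DGMod R
  y : (M.obj h).V
  y_mem : y ∈ (M.obj h).gr (2 * k - 1)
  d_y : (M.obj h).d y = 0
  y_m : M.act y D.m = 0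

section

variable {h t : ι} (D : TwistData R h t)

/-- An element of an attached free cell. -/
def cell {G : ι} {M : DGMod R} {q : ℤ} (φ : (free R G)⟦q⟧ ⟶ M) {a : ι} (r : (R.Hom a G).V) :
    ((cone φ).obj a).V := cmk φ ((free R G).shE q r) 0

lemma act_cell {G : ι} {M : DGMod R} {q : ℤ} (φ : (free R G)⟦q⟧ ⟶ M) {a b : ι}
    (r : (R.Hom b G).V) (s : (R.Hom a b).V) :
    (cone φ).act (cell φ r) s = cell φ (R.comp r s) := by
  refine (act_cmk φ _ _ s).trans ((cmk_inj φ).2 ⟨rfl, ?_⟩)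
  rw [map_zero, LinearMap.zero_apply]

namespace AttachStage

variable {D} {k : ℕ}

/-- The attaching map of the next cell. -/
abbrev att (s : AttachStage D k) : (free R h)⟦(2 * k - 1 : ℤ)⟧ ⟶ s.M :=
  attachMap s.M (2 * k - 1) s.y s.y_mem s.d_y

/-- The next stage, obtained by attaching a cell along `y`. -/
def next (s : AttachStage D k) : AttachStage D (k + 1) where
  M := cone s.att
  -- If e is the new cell, then d e = -y and the next cycle is e m. The cells therefore satisfy d
  -- e_{k+1} = -e_k m.
  y := cell s.att D.m
  y_mem := by
    refine (cmk_mem_iff _ (sub_add_cancel _ 1)).2 ⟨?_, zero_mem _⟩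
    exact (shE_mem_iff (by push_cast; ring)).2 D.m_mem
  d_y := by
    refine (cone_cycle_iff _).2 ⟨d_shE_eq_zero_iff.2 D.d_m, ?_⟩
    rw [map_zero, attachMap_apply, s.y_m, neg_zero, add_zero]
  y_m := by
    rw [act_cell, D.m_m]
    exact (cmk_inj _).2 ⟨map_zero _, rfl⟩

variable (s : AttachStage D k)

/-- The cofiber of the inclusion of a stage in the next one is a suspension of a free module. -/
def iso : (toHo R).obj (cone (coneIn s.att)) ≅ ((hoFree R h)⟦(k : ℤ)⟧)⟦(k : ℤ)⟧ :=
  (exists_attachIso s.M (2 * k - 1) s.y s.y_mem s.d_y (by ring)).choose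

lemma hmap_iso : hmap h s.iso.hom (qcl _ _ (d_attach_gen s.M (2 * k - 1) s.y s.y_mem s.d_y)) =
    sh (k : ℤ) (sh (k : ℤ) (hoOne R h)) :=
  (exists_attachIso s.M (2 * k - 1) s.y s.y_mem s.d_y (by ring)).choose_spec

/-- The map from the next stage to the cofiber. -/
def proj : (toHo R).obj s.next.M ⟶ ((hoFree R h)⟦(k : ℤ)⟧)⟦(k : ℤ)⟧ :=
  (hoCone (coneIn s.att)).mor₂ ≫ s.iso.hom

/-- The connecting map. -/
def conn : ((hoFree R h)⟦(k : ℤ)⟧)⟦(k : ℤ)⟧ ⟶ ((toHo R).obj s.M)⟦(1 : ℤ)⟧ :=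
  s.iso.inv ≫ (hoCone (coneIn s.att)).mor₃

/-- The inclusion of a stage in the next one. -/
def incl : (toHo R).obj s.M ⟶ (toHo R).obj s.next.M := (toHo R).map (coneIn s.att)

lemma mem_hoTriangles : Triangle.mk s.incl s.proj s.conn ∈ hoTriangles R := by
  refine ⟨_, _, coneIn s.att, ⟨Triangle.isoMk _ _ (Iso.refl _) (Iso.refl _) s.iso.symm ?_ ?_ ?_⟩⟩
  · exact (Category.comp_id _).trans (Category.id_comp _).symm
  · refine (Category.assoc _ _ _).trans ?_
    refine (congrArg _ s.iso.hom_inv_id).trans ((Category.comp_id _).trans (Category.id_comp _).symm)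
  · refine (congrArg _ ((shiftFunctor (Ho R) (1 : ℤ)).map_id _)).trans ?_
    exact Category.comp_id _

lemma hmap_conn : hmap h s.conn (sh (k : ℤ) (sh (k : ℤ) (hoOne R h))) = sh 1 (qcl s.M s.y s.d_y) := by
  have h1 : hmap h s.iso.inv (sh (k : ℤ) (sh (k : ℤ) (hoOne R h))) =
      qcl _ _ (d_attach_gen s.M (2 * k - 1) s.y s.y_mem s.d_y) := by
    rw [← hmap_iso, ← hmap_comp, Iso.hom_inv_id, hmap_id]
  refine (hmap_comp _ _ _ _).trans ((congrArg _ h1).trans ?_)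
  exact hoCone_mor₃ (coneIn s.att) s.d_y _

/-- In the cofiber the generator is (y, e). Multiplying by m kills the first coordinate, as y m = 0,
and leaves the image of e m. -/
lemma hmap_proj_y : hmap h s.proj (qcl s.next.M s.next.y s.next.d_y) =
    ract D.m D.d_m _ (sh (k : ℤ) (sh (k : ℤ) (hoOne R h))) := by
  rw [← hmap_iso, ← hmap_ract]
  refine (hmap_comp _ _ _ _).trans (congrArg _ ?_)
  refine (hmap_qcl (coneIn (coneIn s.att)) _ s.next.d_y).trans ?_
  refine Eq.trans ?_ (ract_qcl D.m D.d_m _ _ _).symm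
  refine qcl_eq_iff.2 ⟨0, (map_zero _).trans (sub_eq_zero.2 ?_).symm⟩
  refine Eq.trans ?_ (act_cmk (coneIn s.att) s.y (cell s.att (R.one h)) D.m).symm
  rw [s.y_m, act_cell, R.one_comp]
  rfl

end AttachStage

/-- The tower of iterated cell attachments starting with the zero module. -/
def tower : ∀ k : ℕ, AttachStage D k
  -- Attaching along the zero cycle of degree -1 makes the first cell a free cell in degree 0.
  | 0 => ⟨zeroMod R, 0, zero_mem _, map_zero _, by rw [map_zero, LinearMap.zero_apply]⟩
  | k + 1 => (tower k).next

lemma d_cell_one : ((tower D 1).M.obj h).d (cell (tower D 0).att (R.one h)) = 0 :=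
  (cone_cycle_iff _).2 ⟨d_shE_eq_zero_iff.2 (d_one R h), Subsingleton.elim (α := PUnit) _ _⟩

lemma hmap_proj_first :
    hmap h (tower D 0).proj
      (qcl (tower D 1).M (cell (tower D 0).att (R.one h)) (d_cell_one D)) =
      sh ((0 : ℕ) : ℤ) (sh ((0 : ℕ) : ℤ) (hoOne R h)) := by
  rw [← (tower D 0).hmap_iso]
  exact (hmap_comp _ _ _ _).trans (congrArg _ (hmap_qcl (coneIn (coneIn (tower D 0).att)) _ (d_cell_one D)))

lemma isIso_proj : IsIso (tower D 0).proj := by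
  have h1 : IsIso ((toHo R).map (coneIn (coneIn (tower D 0).att))) :=
    Localization.inverts _ (quasiIso R) _ (coneIn_quasiIso (R := R) _)
  have h2 : IsIso (tower D 0).iso.hom := Iso.isIso_hom _
  exact @IsIso.comp_isIso _ _ _ _ _ _ _ h1 h2

/-- The tower as a filtered object. -/
def towerFiltered (n : ℕ) : FilteredObj (hoTriangles R) (fun k : ℕ => (hoFree R h)⟦(k : ℤ)⟧)
    (fun k : ℕ => suspMap (hoMap (⟨D.m, D.m_mem, D.d_m⟩ : (R.Hom h h).cycles 1)) k) n where
  F k := (toHo R).obj (tower D k).M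
  isZero := Ho.isZero_zeroMod
  i k := (tower D k).incl
  π k := (tower D k).proj
  δ k := (tower D k).conn
  mem k _ := (tower D k).mem_hoTriangles
  isIso := isIso_proj D
  -- Both maps leave a suspended free module. On its generator, the connecting map gives the cycle
  -- of stage k + 1, whose projection is the previous generator times m, as for Σ^{k+1} f_{k+1}.
  comp_eq k _ := by
    refine (isGen_sh_sh h (i := ((k + 1 : ℕ) : ℤ)) (j := ((k + 1 : ℕ) : ℤ)) rfl).ext ?_
    refine (hmap_comp _ _ _ _).trans ?_
    refine Eq.trans ?_ (hmap_comp _ _ _ _).symm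
    refine (congrArg _ (tower D (k + 1)).hmap_conn).trans ?_
    refine (hmap_sh 1 (tower D k).proj _).trans ((congrArg _ (tower D k).hmap_proj_y).trans ?_)
    rw [hmap_sh, hmap_suspMap, hmap_hoMap, sh_add, ract_sh, ract_sh, ract_hoOne]

section Desc

variable {N : DGMod R} (u : ℕ → (N.obj h).V) (hu : ∀ k : ℕ, u k ∈ (N.obj h).gr (2 * k))
  (hdu : ∀ k, (N.obj h).d (u k) = 0) (hum : ∀ k, N.act (u k) D.m = 0)

/-- Maps out of the tower. -/
def towerDesc : ∀ k : ℕ, {α : (tower D k).M ⟶ N // (α.app h).lin (tower D k).y = 0}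
  | 0 => ⟨ofZero N, rfl⟩
  -- The new cell goes to `u k`. The vanishing on `y` is carried along because it is what permits
  -- the next extension; it persists since u_k m = 0.
  | k + 1 => ⟨attachDesc (tower D k).M (2 * k - 1) (tower D k).y (tower D k).y_mem
      (tower D k).d_y (towerDesc k).1 (towerDesc k).2 (u k) (sub_add_cancel _ 1) (hu k) (hdu k), by
        refine (attachDesc_apply _ _ _ _ _ _ _ _ _ _ _ _ _).trans ?_
        rw [hum, map_zero, add_zero]⟩

lemma towerDesc_cell (k : ℕ) {a : ι} (r : (R.Hom a h).V) :
    ((towerDesc D u hu hdu hum (k + 1)).1.app a).lin (cell (tower D k).att r) =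
      N.act (u k) r := by
  refine (attachDesc_apply (tower D k).M (2 * k - 1) (tower D k).y (tower D k).y_mem
    (tower D k).d_y (towerDesc D u hu hdu hum k).1 (towerDesc D u hu hdu hum k).2 (u k)
    (sub_add_cancel _ 1) (hu k) (hdu k) r 0).trans ?_
  rw [map_zero, add_zero]

lemma towerFiltered_incl_desc (n k : ℕ) : (towerFiltered D n).incl k ≫
      (toHo R).map (towerDesc D u hu hdu hum (k + 1)).1 =
    (toHo R).map (towerDesc D u hu hdu hum 1).1 := by
  induction k with
  | zero => exact Category.id_comp _
  | succ k ih =>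
    refine (Category.assoc _ _ _).trans (Eq.trans (congrArg _ ?_) ih)
    exact ((toHo R).map_comp _ _).symm.trans (congrArg _ (coneIn_attachDesc _ _ _ _ _ _
      (towerDesc D u hu hdu hum (k + 1)).2 _ (sub_add_cancel _ 1) (hu (k + 1)) (hdu (k + 1))))

lemma hmap_towerDesc_one : hmap h ((toHo R).map (towerDesc D u hu hdu hum 1).1)
      (qcl (tower D 1).M (cell (tower D 0).att (R.one h)) (d_cell_one D)) =
    qcl N (u 0) (hdu 0) :=
  hmap_qcl' _ ((towerDesc_cell D u hu hdu hum 0 _).trans (N.act_one _))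

end Desc

end

end DG

/-! ### The Toda bracket: existence of an element. -/

namespace DG

open DGMod

namespace Ea

/-! ### The Toda bracket -/

section Toda

variable (H : FinSub) (n : ℕ)

/-- The iterated cell attachments along `m_1^H` as an element of `{[m_1], …, Σ^{n-1}[m_1]}`. -/
def towerObj : FilteredObj (hoTriangles Ea) (fun k : ℕ => (hoFree Ea (.fin H))⟦(k : ℤ)⟧)
    (fun k : ℕ => suspMap (hoMap (m₁ H)) k) n :=
  towerFiltered (twistData H) n

/-- The elements `f_0^H, 0, 0, …` which define a map from the tower to `F_𝕋`. -/
def descElt (k : ℕ) : (Ea.Hom (.fin H) .circ).V := if k = 0 then (f₀ H).1 else 0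

lemma descElt_mem (k : ℕ) : descElt H k ∈ (Ea.Hom (.fin H) .circ).gr (2 * k) := by
  unfold descElt
  split_ifs with hk
  · subst hk
    exact (f₀ H).2.1
  · exact zero_mem _

lemma descElt_comp_m₁ (k : ℕ) : Ea.comp (descElt H k) (m₁ H).1 = 0 := by
  unfold descElt
  split_ifs
  · exact f₀_comp_m₁ H
  · rw [map_zero, LinearMap.zero_apply]

/-- The maps from the stages of the tower to `F_𝕋` which extend `f_0^H`. -/
def towerMap (k : ℕ) : (toHo Ea).obj (tower (twistData H) k).M ⟶ hoFree Ea .circ :=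
  (toHo Ea).map (towerDesc (twistData H) (N := free Ea .circ) (descElt H) (descElt_mem H)
    (fun _ => d_fin _) (descElt_comp_m₁ H) k).1

lemma firstOne_towerObj : firstOne (towerObj H n) =
    qcl (tower (twistData H) 1).M (cell (tower (twistData H) 0).att (Ea.one (.fin H)))
      (d_cell_one (twistData H)) := by
  have := (towerObj H n).isIso
  have h1 : Function.Injective (hmap (R := Ea) (Cell.fin H) ((towerObj H n).π 0)) :=
    (hmap_iso_bijective (R := Ea) (Cell.fin H) ((towerObj H n).π 0)).1
  exact h1 ((hmap_firstOne (towerObj H n)).trans (hmap_proj_first (twistData H)).symm)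

lemma σ'_comp_towerMap : (towerObj H n).σ' ≫ towerMap H (n + 1) = hoMap (f₀ H) := by
  have h0 : IsGen (R := Ea) (.fin H) 0 ((hoFree Ea (.fin H))⟦((0 : ℕ) : ℤ)⟧)
      (sh ((0 : ℕ) : ℤ) (hoOne Ea (.fin H))) :=
    IsGen.shift (R := Ea) (zero_add _) (isGen_hoOne (R := Ea) (Cell.fin H))
  have h1 : hmap (.fin H) ((towerObj H n).incl n ≫ towerMap H (n + 1))
      (firstOne (towerObj H n)) = hmap (.fin H) (towerMap H 1)
        (qcl (tower (twistData H) 1).M (cell (tower (twistData H) 0).att (Ea.one (.fin H)))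
          (d_cell_one (twistData H))) := by
    rw [← firstOne_towerObj H n]
    exact congrArg (fun f => hmap (R := Ea) (Cell.fin H) f (firstOne (towerObj H n)))
      (towerFiltered_incl_desc (twistData H) _ _ _ _ n n)
  have h2 : hmap (.fin H) ((towerObj H n).σ' ≫ towerMap H (n + 1))
      (sh 0 (hoOne Ea (.fin H))) = hmap (.fin H) (hoMap (f₀ H)) (sh 0 (hoOne Ea (.fin H))) := by
    refine (hmap_comp (R := Ea) (Cell.fin H) (towerObj H n).σ' (towerMap H (n + 1)) _).trans ?_
    refine (congrArg _ (hmap_σ' (towerObj H n))).trans ?_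
    refine (hmap_comp (R := Ea) (Cell.fin H) _ _ _).symm.trans (h1.trans ?_)
    exact (hmap_towerDesc_one (twistData H) _ _ _ _).trans (hmap_hoMap (f₀ H)).symm
  exact h0.ext h2

/-- The class ∑ x_j g_{n-j} is itself the lift: it corresponds to a map β, and its projection e_n
g_1 is the value of the suspended [g_1]. -/
lemma exists_lift {x : FilteredObj (hoTriangles Ea) (fun k : ℕ => (hoFree Ea (.fin H))⟦(k : ℤ)⟧)
    (fun k : ℕ => suspMap (hoMap (m₁ H)) k) n} :
    ∃ β : (((hoFree Ea .circ)⟦((n + 1 : ℕ) : ℤ)⟧)⟦(n : ℤ)⟧) ⟶ x.X,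
      β ≫ x.σ = (suspMap (hoMap (g₁ H)) n)⟦(n : ℤ)⟧' := by
  obtain ⟨ξ, -, -, h3⟩ := exists_seqHo x n le_rfl
  have hgen := isGen_sh_sh (R := Ea) Cell.circ
    (show ((n + 1 : ℕ) : ℤ) + (n : ℤ) = 2 * n + 1 by push_cast; ring)
  obtain ⟨β, hβ, -⟩ := hgen.2 x.X _ (seqPair_mem (g_mem H) ξ)
  refine ⟨β, hgen.ext ?_⟩
  refine (hmap_comp _ _ _ _).trans ((congrArg _ hβ).trans (h3.trans ?_))
  unfold cellOne
  rw [hmap_sh, hmap_suspMap, hmap_hoMap, ract_sh, ract_sh, ract_hoOne]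
  rfl

theorem todaBracket_eq : todaBracket (hoTriangles Ea)
      (fun k : ℕ => (hoFree Ea (.fin H))⟦(k : ℤ)⟧) (hoMap (f₀ H))
      (fun k : ℕ => suspMap (hoMap (m₁ H)) k) n (suspMap (hoMap (g₁ H)) n) =
    {desuspMap n (hoMap (f₀g H n))} := by
  refine Set.Subset.antisymm ?_ ?_
  · rintro θ ⟨x, β, α, hβ, hα, rfl⟩
    exact comp_eq_desuspMap x hβ hα
  · rintro θ rfl
    obtain ⟨β, hβ⟩ := exists_lift H n (x := towerObj H n)
    exact ⟨towerObj H n, β, towerMap H (n + 1), hβ, σ'_comp_towerMap H n,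
      (comp_eq_desuspMap (towerObj H n) hβ (σ'_comp_towerMap H n)).symm⟩

end Toda

end Ea

end DG

/-! ### The Massey product and its comparison with the Toda bracket. -/

namespace DG

open DGMod

lemma comp_eps {ι : Type} {R : DGRing ι} {a b c : ι} (n : ℤ) (x : (R.Hom b c).V)
    (y : (R.Hom a b).V) : R.comp (eps n x) y = (n + 1).negOnePow • R.comp x y := by
  rw [eps, Units.smul_def, Units.smul_def, map_zsmul, LinearMap.smul_apply]

lemma degU_zero_one (j : ℕ) : degU 0 (fun _ => 1) j = 2 * j := by
  simp [degU]
  ring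

lemma degA_one {i j : ℕ} (h : i < j) : degA (fun _ => 1) i j = 2 * (j - i) - 1 := by
  simp [degA, Nat.cast_sub h.le]
  ring

lemma degV_one_one {m i : ℕ} (h : i ≤ m) : degV 1 (fun _ => 1) m i = 2 * ((m - i : ℕ) : ℤ) + 1 := by
  simp [degV, Nat.cast_sub h]
  ring

namespace Ea

/-! ### The Massey product -/

section Massey

variable (H : FinSub) (n : ℕ)

/-- The differential of E_a(K, -) is zero for finite K, so each class has only one representative.
-/
lemma cycle_eq_of_cls_eq {a : Cell} {K : FinSub} {p : ℤ} {c c' : (Ea.Hom (.fin K) a).cycles p}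
    (h : Cx.cls c = Cx.cls c') : c.1 = c'.1 := by
  obtain ⟨w, -, hw⟩ := (Cx.cls_eq_zero_iff (c - c')).1 (sub_eq_zero.2 h)
  exact sub_eq_zero.1 (hw.symm.trans (d_fin w))

/-- Elements of degree 2 are multiples of the cycle g_2, so there are no nonzero boundaries in
degree 1. -/
lemma eq_g₁_of_cls_eq {c : (Ea.Hom .circ (.fin H)).cycles 1} (h : Cx.cls c = Cx.cls (g₁ H)) :
    c.1 = g H 0 := by
  obtain ⟨w, hw, hdw⟩ := (Cx.cls_eq_zero_iff (c - g₁ H)).1 (sub_eq_zero.2 h)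
  obtain ⟨r, rfl⟩ := gEven_of_mem H (k := 0) (by simpa using hw)
  refine sub_eq_zero.1 (hdw.symm.trans ((eHom_d_single _ _).trans ?_))
  exact smul_zero (A := EBasis .circ (.fin H) →₀ ℚ) _

lemma eq_g_of_d_eq {k : ℕ} {x : (Ea.Hom .circ (.fin H)).V}
    (hx : x ∈ (Ea.Hom .circ (.fin H)).gr (2 * ((k + 1 : ℕ) : ℤ) + 1))
    (hd : (Ea.Hom .circ (.fin H)).d x = Ea.comp (m₁ H).1 (g H k)) : x = g H (k + 1) := by
  obtain ⟨r, rfl⟩ := gOdd_of_mem H hx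
  have h : (r • (EBasis.gOdd H (k + 1)).diff : EBasis .circ (.fin H) →₀ ℚ) =
      Finsupp.single (EBasis.gEven H k) 1 :=
    (eHom_d_single (EBasis.gOdd H (k + 1)) r).symm.trans (hd.trans (m₁_comp_g H k))
  simp only [EBasis.diff, Finsupp.smul_single, smul_eq_mul, mul_one] at h
  rw [Finsupp.single_injective _ h]
  rfl

/-- The defining system of the Massey product `⟨[f_0], [m_1], …, [m_1], [g_1]⟩`. -/
def definingSystem : DefiningSystem Ea (fun _ : ℕ => .fin H) (fun _ : ℕ => 1)
    (Cx.cls (f₀ H)) (fun _ : ℕ => Cx.cls (m₁ H)) n (Cx.cls (g₁ H)) where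
  u := descElt H
  a i j := if j = i + 1 then (m₁ H).1 else 0
  v i := g H (n - i)
  u_mem j _ := by
    rw [degU_zero_one]
    exact descElt_mem H j
  a_mem i j hij _ := by
    rw [degA_one hij]
    split_ifs with h
    · subst h
      have h1 : (2 * (((i + 1 : ℕ) : ℤ) - i) - 1) = 1 := by push_cast; ring
      rw [h1]
      exact (m₁ H).2.1
    · exact zero_mem _
  v_mem i hi := by
    rw [degV_one_one hi]
    exact g_mem H (n - i)
  u_rep := ⟨f₀ H, rfl, rfl⟩
  a_rep k _ := ⟨m₁ H, (if_pos rfl).symm, rfl⟩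
  v_rep := ⟨g₁ H, by rw [Nat.sub_self]; rfl, rfl⟩
  d_u j _ := by
    refine (d_fin _).trans (Finset.sum_eq_zero fun r _ => ?_).symm
    rw [comp_eps]
    split_ifs
    · rw [descElt_comp_m₁, smul_zero]
    · rw [map_zero, smul_zero]
  d_a i j _ _ := by
    refine (d_fin _).trans (Finset.sum_eq_zero fun r _ => ?_).symm
    rw [comp_eps]
    split_ifs
    · rw [m₁_comp_m₁, smul_zero]
    · rw [map_zero, smul_zero]
    · rw [map_zero, LinearMap.zero_apply, smul_zero]
    · rw [map_zero, smul_zero]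
  d_v i hi := by
    rcases hi.lt_or_eq with hi | rfl
    · have h1 : n - i = n - (i + 1) + 1 := by omega
      rw [Finset.sum_eq_single_of_mem (i + 1) (Finset.mem_Ioc.2 ⟨by omega, hi⟩), comp_eps, if_pos rfl,
        degA_one (Nat.lt_succ_self i), h1]
      -- m has odd degree, so ε(m) = m and the equation is d g_{2k+3} = m g_{2k+1} without sign.
      · have h2 : (2 * (((i + 1 : ℕ) : ℤ) - i) - 1 + 1) = 2 * 1 := by push_cast; ring
        rw [h2, Int.negOnePow_two_mul, one_smul]
        exact (d_g_succ H _).trans (m₁_comp_g H _).symm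
      · intro r _ hr
        rw [comp_eps, if_neg hr, map_zero, LinearMap.zero_apply, smul_zero]
    · rw [Nat.sub_self, Finset.Ioc_self, Finset.sum_empty]
      exact d_g_zero H

variable {H n} (s : DefiningSystem Ea (fun _ : ℕ => .fin H) (fun _ : ℕ => 1)
    (Cx.cls (f₀ H)) (fun _ : ℕ => Cx.cls (m₁ H)) n (Cx.cls (g₁ H)))

lemma definingSystem_u_zero : s.u 0 = (f₀ H).1 := by
  obtain ⟨c, hc, h⟩ := s.u_rep
  exact hc.symm.trans (cycle_eq_of_cls_eq h)

lemma definingSystem_u_eq_zero {j : ℕ} (hj : j ≠ 0) (hjn : j ≤ n) : s.u j = 0 := by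
  have h := s.u_mem j hjn
  rw [degU_zero_one] at h
  exact hom_fin_circ_eq_zero H (by omega) h

lemma definingSystem_a_succ {i : ℕ} (hi : i < n) : s.a i (i + 1) = (m₁ H).1 := by
  obtain ⟨c, hc, h⟩ := s.a_rep i hi
  exact hc.symm.trans (cycle_eq_of_cls_eq h)

lemma definingSystem_a_eq_zero {i j : ℕ} (hij : i + 1 < j) (hjn : j ≤ n) : s.a i j = 0 := by
  have h := s.a_mem i j (by omega) hjn
  rw [degA_one (by omega)] at h
  exact hom_fin_fin_eq_zero H (by omega) h

/-- The induction climbs the last column from its bottom entry g_1. As `a` vanishes away from its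
entries m, each entry solves d x = m g_{2k+1}, and d is injective in degree 2k+3. -/
lemma definingSystem_v {k : ℕ} (hk : k ≤ n) : s.v (n - k) = g H k := by
  induction k with
  | zero =>
    obtain ⟨c, hc, h⟩ := s.v_rep
    exact hc.symm.trans (eq_g₁_of_cls_eq H h)
  | succ k ih =>
    have h1 := s.v_mem (n - (k + 1)) (by omega)
    rw [degV_one_one (by omega), show n - (n - (k + 1)) = k + 1 by omega] at h1
    refine eq_g_of_d_eq H h1 ((s.d_v (n - (k + 1)) (by omega)).trans ?_)
    have h2 : n - (k + 1) + 1 = n - k := by omega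
    rw [Finset.sum_eq_single_of_mem (n - (k + 1) + 1) (Finset.mem_Ioc.2 ⟨by omega, by omega⟩),
      comp_eps, definingSystem_a_succ s (by omega), degA_one (Nat.lt_add_one _), h2,
      ih (by omega)]
    · have h3 : (2 * (((n - (k + 1) + 1 : ℕ) : ℤ) - (n - (k + 1) : ℕ)) - 1 + 1) = 2 * 1 := by
        push_cast; ring
      have h4 := h2 ▸ h3
      rw [h4, Int.negOnePow_two_mul, one_smul]
    · intro r hr hr'
      have := Finset.mem_Ioc.1 hr
      rw [comp_eps, definingSystem_a_eq_zero s (by omega) this.2, map_zero, LinearMap.zero_apply,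
        smul_zero]

/-- All u_r with r > 0 vanish for degree reasons, and ε(f_0) = -f_0 because f_0 has degree 0. -/
lemma definingSystem_sum : ∑ r ∈ Finset.range (n + 1),
    Ea.comp (eps (degU 0 (fun _ => 1) r) (s.u r)) (s.v r) = (-i H n).1 := by
  rw [Finset.sum_eq_single_of_mem 0 (Finset.mem_range.2 n.succ_pos), comp_eps,
    definingSystem_u_zero, degU_zero_one]
  · have h1 : s.v 0 = g H n := by
      have h := definingSystem_v s le_rfl
      rwa [Nat.sub_self] at h
    have h2 : (2 * ((0 : ℕ) : ℤ) + 1) = 1 := by norm_num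
    rw [h1, f₀_comp_g, h2, Int.negOnePow_one, Units.neg_smul, one_smul]
    rfl
  · intro r hr hr'
    rw [comp_eps, definingSystem_u_eq_zero s hr' (by have := Finset.mem_range.1 hr; omega), map_zero,
      LinearMap.zero_apply, smul_zero]

theorem masseyProduct_eq (q : 0 + ∑ k ∈ Finset.range n, (fun _ : ℕ => (1 : ℤ)) k + 1 + n =
      2 * n + 1) :
    masseyProduct Ea (fun _ : ℕ => .fin H) (fun _ : ℕ => 1) (Cx.cls (f₀ H))
      (fun _ : ℕ => Cx.cls (m₁ H)) n (Cx.cls (g₁ H)) (2 * n + 1) q = {-Cx.cls (i H n)} := by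
  refine Set.Subset.antisymm ?_ ?_
  · rintro γ ⟨s, c, hc, rfl⟩
    have h : c = -i H n := Subtype.ext (hc.trans (definingSystem_sum s))
    rw [h]
    rfl
  · rintro γ rfl
    exact ⟨definingSystem H n, -i H n, (definingSystem_sum _).symm, rfl⟩

end Massey

lemma hoMap_eq_of_cls_eq {ι : Type} {R : DGRing ι} {G G' : ι} {p : ℤ}
    {z z' : (R.Hom G G').cycles p} (h : Cx.cls z = Cx.cls z') : hoMap z = hoMap z' := by
  obtain ⟨w, -, hw⟩ := (Cx.cls_eq_zero_iff (z - z')).1 (sub_eq_zero.2 h)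
  have hG : IsGen G p ((hoFree R G)⟦p⟧) (sh p (hoOne R G)) :=
    IsGen.shift (zero_add p) (isGen_hoOne G)
  refine hG.ext ?_
  rw [hmap_hoMap, hmap_hoMap]
  exact qcl_eq_iff.2 ⟨w, hw⟩

lemma f₀g_eq_i (H : FinSub) (n : ℕ) : f₀g H n = i H n := Subtype.ext (f₀_comp_g H n)

end Ea

end DG

end

theorem proposition6p5 (H : DG.FinSub) (n : ℕ) :
    -- the higher Toda bracket `⟨[f_0], [m_1], Σ[m_1], …, Σ^{n-1}[m_1], Σ^n[g_1]⟩_T`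
    DG.todaBracket (DG.hoTriangles DG.Ea)
        (fun k : ℕ => (DG.hoFree DG.Ea (.fin H))⟦(k : ℤ)⟧)
        (DG.hoMap (DG.Ea.f₀ H))
        (fun k : ℕ => DG.suspMap (DG.hoMap (DG.Ea.m₁ H)) k)
        n
        (DG.suspMap (DG.hoMap (DG.Ea.g₁ H)) n)
      = {DG.desuspMap n (DG.hoMap (DG.Ea.f₀g H n))} ∧
    DG.hoMap (DG.Ea.f₀g H n) = DG.hoMap (DG.Ea.i H n) ∧
    -- the Massey product `⟨[f_0], [m_1], …, [m_1], [g_1]⟩`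
    DG.masseyProduct DG.Ea (fun _ : ℕ => .fin H) (fun _ : ℕ => 1)
        (DG.Cx.cls (DG.Ea.f₀ H))
        (fun _ : ℕ => DG.Cx.cls (DG.Ea.m₁ H))
        n
        (DG.Cx.cls (DG.Ea.g₁ H))
        (2 * n + 1) (by simp; ring)
      = {-DG.Cx.cls (DG.Ea.i H n)} ∧
    -- the two agree up to the sign `-1`, when cycles are viewed as homotopy classes of maps
    DG.todaBracket (DG.hoTriangles DG.Ea)
        (fun k : ℕ => (DG.hoFree DG.Ea (.fin H))⟦(k : ℤ)⟧)
        (DG.hoMap (DG.Ea.f₀ H))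
        (fun k : ℕ => DG.suspMap (DG.hoMap (DG.Ea.m₁ H)) k)
        n
        (DG.suspMap (DG.hoMap (DG.Ea.g₁ H)) n)
      = {θ | ∃ z : (DG.Ea.Hom .circ .circ).cycles (2 * n + 1),
          DG.Cx.cls (-z) ∈ DG.masseyProduct DG.Ea (fun _ : ℕ => .fin H) (fun _ : ℕ => 1)
            (DG.Cx.cls (DG.Ea.f₀ H))
            (fun _ : ℕ => DG.Cx.cls (DG.Ea.m₁ H))
            n
            (DG.Cx.cls (DG.Ea.g₁ H))
            (2 * n + 1) (by simp; ring) ∧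
          θ = DG.desuspMap n (DG.hoMap z)} := by
  refine ⟨DG.Ea.todaBracket_eq H n, by rw [DG.Ea.f₀g_eq_i], DG.Ea.masseyProduct_eq _, ?_⟩
  rw [DG.Ea.todaBracket_eq, DG.Ea.masseyProduct_eq, DG.Ea.f₀g_eq_i]
  refine Set.Subset.antisymm ?_ ?_
  · rintro θ rfl
    exact ⟨DG.Ea.i H n, rfl, rfl⟩
  · rintro θ ⟨z, hz, rfl⟩
    -- The class of `-z` is definitionally minus the class of `z`, so `z` is homologous to i_{2n+1}
    -- and gives the same map.
    have h : -DG.Cx.cls z = -DG.Cx.cls (DG.Ea.i H n) := hz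
    rw [DG.Ea.hoMap_eq_of_cls_eq (neg_injective h)]
    rfl
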